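/- For a prime number $p\neq 2$ put $p^*=\left(\frac{-1}{p}\right)p$ and $f_p=\mathrm{ord}_2\left(\frac{p^*-1}{4}\right)$. For a number field $F$ let $F_n$ be the $n$-th layer of its cyclotomic $\mathbb Z_2$-extension $F_{cyc}$, i.e. the unique field $F\subseteq F_n\subseteq F_{cyc}$ with $[F_n:F]=2^n$, and let $\zeta_{F_n}$ be the (analytically continued) Dedekind zeta function of $F_n$. Let $\mathrm{ord}_2$ be the order function on $\overline{\mathbb Q}$ with $\mathrm{ord}_2(2)=1$ (for any choice of a place above $2$). For $n\ge 1$ let $\chi_n$ be any primitive character of $\mathrm{Gal}(\mathbb Q_n/\mathbb Q)$, viewed as a Dirichlet character modulo $2^{n+2}$, and let $\psi_d$ be the Dirichlet character of $\mathbb Q(\sqrt d)/\mathbb Q$; products of characters are understood as primitive characters. Let $m$ be a positive even integer. (1) For all integers $n\ge 0$, $\zeta_{\mathbb Q_n}(1-m)$ is a non-zero algebraic number and $$\mathrm{ord}_2\,\zeta_{\mathbb Q_n}(1-m)=2^n-n-2-\mathrm{ord}_2(m).$$ (2) Let $d>1$ be an odd square-free integer and $K=\mathbb Q(\sqrt d)$.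 The numbers $L(\psi_d,1-m)$ and $L(\chi_n\psi_d,1-m)$ ($n\ge 1$) are algebraic and non-zero. Let $n_d$ be any positive integer such that $$\mathrm{ord}_2\,L(\chi_n\psi_d,1-m)=1+2^{1-n}\Bigl(-1+\sum_{p\mid d}2^{f_p}\Bigr)\quad\text{for all } n\ge n_d;$$ one can take $n_d=\lceil \max_{p\mid d}f_p+\log_2\tau(d)+2\rceil$, where $\tau(d)$ is the number of distinct prime divisors of $d$. Then for all $n\ge n_d$, $\zeta_{K_n}(1-m)$ is a non-zero algebraic number and $$\mathrm{ord}_2\,\zeta_{K_n}(1-m)=2\cdot 2^n+\Bigl(-2+\sum_{p\mid d}2^{f_p}\Bigr)n+\nu'_{m,d},$$ where $$\nu'_{m,d}=\mathrm{ord}_2\!\left(\frac{L(\psi_d,1-m)}{4m}\right)-2^{n_d}+n_d\Bigl(1-\sum_{p\mid d}2^{f_p}\Bigr)+\sum_{k=1}^{n_d}2^{k-1}\,\mathrm{ord}_2\,L(\chi_k\psi_d,1-m).$$ The constant $\nu'_{m,d}$ depends only on $m$ and $d$ (not on the place above $2$, the characters $\chi_k$ or the choice of $n_d$). -/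

import Mathlib

noncomputable section

namespace TwoAdicZeta

/-! ### The cyclotomic `ℤ₂`-extension and its layers -/

/-- `ℚ_cyc`, the cyclotomic `ℤ₂`-extension of `ℚ`: the maximal real subfield of `ℚ(μ_{2^∞})`, that
is, the union over `k` of the fields `ℚ(ζ + ζ⁻¹)` with `ζ` running through the `2^k`-th roots of
unity. -/
def cyclotomicRat : IntermediateField ℚ ℂ :=
  IntermediateField.adjoin ℚ {x : ℂ | ∃ (k : ℕ) (ζ : ℂ), ζ ^ (2 ^ k) = 1 ∧ x = ζ + ζ⁻¹}

/-- `F_cyc = F · ℚ_cyc`, the cyclotomic `ℤ₂`-extension of `F`. -/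
def cyclotomicExt (F : IntermediateField ℚ ℂ) : IntermediateField ℚ ℂ :=
  F ⊔ cyclotomicRat

/-- `E` is an `n`-th layer of the cyclotomic `ℤ₂`-extension of `F`: an intermediate field of
`F_cyc / F` with `[E : F] = 2 ^ n`. -/
structure IsLayer (F : IntermediateField ℚ ℂ) (n : ℕ) (E : IntermediateField ℚ ℂ) : Prop where
  le : F ≤ E
  le_cyclotomicExt : E ≤ cyclotomicExt F
  degree : IntermediateField.relfinrank F E = 2 ^ n

/-- The real quadratic field `ℚ(√d)` inside `ℂ`. -/
def quadField (d : ℕ) : IntermediateField ℚ ℂ :=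
  IntermediateField.adjoin ℚ {((Real.sqrt d : ℝ) : ℂ)}

/-- Layers over a number field are number fields. -/
theorem IsLayer.numberField {F E : IntermediateField ℚ ℂ} {n : ℕ} [FiniteDimensional ℚ F]
    (h : IsLayer F n E) : NumberField E := by
  have hr := h.degree
  rw [IntermediateField.relfinrank_eq_finrank_of_le h.le] at hr
  have hfin : FiniteDimensional F (IntermediateField.extendScalars h.le) :=
    Module.finite_of_finrank_pos (by rw [hr]; positivity)
  have h1 : FiniteDimensional ℚ (IntermediateField.extendScalars h.le) :=
    FiniteDimensional.trans ℚ F _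
  have h2 : FiniteDimensional ℚ E := h1
  exact ⟨⟩

/-! ### The Dedekind zeta function -/

/-- `Z` is the Dedekind zeta function of `E`, continued to `ℂ` minus the point `1`. -/
structure IsDedekindZeta (E : Type*) [Field E] [NumberField E] (Z : ℂ → ℂ) : Prop where
  differentiableOn : DifferentiableOn ℂ Z {1}ᶜ
  eq_dedekindZeta : ∀ s : ℂ, 1 < s.re → Z s = NumberField.dedekindZeta E s

/-- The continuation of the Dedekind zeta function is unique away from `1`. -/
theorem IsDedekindZeta.unique {E : Type*} [Field E] [NumberField E] {Z W : ℂ → ℂ}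
    (hZ : IsDedekindZeta E Z) (hW : IsDedekindZeta E W) {s : ℂ} (hs : s ≠ 1) : Z s = W s := by
  have hZ' := hZ.differentiableOn.analyticOnNhd isOpen_compl_singleton
  have hW' := hW.differentiableOn.analyticOnNhd isOpen_compl_singleton
  have hc : IsPreconnected ({1}ᶜ : Set ℂ) :=
    (isConnected_compl_singleton_of_one_lt_rank (by simp) 1).isPreconnected
  refine hZ'.eqOn_of_preconnected_of_eventuallyEq hW' hc (z₀ := 2) (by simp) ?_ hs
  have ho : IsOpen {s : ℂ | 1 < s.re} := isOpen_lt continuous_const Complex.continuous_re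
  filter_upwards [ho.mem_nhds (by simp : (2 : ℂ) ∈ {s : ℂ | 1 < s.re})] with t ht
  rw [hZ.eq_dedekindZeta t ht, hW.eq_dedekindZeta t ht]

/-! ### The `2`-adic order on `ℚ̄` -/

/-- A choice of an embedding of `ℚ̄` (the algebraic numbers in `ℂ`) into `ℚ̄₂`, i.e. of a place
of `ℚ̄` above `2`. -/
abbrev Embedding2 : Type := algebraicClosure ℚ ℂ →+* PadicAlgCl 2

open Classical in
/-- The order function on `ℚ̄` normalized by `ord₂ 2 = 1` (for the chosen place); it is only
used at non-zero algebraic numbers. -/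
def ord2 (ι : Embedding2) (z : ℂ) : ℝ :=
  if h : z ∈ algebraicClosure ℚ ℂ then - Real.logb 2 ‖ι ⟨z, h⟩‖ else 0

/-- `z` is a non-zero algebraic number with `ord₂ z = r`. -/
def HasOrd2 (ι : Embedding2) (z : ℂ) (r : ℝ) : Prop :=
  IsAlgebraic ℚ z ∧ z ≠ 0 ∧ ord2 ι z = r

/-! ### Dirichlet characters and `L`-functions -/

/-- The `L`-function of (the primitive character attached to) a Dirichlet character. -/
def primLFunction {N : ℕ} [NeZero N] (χ : DirichletCharacter ℂ N) (s : ℂ) : ℂ :=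
  haveI : NeZero χ.conductor := ⟨χ.conductor_ne_zero⟩
  χ.primitiveCharacter.LFunction s

theorem jacobi_val_mul (d : ℕ) [NeZero d] (a b : ZMod (4 * d)) :
    (if Odd (a * b).val then jacobiSym d (a * b).val else 0) =
      (if Odd a.val then jacobiSym d a.val else 0) *
        (if Odd b.val then jacobiSym d b.val else 0) := by
  have hpar : Odd (a * b).val ↔ Odd a.val ∧ Odd b.val := by
    rw [← Nat.odd_mul, ZMod.val_mul, Nat.odd_iff, Nat.odd_iff,
      Nat.mod_mod_of_dvd _ ⟨2 * d, by ring⟩]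
  by_cases ha : Odd a.val
  · by_cases hb : Odd b.val
    · have hab : Odd (a.val * b.val) := Nat.odd_mul.2 ⟨ha, hb⟩
      have : NeZero a.val := ⟨fun h => by simp [h] at ha⟩
      have : NeZero b.val := ⟨fun h => by simp [h] at hb⟩
      rw [if_pos (hpar.2 ⟨ha, hb⟩), if_pos ha, if_pos hb, ← jacobiSym.mul_right,
        jacobiSym.mod_right' d hab, ZMod.val_mul]
    · rw [if_neg (fun h => hb (hpar.1 h).2), if_neg hb, mul_zero]
  · rw [if_neg (fun h => ha (hpar.1 h).1), if_neg ha, zero_mul]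

/-- The quadratic character of `ℚ(√d)`, as a Dirichlet character modulo `4d`:
it sends the class of an odd `a ≥ 1` to the Jacobi symbol `(d / a)` and even classes to `0`.
By quadratic reciprocity this only depends on `a` modulo `4d`. (For `d ≡ 1 mod 4` it is induced
from modulus `d`; `primLFunction` always passes to the primitive character.) -/
def quadChar (d : ℕ) [NeZero d] : DirichletCharacter ℂ (4 * d) where
  toFun a := (((if Odd a.val then jacobiSym d a.val else 0 : ℤ)) : ℂ)
  map_one' := by
    have hd : 0 < d := Nat.pos_of_ne_zero (NeZero.ne d)
    have : Fact (1 < 4 * d) := ⟨by omega⟩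
    simp [ZMod.val_one]
  map_mul' a b := by rw [jacobi_val_mul]; push_cast; rfl
  map_nonunit' a ha := by
    by_cases ho : Odd a.val
    · rw [if_pos ho]
      have : NeZero a.val := ⟨fun h => by simp [h] at ho⟩
      have : jacobiSym d a.val = 0 := by
        rw [jacobiSym.eq_zero_iff_not_coprime]
        intro hg
        apply ha
        rw [← ZMod.natCast_zmod_val a, ZMod.isUnit_iff_coprime]
        refine Nat.Coprime.mul_right ?_ ?_
        · exact (Nat.Coprime.pow_right 2 ho.coprime_two_right : Nat.Coprime a.val (2 ^ 2))
        · rw [Nat.coprime_comm]; exact hg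
      rw [this, Int.cast_zero]
    · rw [if_neg ho, Int.cast_zero]

/-- `χ` is a primitive character of `Gal(ℚ_n/ℚ)` (`n ≥ 1`), viewed as a Dirichlet character modulo
`2^(n+2)`: since `Gal(ℚ_n/ℚ) = (ℤ/2^(n+2))ˣ / {±1}`, these are the even characters of conductor
exactly `2^(n+2)`. -/
def IsLayerChar {n : ℕ} (χ : DirichletCharacter ℂ (2 ^ (n + 2))) : Prop :=
  χ.Even ∧ χ.IsPrimitive

/-- `L(χ ψ_d, s)` for a Dirichlet character `χ` modulo `2^(n+2)`. -/
def twistedL {n : ℕ} (χ : DirichletCharacter ℂ (2 ^ (n + 2))) (d : ℕ) [NeZero d] (s : ℂ) : ℂ :=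
  haveI : NeZero (Nat.lcm (2 ^ (n + 2)) (4 * d)) :=
    ⟨Nat.lcm_ne_zero (by positivity) (NeZero.ne (4 * d))⟩
  primLFunction (χ.mul (quadChar d)) s

/-! ### The constants -/

/-- `p* = (-1 / p) p`. -/
def pStar (p : ℕ) : ℤ := jacobiSym (-1) p * p

/-- `f_p = ord₂ ((p* - 1) / 4)` (the division is exact for odd primes `p`). -/
def fp (p : ℕ) : ℕ := padicValInt 2 ((pStar p - 1) / 4)

/-- `∑_{p ∣ d} 2^{f_p}`. -/
def sumFp (d : ℕ) : ℝ := ∑ p ∈ d.primeFactors, (2 : ℝ) ^ fp p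

/-- `⌈f + log₂ τ(d) + 2⌉`, where `f = max_{p ∣ d} f_p` and `τ(d)` is the number of distinct
prime divisors of `d`. -/
def explicitBound (d : ℕ) : ℕ :=
  ⌈((d.primeFactors.sup fp : ℕ) : ℝ) + Real.logb 2 (d.primeFactors.card : ℝ) + 2⌉₊

/-- `N` can be taken as `n_d`: it is a positive integer and
`ord₂ L(χ_n ψ_d, 1 - m) = 1 + 2^(1-n) (-1 + ∑_{p ∣ d} 2^{f_p})` for all `n ≥ N`. -/
def IsAdmissible (ι : Embedding2) (χ : ∀ n : ℕ, DirichletCharacter ℂ (2 ^ (n + 2)))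
    (m d : ℕ) [NeZero d] (N : ℕ) : Prop :=
  1 ≤ N ∧ ∀ n : ℕ, N ≤ n →
    HasOrd2 ι (twistedL (χ n) d (1 - m)) (1 + (2 : ℝ) ^ (1 - (n : ℤ)) * (-1 + sumFp d))

/-- The expression defining `ν'_{m,d}`, computed with `N` in the role of `n_d`. -/
def nuPrime (ι : Embedding2) (χ : ∀ n : ℕ, DirichletCharacter ℂ (2 ^ (n + 2)))
    (m d : ℕ) [NeZero d] (N : ℕ) : ℝ :=
  ord2 ι (primLFunction (quadChar d) (1 - m) / (4 * m)) - 2 ^ N + N * (1 - sumFp d)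
    + ∑ k ∈ Finset.Icc 1 N, 2 ^ (k - 1) * ord2 ι (twistedL (χ k) d (1 - m))

end TwoAdicZeta

end

/-!
The layers of the two cyclotomic `ℤ₂`-extensions are abelian over `ℚ`, so their zeta functions are
products of Dirichlet `L`-functions, and the theorem reduces to `2`-adic orders of generalized
Bernoulli numbers.

*Factorization.* Embed an abelian field `E` in `ℚ(μ_N)` and let `charsOf N E` be the characters
modulo `N` that are trivial on the automorphisms fixing `E`. For each prime `p`, the Euler factor of
`ζ_E` is compared with those of the primitive `L`-functions: the characters trivial on inertia at `p`
are those of conductor prime to `p`, and they take each `f`-th root of unity at the Frobenius equally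
often, where `f` is the residue degree. As `ζ_E` is an Euler product over the primes of `E`, this
gives `ζ_E = ∏ L(χ, s)` on `re s > 1`, and the product of the continued `L`-functions is the
continuation of `ζ_E` (`isDedekindZeta_prod_charsOf`). For `ℚ_n` the characters are the even ones
modulo `2^(n+2)`. For `K_n = ℚ(√d) ℚ_n` they are these together with their twists by `ψ_d`, because
`√d` is, up to a fourth root of unity, a product of Gauss sums in `ℚ(μ_{4d})` (`exists_cycAut_sqrt`).

*Untwisted values.* `L(χ, 1 - m)` is a weighted sum of values of the Bernoulli polynomial `B_m`. If
two even characters agree modulo an ideal of the `2`-adic integers, then their values, multiplied by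
`1 - χ(c) c^m`, agree modulo twice that ideal, as the residues `a` and `-a` contribute equally
(`norm_algL_sub_le`). An even character `χ` of exact level
`j ≥ 1` in the tower is congruent to the trivial one modulo the prime over `2`, and `ζ(1 - m)` is
known by von Staudt and Clausen; with `c = 5`, where `χ(5)` is a primitive `2^j`-th root of unity,
this gives `ord₂ L(χ, 1 - m) = 1 - 2^(1-j)` (`hasOrd2_primLFunction`).

*Twisted values.* Modulo `2` the character `χ ψ_d` agrees with `χ` made imprimitive at the primes
`p ∣ d`. The `L`-value of the latter has the additional Euler factors `1 - χ(p) p^(m-1)`, of order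
`2^(1-j) 2^{f_p}` since `χ(p) = χ(p*)` is a primitive `2^(j-f_p)`-th root of unity. If `j` is at least
the explicit bound, the error of the congruence is smaller than the value, and the order of
`L(χ ψ_d, 1 - m)` is `1 + 2^(1-j) (-1 + ∑ 2^{f_p})` (`hasOrd2_twistedL`).

*Conclusion.* There are `2^(k-1)` even characters of exact level `k`, so the orders sum to the stated
formulas (`sum_evenChars`). For small `k` the order of `L(χ ψ_d, 1 - m)` is not computed, but it is
the same for all `χ` of level `k` and all places, as `2` is totally ramified in `ℚ(μ_{2^k})`
(`ord2_twistedL_eq`); hence the constant is well defined. The values do not vanish by the functional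
equation (`primLFunction_ne_zero`).
-/

noncomputable section

namespace TwoAdicZeta

open NumberField Ideal MulAction Pointwise

/-! ### Splitting of primes in subfields of a Galois extension -/

section Splitting

variable {K : Type*} [Field K] [NumberField K] (F : IntermediateField ℚ K)

theorem card_stabilizer_fixingSubgroup (P : Ideal (𝓞 K)) :
    Nat.card (stabilizer Gal(K/F) P) = Nat.card ↥(stabilizer Gal(K/ℚ) P ⊓ F.fixingSubgroup) :=
  Nat.card_congr
    { toFun := fun σ => ⟨(IntermediateField.fixingSubgroupEquiv F).symm σ.1, σ.2,
        ((IntermediateField.fixingSubgroupEquiv F).symm σ.1).2⟩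
      invFun := fun σ => ⟨IntermediateField.fixingSubgroupEquiv F ⟨σ.1, σ.2.2⟩, σ.2.1⟩
      left_inv := fun _ => rfl
      right_inv := fun _ => rfl }

theorem card_inertia_fixingSubgroup (P : Ideal (𝓞 K)) :
    Nat.card (inertia Gal(K/F) P) = Nat.card ↥(inertia Gal(K/ℚ) P ⊓ F.fixingSubgroup) :=
  Nat.card_congr
    { toFun := fun σ => ⟨(IntermediateField.fixingSubgroupEquiv F).symm σ.1, σ.2,
        ((IntermediateField.fixingSubgroupEquiv F).symm σ.1).2⟩
      invFun := fun σ => ⟨IntermediateField.fixingSubgroupEquiv F ⟨σ.1, σ.2.2⟩, σ.2.1⟩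
      left_inv := fun _ => rfl
      right_inv := fun _ => rfl }

theorem card_inf_mul_relIndex {G : Type*} [Group G] (A B : Subgroup G) :
    Nat.card ↥(A ⊓ B) * B.relIndex A = Nat.card A := by
  rw [← Subgroup.inf_relIndex_left, ← Subgroup.relIndex_bot_left, ← Subgroup.relIndex_bot_left A]
  exact Subgroup.relIndex_mul_relIndex _ _ _ bot_le inf_le_left

/-- In a Galois extension `K / ℚ` with commutative Galois group, the number of primes of a
subfield `F` above `p` is the index of `Gal(K/F) D`, with `D` a decomposition group at `p`, and
`f g` is the index of `Gal(K/F) I`, with `I` the inertia group. -/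
theorem ncard_primesOver_intermediateField [IsGalois ℚ K] [IsMulCommutative Gal(K/ℚ)]
    (p : ℕ) [hp : Fact p.Prime]
    (P : Ideal (𝓞 K)) [P.IsPrime] [P.LiesOver (span {(p : ℤ)})] :
    ((span {(p : ℤ)}).primesOver (𝓞 F)).ncard =
        (F.fixingSubgroup ⊔ stabilizer Gal(K/ℚ) P).index ∧
      ((span {(p : ℤ)}).primesOver (𝓞 F)).ncard * (span {(p : ℤ)}).inertiaDegIn (𝓞 F) =
        (F.fixingSubgroup ⊔ inertia Gal(K/ℚ) P).index := by
  have : IsAbelianGalois ℚ K := {}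
  have : IsGalois ℚ F := (IsAbelianGalois.tower_bot ℚ F K).toIsGalois
  have hpm : (span {(p : ℤ)}).IsMaximal := by
    apply PrincipalIdealRing.isMaximal_of_irreducible
    exact (Nat.prime_iff_prime_int.mp hp.out).irreducible
  have hp0 : span {(p : ℤ)} ≠ ⊥ := by simpa using hp.out.ne_zero
  let Q : Ideal (𝓞 F) := P.under (𝓞 F)
  have hQ : Q.LiesOver (span {(p : ℤ)}) := Ideal.under_liesOver_of_liesOver (𝓞 F) P (span {(p : ℤ)})
  have hQ' : Q.IsPrime := inferInstance
  have hQ0 : Q ≠ ⊥ := Ideal.ne_bot_of_liesOver_of_ne_bot hp0 Q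
  have hQm : Q.IsMaximal := hQ'.isMaximal hQ0
  have : Finite (𝓞 F ⧸ Q) := Ring.HasFiniteQuotients.finiteQuotient hQ0
  have : Finite (ℤ ⧸ span {(p : ℤ)}) := Ring.HasFiniteQuotients.finiteQuotient hp0
  set H := F.fixingSubgroup
  set D := stabilizer Gal(K/ℚ) P
  set I := inertia Gal(K/ℚ) P
  have hN : ∀ S : Subgroup Gal(K/ℚ), S.Normal := fun S => inferInstance
  have hD := Ideal.card_stabilizer_eq (G := Gal(K/ℚ)) (span {(p : ℤ)}) P
  have hI := Ideal.card_inertia_eq_ramificationIdxIn (G := Gal(K/ℚ)) (span {(p : ℤ)}) P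
  have hD' := Ideal.card_stabilizer_eq (G := Gal(K/F)) Q P
  have hI' := Ideal.card_inertia_eq_ramificationIdxIn (G := Gal(K/F)) Q P
  rw [card_stabilizer_fixingSubgroup] at hD'
  rw [card_inertia_fixingSubgroup] at hI'
  have he := Ideal.ramificationIdxIn_mul_ramificationIdxIn (p := span {(p : ℤ)}) Q Gal(F/ℚ) (𝓞 K)
    Gal(K/ℚ) Gal(K/F)
  have hf := Ideal.inertiaDegIn_mul_inertiaDegIn (span {(p : ℤ)}) Q Gal(F/ℚ) (𝓞 K)
    Gal(K/ℚ) Gal(K/F)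
  have hefg := Ideal.ncard_primesOver_mul_ramificationIdxIn_mul_inertiaDegIn (span {(p : ℤ)}) (𝓞 F)
    Gal(F/ℚ)
  rw [IsGalois.card_aut_eq_finrank, IntermediateField.finrank_eq_fixingSubgroup_index] at hefg
  have h1 := card_inf_mul_relIndex D H
  have h2 := card_inf_mul_relIndex I H
  have h3 : H.relIndex D * (H ⊔ D).index = H.index := by
    rw [← Subgroup.relIndex_sup_left D H]
    exact Subgroup.relIndex_mul_index le_sup_left
  have h4 : H.relIndex I * (H ⊔ I).index = H.index := by
    rw [← Subgroup.relIndex_sup_left I H]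
    exact Subgroup.relIndex_mul_index le_sup_left
  have ne1 : (span {(p : ℤ)}).ramificationIdxIn (𝓞 F) ≠ 0 := ramificationIdxIn_ne_zero Gal(F/ℚ)
  have ne2 : (span {(p : ℤ)}).inertiaDegIn (𝓞 F) ≠ 0 := inertiaDegIn_ne_zero Gal(F/ℚ)
  have ne3 : Q.ramificationIdxIn (𝓞 K) ≠ 0 := ramificationIdxIn_ne_zero Gal(K/F)
  have ne4 : Q.inertiaDegIn (𝓞 K) ≠ 0 := inertiaDegIn_ne_zero Gal(K/F)
  rw [hD, hD', ← he, ← hf] at h1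
  rw [hI, hI', ← he] at h2
  have h5 : H.relIndex D = (span {(p : ℤ)}).ramificationIdxIn (𝓞 F) *
      (span {(p : ℤ)}).inertiaDegIn (𝓞 F) :=
    mul_left_cancel₀ (mul_ne_zero ne3 ne4) (by rw [h1]; ring)
  have h6 : H.relIndex I = (span {(p : ℤ)}).ramificationIdxIn (𝓞 F) :=
    mul_left_cancel₀ ne3 (by rw [h2]; ring)
  rw [h5] at h3
  rw [h6] at h4
  constructor
  · exact mul_left_cancel₀ (mul_ne_zero ne1 ne2) (by rw [h3, ← hefg]; ring)
  · exact mul_left_cancel₀ ne1 (by rw [h4, ← hefg]; ring)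

end Splitting

/-! ### Decomposition and inertia groups in cyclotomic fields -/

section CyclotomicSplitting

open IsCyclotomicExtension.Rat

variable {n : ℕ} [NeZero n] {K : Type*} [Field K] [NumberField K]
  [hK : IsCyclotomicExtension {n} ℚ K] {p k m : ℕ} [hp : Fact p.Prime]
  (hn : n = p ^ k * m) (hm : p.Coprime m)
  (P : Ideal (𝓞 K)) [P.IsMaximal] [P.LiesOver (span {(p : ℤ)})]

attribute [local instance] Ideal.Quotient.field

omit hp in
include hn hm in
/-- Primitive roots of order prime to `p` stay primitive modulo a prime above `p`. -/
theorem exists_isPrimitiveRoot_quotient : ∃ ζ : 𝓞 K, ζ ^ n = 1 ∧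
    IsPrimitiveRoot (Ideal.Quotient.mk P ζ) m := by
  have hζ := IsCyclotomicExtension.zeta_spec n ℚ K
  have hζ' : IsPrimitiveRoot (hζ.toInteger ^ p ^ k) m :=
    hζ.toInteger_isPrimitiveRoot.pow (NeZero.pos n) hn
  refine ⟨hζ.toInteger ^ p ^ k, ?_, ?_⟩
  · rw [← pow_mul, mul_comm, pow_mul, hζ.toInteger_isPrimitiveRoot.pow_eq_one, one_pow]
  · have : NeZero m := ⟨by rintro rfl; exact NeZero.ne n (by simp [hn])⟩
    refine hζ'.idealQuotient_mk (by simpa using IsMaximal.ne_top inferInstance) ?_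
    rw [← pow_inertiaDeg p]
    exact Nat.Coprime.pow_left _ hm

omit hp in
include hm in
theorem unitsMap_galEquivZMod_of_mem_inertia {σ : Gal(K/ℚ)} (hσ : σ ∈ inertia Gal(K/ℚ) P) :
    ZMod.unitsMap (Dvd.intro_left _ hn.symm) (galEquivZMod n K σ) = 1 := by
  obtain ⟨ζ, h1, h2⟩ := exists_isPrimitiveRoot_quotient hn hm P
  have : NeZero m := ⟨by rintro rfl; exact NeZero.ne n (by simp [hn])⟩
  have h3 : Ideal.Quotient.mk P (σ • ζ) = Ideal.Quotient.mk P ζ :=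
    Ideal.Quotient.eq.2 (hσ ζ)
  rw [galEquivZMod_smul_of_pow_eq n K σ h1, map_pow] at h3
  nth_rw 2 [← pow_one (Ideal.Quotient.mk P ζ)] at h3
  rw [(h2.isOfFinOrder (NeZero.ne _)).pow_inj_mod, ← h2.eq_orderOf,
    ← ZMod.natCast_eq_natCast_iff'] at h3
  rw [Units.ext_iff, ZMod.unitsMap_val]
  rw [ZMod.natCast_val] at h3
  simpa using h3

include hm in
theorem unitsMap_galEquivZMod_of_mem_stabilizer {σ : Gal(K/ℚ)}
    (hσ : σ ∈ stabilizer Gal(K/ℚ) P) :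
    ZMod.unitsMap (Dvd.intro_left _ hn.symm) (galEquivZMod n K σ) ∈
      Subgroup.zpowers (ZMod.unitOfCoprime p hm) := by
  obtain ⟨ζ, h1, h2⟩ := exists_isPrimitiveRoot_quotient hn hm P
  have : NeZero m := ⟨by rintro rfl; exact NeZero.ne n (by simp [hn])⟩
  let τ := IsFractionRing.stabilizerHom Gal(K/ℚ) (Ideal.span {(p : ℤ)}) P
     (ℤ ⧸ span {(p : ℤ)}) (𝓞 K ⧸ P) ⟨σ, hσ⟩
  have : CharP (ℤ ⧸ span {(p : ℤ)}) p := ringChar.of_eq <| Int.ringChar_idealQuot p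
  have : Finite (𝓞 K ⧸ P) := Ring.HasFiniteQuotients.finiteQuotient (NeZero.ne P)
  obtain ⟨i, hi⟩ := FiniteField.exists_forall_apply_eq_pow (ℤ ⧸ span {(p : ℤ)}) p (𝓞 K ⧸ P) τ
  refine ⟨i, ?_⟩
  have h₁ := IsFractionRing.stabilizerHom_apply_apply_mk Gal(K/ℚ) (Ideal.span {(p : ℤ)}) P
      (ℤ ⧸ span {(p : ℤ)}) (𝓞 K ⧸ P) ⟨σ, hσ⟩ ζ
  simp only [Algebra.algebraMap_self, RingHomCompTriple.comp_apply] at h₁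
  specialize hi (Ideal.Quotient.mk P ζ)
  rw [h₁, Int.card_ideal_quot, galEquivZMod_smul_of_pow_eq n _ _ h1, map_pow,
    (h2.isOfFinOrder (NeZero.ne _)).pow_inj_mod,
    ← h2.eq_orderOf, ← ZMod.natCast_eq_natCast_iff', Nat.cast_pow] at hi
  rw [Units.ext_iff, ZMod.unitsMap_val]
  rw [ZMod.natCast_val] at hi
  rw [hi]
  simp

theorem card_ker_unitsMap {n m : ℕ} [NeZero n] (h : m ∣ n) :
    Nat.card (ZMod.unitsMap h).ker * m.totient = n.totient := by
  have : NeZero m := ⟨fun h0 => NeZero.ne n (by simpa [h0] using h)⟩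
  have h1 := (ZMod.unitsMap h).ker.card_mul_index
  rw [Subgroup.index_ker, MonoidHom.range_eq_top.2 (ZMod.unitsMap_surjective h),
    Subgroup.card_top, Nat.card_eq_fintype_card (α := (ZMod m)ˣ), ZMod.card_units_eq_totient,
    Nat.card_eq_fintype_card (α := (ZMod n)ˣ), ZMod.card_units_eq_totient] at h1
  exact h1

include hn hm in
theorem ramificationIdxIn_mul_totient :
    (span {(p : ℤ)}).ramificationIdxIn (𝓞 K) * m.totient = n.totient ∧
    (span {(p : ℤ)}).inertiaDegIn (𝓞 K) = orderOf (ZMod.unitOfCoprime p hm) := by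
  have hm' : ¬ p ∣ m := (Nat.Prime.coprime_iff_not_dvd hp.out).mp hm
  rw [← orderOf_injective _ Units.coeHom_injective (ZMod.unitOfCoprime p hm)]
  rcases k with _ | k
  · obtain rfl : n = m := by simpa using hn
    rw [ramificationIdxIn_eq_of_not_dvd p K hm', inertiaDegIn_eq_of_not_dvd p K hm']
    simp
  · rw [ramificationIdxIn_eq n K hn hm', inertiaDegIn_eq n K hn hm', hn,
      Nat.totient_mul (Nat.Coprime.pow_left _ hm), Nat.totient_prime_pow_succ hp.out]
    simp

include hm in
/-- The inertia group of `p` in `ℚ(ζ_n)`, `n = p ^ k * m`, consists of the classes `≡ 1 mod m`. -/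
theorem map_inertia_eq_ker :
    (inertia Gal(K/ℚ) P).map (galEquivZMod n K).toMonoidHom =
      (ZMod.unitsMap (Dvd.intro_left _ hn.symm : m ∣ n)).ker := by
  have : IsGalois ℚ K := IsCyclotomicExtension.isGalois {n} ℚ K
  have : (span {(p : ℤ)}).IsMaximal :=
    PrincipalIdealRing.isMaximal_of_irreducible (Nat.prime_iff_prime_int.mp hp.out).irreducible
  have hp0 : span {(p : ℤ)} ≠ ⊥ := by simpa using hp.out.ne_zero
  have : Finite (ℤ ⧸ span {(p : ℤ)}) := Ring.HasFiniteQuotients.finiteQuotient hp0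
  have : NeZero m := ⟨by rintro rfl; exact NeZero.ne n (by simp [hn])⟩
  refine Subgroup.eq_of_le_of_card_ge ?_ ?_
  · rintro _ ⟨σ, hσ, rfl⟩
    exact unitsMap_galEquivZMod_of_mem_inertia hn hm P hσ
  · rw [Subgroup.card_map_of_injective (f := (galEquivZMod n K).toMonoidHom)
        (galEquivZMod n K).injective,
      Ideal.card_inertia_eq_ramificationIdxIn (span {(p : ℤ)})]
    refine le_of_mul_le_mul_right ?_ (Nat.totient_pos.2 (NeZero.pos m))
    rw [card_ker_unitsMap, (ramificationIdxIn_mul_totient (K := K) hn hm).1]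

/-- The decomposition group of `p` in `ℚ(ζ_n)`, `n = p ^ k * m`, consists of the classes that are
powers of `p` modulo `m`. -/
theorem map_stabilizer_eq_comap :
    (stabilizer Gal(K/ℚ) P).map (galEquivZMod n K).toMonoidHom =
      (Subgroup.zpowers (ZMod.unitOfCoprime p hm)).comap
        (ZMod.unitsMap (Dvd.intro_left _ hn.symm : m ∣ n)) := by
  have : IsGalois ℚ K := IsCyclotomicExtension.isGalois {n} ℚ K
  have : (span {(p : ℤ)}).IsMaximal :=
    PrincipalIdealRing.isMaximal_of_irreducible (Nat.prime_iff_prime_int.mp hp.out).irreducible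
  have hp0 : span {(p : ℤ)} ≠ ⊥ := by simpa using hp.out.ne_zero
  have : Finite (ℤ ⧸ span {(p : ℤ)}) := Ring.HasFiniteQuotients.finiteQuotient hp0
  have : NeZero m := ⟨by rintro rfl; exact NeZero.ne n (by simp [hn])⟩
  refine Subgroup.eq_of_le_of_card_ge ?_ ?_
  · rintro _ ⟨σ, hσ, rfl⟩
    exact unitsMap_galEquivZMod_of_mem_stabilizer hn hm P hσ
  · rw [Subgroup.card_map_of_injective (f := (galEquivZMod n K).toMonoidHom)
        (galEquivZMod n K).injective,
      Ideal.card_stabilizer_eq (span {(p : ℤ)}), (ramificationIdxIn_mul_totient (K := K) hn hm).2]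
    obtain ⟨h1, -⟩ := ramificationIdxIn_mul_totient (K := K) hn hm
    have hpos : 0 < (Subgroup.zpowers (ZMod.unitOfCoprime p hm)).index :=
      Nat.pos_of_ne_zero Subgroup.index_ne_zero_of_finite
    refine le_of_mul_le_mul_right ?_ hpos
    nth_rw 1 [← (Subgroup.zpowers (ZMod.unitOfCoprime p hm)).index_comap_of_surjective
      (ZMod.unitsMap_surjective (Dvd.intro_left _ hn.symm : m ∣ n))]
    rw [Subgroup.card_mul_index, mul_assoc, ← Nat.card_zpowers, Subgroup.card_mul_index,
      Nat.card_eq_fintype_card, Nat.card_eq_fintype_card, ZMod.card_units_eq_totient,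
      ZMod.card_units_eq_totient, h1]

end CyclotomicSplitting

/-! ### Euler factors of abelian fields -/

/-- A homomorphism from a finite group to `ℂˣ` takes each `f`-th root of unity equally often, with
`f` the order of its image. -/
theorem prod_one_sub_hom_mul {Y : Type*} [Group Y] [Fintype Y] (ev : Y →* ℂˣ) (T : ℂ) :
    ∏ y : Y, (1 - (ev y : ℂ) * T) = (1 - T ^ Nat.card ev.range) ^ Nat.card ev.ker := by
  classical
  set f := Nat.card ev.range with hf
  have hf0 : 0 < f := Nat.card_pos
  have : NeZero f := ⟨hf0.ne'⟩
  have hz : ∀ z ∈ ev.range, z ^ f = 1 := fun z hz => by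
    have := pow_card_eq_one' (x := (⟨z, hz⟩ : ev.range))
    exact congrArg Subtype.val this
  have himg : Finset.univ.image (fun y => (ev y : ℂ)) = Polynomial.nthRootsFinset f (1 : ℂ) := by
    apply Finset.eq_of_subset_of_card_le
    · intro z hz'
      obtain ⟨y, -, rfl⟩ := Finset.mem_image.1 hz'
      rw [Polynomial.mem_nthRootsFinset hf0, ← Units.val_pow_eq_pow_val, hz _ ⟨y, rfl⟩,
        Units.val_one]
    · rw [(Complex.isPrimitiveRoot_exp f hf0.ne').card_nthRootsFinset, hf,
        show (fun y => (ev y : ℂ)) = Units.val ∘ ev from rfl, ← Finset.image_image,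
        Finset.card_image_of_injective _ Units.val_injective, ← Set.ncard_coe_finset]
      simp [Set.ncard, ← MonoidHom.coe_range]
      rfl
  rw [← Finset.prod_fiberwise_of_maps_to (g := fun y => (ev y : ℂ))
    (t := Polynomial.nthRootsFinset f (1 : ℂ))
    (fun y _ => by rw [← himg]; exact Finset.mem_image_of_mem _ (Finset.mem_univ _))]
  rw [← one_pow f, (Complex.isPrimitiveRoot_exp f hf0.ne').pow_sub_pow_eq_prod_sub_mul 1 T hf0,
    ← Finset.prod_pow]
  refine Finset.prod_congr (by rw [one_pow]) fun z hz' => ?_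
  rw [Finset.prod_congr rfl (g := fun _ => 1 - z * T)
    (fun y hy => by rw [(Finset.mem_filter.1 hy).2, one_pow]), Finset.prod_const]
  congr 1
  rw [← himg] at hz'
  obtain ⟨y₀, -, rfl⟩ := Finset.mem_image.1 hz'
  rw [← Set.ncard_coe_finset, ← Nat.card_coe_set_eq]
  refine Nat.card_congr ⟨fun y => ⟨y₀⁻¹ * y.1, ?_⟩, fun k => ⟨y₀ * k.1, ?_⟩, ?_, ?_⟩
  · have := y.2
    simp only [Finset.coe_filter, Finset.mem_univ, true_and, Set.mem_ofPred_eq, Units.val_inj] at this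
    simp [MonoidHom.mem_ker, this]
  · have := k.2
    rw [MonoidHom.mem_ker] at this
    simp [this]
  · intro y; simp
  · intro y; simp

section CyclotomicSplitting

open IsCyclotomicExtension.Rat DirichletCharacter

variable {n : ℕ} [NeZero n] {K : Type*} [Field K] [NumberField K]
  [hK : IsCyclotomicExtension {n} ℚ K] {p k m : ℕ} [hp : Fact p.Prime]

theorem forall_mem_sup_char_eq_one (χ : DirichletCharacter ℂ n) (A B : Subgroup Gal(K/ℚ)) :
    (∀ σ ∈ A ⊔ B, χ (galEquivZMod n K σ) = 1) ↔
      (∀ σ ∈ A, χ (galEquivZMod n K σ) = 1) ∧ ∀ σ ∈ B, χ (galEquivZMod n K σ) = 1 := by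
  let φ : Gal(K/ℚ) →* ℂˣ := χ.toUnitHom.comp (galEquivZMod n K).toMonoidHom
  have h : ∀ σ, χ (galEquivZMod n K σ) = 1 ↔ σ ∈ φ.ker := fun σ => by
    rw [MonoidHom.mem_ker, Units.ext_iff]
    simp [φ]
  simp only [h]
  exact sup_le_iff (a := A) (b := B) (c := φ.ker)

theorem forall_map_char_eq_one (χ : DirichletCharacter ℂ n) (A : Subgroup Gal(K/ℚ)) :
    (∀ σ ∈ A, χ (galEquivZMod n K σ) = 1) ↔
      A.map (galEquivZMod n K).toMonoidHom ≤ χ.toUnitHom.ker := by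
  rw [Subgroup.map_le_iff_le_comap]
  refine forall_congr' fun σ => imp_congr_right fun _ => ?_
  rw [Subgroup.mem_comap, MonoidHom.mem_ker, Units.ext_iff]
  simp

omit [NeZero n] hp in
theorem conductor_dvd_iff_coprime (hn : n = p ^ k * m) (hm : p.Coprime m)
    (χ : DirichletCharacter ℂ n) : χ.conductor ∣ m ↔ p.Coprime χ.conductor := by
  constructor
  · exact fun h => hm.coprime_dvd_right h
  · intro h
    have h1 : χ.conductor ∣ p ^ k * m := hn ▸ χ.conductor_dvd_level
    exact (Nat.Coprime.pow_right k h.symm).dvd_of_dvd_mul_left h1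

omit hp in
theorem unitsMap_ker_le_iff (hn : n = p ^ k * m) (hm : p.Coprime m)
    (χ : DirichletCharacter ℂ n) :
    (ZMod.unitsMap (Dvd.intro_left _ hn.symm : m ∣ n)).ker ≤ χ.toUnitHom.ker ↔
      p.Coprime χ.conductor := by
  rw [← factorsThrough_iff_ker_unitsMap, ← mem_conductorSet_iff,
    mem_conductorSet_iff_conductor_dvd _ (Dvd.intro_left _ hn.symm),
    conductor_dvd_iff_coprime hn hm]

omit hp in
theorem primitiveCharacter_changeLevel_prime (hn : n = p ^ k * m) (hm : p.Coprime m)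
    (χ : DirichletCharacter ℂ m) :
    (changeLevel (Dvd.intro_left _ hn.symm : m ∣ n) χ).primitiveCharacter p = χ p := by
  have h := primitiveCharacter_changeLevel_apply (Dvd.intro_left _ hn.symm : m ∣ n) χ (p : ℤ)
  rw [primitiveCharacter_apply_of_isCoprime _ (Nat.isCoprime_iff_coprime.mpr hm)] at h
  simpa using h

theorem comap_zpowers_le_iff (hn : n = p ^ k * m) (hm : p.Coprime m)
    (χ : DirichletCharacter ℂ n) :
    (Subgroup.zpowers (ZMod.unitOfCoprime p hm)).comap
        (ZMod.unitsMap (Dvd.intro_left _ hn.symm : m ∣ n)) ≤ χ.toUnitHom.ker ↔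
      χ.primitiveCharacter p = 1 := by
  have hmn : m ∣ n := Dvd.intro_left _ hn.symm
  have key : ∀ χ' : DirichletCharacter ℂ m, χ = changeLevel hmn χ' →
      ((Subgroup.zpowers (ZMod.unitOfCoprime p hm)).comap (ZMod.unitsMap hmn) ≤
        χ.toUnitHom.ker ↔ χ.primitiveCharacter p = 1) := by
    rintro χ' rfl
    rw [primitiveCharacter_changeLevel_prime hn hm]
    have h1 : ∀ u : (ZMod n)ˣ, u ∈ (changeLevel hmn χ').toUnitHom.ker ↔
        χ' (ZMod.unitsMap hmn u) = 1 := fun u => by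
      rw [changeLevel_toUnitHom, MonoidHom.mem_ker, Units.ext_iff]
      simp
    constructor
    · intro h
      obtain ⟨u, hu⟩ := ZMod.unitsMap_surjective hmn (ZMod.unitOfCoprime p hm)
      have := (h1 u).1 (h (show _ ∈ Subgroup.zpowers _ by rw [hu]; exact Subgroup.mem_zpowers _))
      rwa [hu, ZMod.coe_unitOfCoprime] at this
    · intro h u hu
      obtain ⟨i, hi⟩ := hu
      rw [h1, ← hi]
      have h2 : χ'.toUnitHom (ZMod.unitOfCoprime p hm) = 1 := by
        rw [Units.ext_iff]; simpa using h
      have h3 : χ'.toUnitHom ((ZMod.unitOfCoprime p hm) ^ i) = 1 := by rw [map_zpow, h2, one_zpow]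
      rwa [Units.ext_iff, MulChar.coe_toUnitHom] at h3
  constructor
  · intro h
    have h0 : (ZMod.unitsMap hmn).ker ≤ χ.toUnitHom.ker := le_trans
      (fun u hu => by rw [Subgroup.mem_comap, hu]; exact one_mem _) h
    obtain ⟨χ', hχ'⟩ := ((factorsThrough_iff_ker_unitsMap hmn).2 h0).2
    exact (key χ' hχ').1 h
  · intro h
    have h0 : p.Coprime χ.conductor := by
      rw [← Nat.isCoprime_iff_coprime, ← apply_ne_zero_iff (χ := χ.primitiveCharacter)]
      simp [h]
    rw [← unitsMap_ker_le_iff hn hm] at h0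
    obtain ⟨χ', hχ'⟩ := ((factorsThrough_iff_ker_unitsMap hmn).2 h0).2
    exact (key χ' hχ').2 h

/-- The primes of a number field above `p`. -/
def primesAbove (E : Type*) [Field E] [NumberField E] (p : ℕ) : Finset (Ideal (𝓞 E)) :=
  (Algebra.QuasiFinite.finite_primesOver (S := 𝓞 E) (span {(p : ℤ)})).toFinset

theorem mem_primesAbove {E : Type*} [Field E] [NumberField E] {p : ℕ} {P : Ideal (𝓞 E)} :
    P ∈ primesAbove E p ↔ P.IsPrime ∧ P.LiesOver (span {(p : ℤ)}) := by
  rw [primesAbove, Set.Finite.mem_toFinset]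
  rfl

variable (n) in
/-- The characters of `Gal(F/ℚ)` for a subfield `F` of `ℚ(ζ_n)`, as Dirichlet characters
modulo `n`. -/
def fieldChars [IsAbelianGalois ℚ K] (F : IntermediateField ℚ K) :
    Finset (DirichletCharacter ℂ n) :=
  (Set.toFinite (intermediateFieldEquivSubgroupChar n K ℂ F : Set (DirichletCharacter ℂ n))).toFinset

theorem mem_fieldChars [IsAbelianGalois ℚ K] {F : IntermediateField ℚ K}
    {χ : DirichletCharacter ℂ n} : χ ∈ fieldChars n F ↔
      ∀ σ ∈ F.fixingSubgroup, χ (galEquivZMod n K σ) = 1 := by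
  simp [fieldChars]

/-- The Euler factor at `p` of the Dedekind zeta function of a subfield `F` of `ℚ(ζ_n)` is the
product of the Euler factors of the primitive Dirichlet characters attached to `F`. -/
theorem prod_primesOver_eq_prod_fieldChars [IsAbelianGalois ℚ K] (F : IntermediateField ℚ K)
    (p : ℕ) [hp : Fact p.Prime] (s : ℂ) :
    ∏ P ∈ primesAbove F p, (1 - (absNorm P : ℂ) ^ (-s)) =
      ∏ χ ∈ fieldChars n F, (1 - χ.primitiveCharacter p * (p : ℂ) ^ (-s)) := by
  classical
  obtain ⟨k, m, hm, hn⟩ : ∃ k m, p.Coprime m ∧ n = p ^ k * m := by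
    obtain ⟨k, m, h1, h2⟩ := Nat.exists_eq_pow_mul_and_not_dvd (NeZero.ne n) p hp.out.ne_one
    exact ⟨k, m, (Nat.Prime.coprime_iff_not_dvd hp.out).2 h1, h2⟩
  have hmn : m ∣ n := Dvd.intro_left _ hn.symm
  have : NeZero m := ⟨by rintro rfl; exact NeZero.ne n (by simp [hn])⟩
  have hpm : (span {(p : ℤ)}).IsMaximal :=
    PrincipalIdealRing.isMaximal_of_irreducible (Nat.prime_iff_prime_int.mp hp.out).irreducible
  obtain ⟨⟨P, hP, hP'⟩⟩ := (span {(p : ℤ)}).nonempty_primesOver (S := 𝓞 K)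
  have hPm : P.IsMaximal := .of_liesOver_isMaximal P (span {(p : ℤ)})
  obtain ⟨hg, hfg⟩ := ncard_primesOver_intermediateField F p P
  set g := ((span {(p : ℤ)}).primesOver (𝓞 F)).ncard with hgdef
  set f := (span {(p : ℤ)}).inertiaDegIn (𝓞 F) with hfdef
  have hg0 : 0 < g := by rw [hg]; exact Nat.pos_of_ne_zero Subgroup.index_ne_zero_of_finite
  set X := intermediateFieldEquivSubgroupChar n K ℂ F with hX
  -- the characters unramified at `p`, as characters modulo `m`
  let Y : Subgroup (DirichletCharacter ℂ m) := X.comap (changeLevel hmn)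
  let u := ZMod.unitOfCoprime p hm
  let ev : Y →* ℂˣ :=
    { toFun := fun χ => χ.1.toUnitHom u
      map_one' := by ext; simp
      map_mul' := fun a b => by ext; simp }
  have hev : ∀ χ : Y, (ev χ : ℂ) = χ.1 p := fun χ => by
    simp [ev, u]
  have hYmap : Y.map (changeLevel hmn) =
      (subgroupGalEquivSubgroupChar n K ℂ (F.fixingSubgroup ⊔ inertia Gal(K/ℚ) P)).ofDual := by
    ext χ
    rw [mem_subgroupGalEquivSubgroupChar_iff, forall_mem_sup_char_eq_one,
      forall_map_char_eq_one χ (inertia Gal(K/ℚ) P), map_inertia_eq_ker hn hm P,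
      ← mem_intermediateFieldEquivSubgroupChar_iff, ← factorsThrough_iff_ker_unitsMap]
    constructor
    · rintro ⟨χ', h, rfl⟩
      exact ⟨h, changeLevel_factorsThrough _ _⟩
    · rintro ⟨h1, _, χ', rfl⟩
      exact ⟨χ', h1, rfl⟩
  have hkmap : (ev.ker.map Y.subtype).map (changeLevel hmn) =
      (subgroupGalEquivSubgroupChar n K ℂ (F.fixingSubgroup ⊔ stabilizer Gal(K/ℚ) P)).ofDual := by
    ext χ
    rw [mem_subgroupGalEquivSubgroupChar_iff, forall_mem_sup_char_eq_one,
      forall_map_char_eq_one χ (stabilizer Gal(K/ℚ) P), map_stabilizer_eq_comap hn hm P,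
      ← mem_intermediateFieldEquivSubgroupChar_iff, comap_zpowers_le_iff hn hm]
    constructor
    · rintro ⟨_, ⟨χ', h, rfl⟩, rfl⟩
      refine ⟨χ'.2, ?_⟩
      rw [Subgroup.coe_subtype, primitiveCharacter_changeLevel_prime hn hm, ← hev,
        MonoidHom.mem_ker.1 h, Units.val_one]
    · rintro ⟨h1, h2⟩
      have h0 : p.Coprime χ.conductor := by
        rw [← Nat.isCoprime_iff_coprime, ← apply_ne_zero_iff (χ := χ.primitiveCharacter)]
        simp [h2]
      rw [← unitsMap_ker_le_iff hn hm, ← factorsThrough_iff_ker_unitsMap] at h0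
      obtain ⟨_, χ', rfl⟩ := h0
      refine ⟨χ', ⟨⟨χ', h1⟩, ?_, rfl⟩, rfl⟩
      rw [SetLike.mem_coe, MonoidHom.mem_ker, Units.ext_iff, hev,
        ← primitiveCharacter_changeLevel_prime hn hm, h2, Units.val_one]
  -- both groups are the characters of a quotient of the Galois group
  have hcardY : Nat.card Y = g * f := by
    rw [hfg, Subgroup.index_eq_card, ← card_subgroupGalEquivSubgroupChar n K ℂ, ← hYmap,
      Subgroup.card_map_of_injective (changeLevel_injective hmn)]
  have hcardk : Nat.card ev.ker = g := by
    rw [hg, Subgroup.index_eq_card, ← card_subgroupGalEquivSubgroupChar n K ℂ, ← hkmap,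
      Subgroup.card_map_of_injective (changeLevel_injective hmn),
      Subgroup.card_map_of_injective Y.subtype_injective]
  have hcardr : Nat.card ev.range = f := by
    have := ev.ker.card_mul_index
    rw [Subgroup.index_ker, hcardk, hcardY] at this
    exact mul_left_cancel₀ hg0.ne' this
  have hLHS : ∏ P ∈ primesAbove F p, (1 - (absNorm P : ℂ) ^ (-s)) =
      (1 - ((p : ℂ) ^ (-s)) ^ f) ^ g := by
    rw [Finset.prod_congr rfl (g := fun _ => 1 - ((p : ℂ) ^ (-s)) ^ f), Finset.prod_const]
    · rw [hgdef, primesAbove, Set.ncard_eq_toFinset_card _ (Algebra.QuasiFinite.finite_primesOver _)]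
    · intro Q hQ
      obtain ⟨hQ, hQ'⟩ := mem_primesAbove.1 hQ
      have : IsGalois ℚ F := (IsAbelianGalois.tower_bot ℚ F K).toIsGalois
      rw [← pow_inertiaDeg p Q, ← inertiaDegIn_eq_inertiaDeg (span {(p : ℤ)}) Q Gal(F/ℚ),
        Nat.cast_pow, ← Complex.natCast_cpow_natCast_mul, ← Complex.cpow_nat_mul]
  rw [hLHS, ← hcardr, ← hcardk]
  have : Fintype Y := Fintype.ofFinite Y
  rw [← prod_one_sub_hom_mul ev]
  symm
  have himg : (Finset.univ : Finset Y).image (fun χ => changeLevel hmn χ.1) ⊆ fieldChars n F := by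
    intro χ h
    obtain ⟨χ', -, rfl⟩ := Finset.mem_image.1 h
    rw [mem_fieldChars, ← mem_intermediateFieldEquivSubgroupChar_iff]
    exact χ'.2
  rw [← Finset.prod_subset himg, Finset.prod_image]
  · refine Finset.prod_congr rfl fun χ _ => ?_
    rw [primitiveCharacter_changeLevel_prime hn hm, hev]
  · intro a _ b _ hab
    exact Subtype.ext (changeLevel_injective hmn hab)
  · intro χ hχ hχ'
    rw [mem_fieldChars, ← mem_intermediateFieldEquivSubgroupChar_iff] at hχ
    -- characters that do not come from level `m` are ramified at `p`
    suffices χ.primitiveCharacter p = 0 by rw [this, zero_mul, sub_zero]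
    have := apply_eq_zero_iff χ.primitiveCharacter (p : ℤ)
    rw [Int.cast_natCast] at this
    rw [this, Nat.isCoprime_iff_coprime, ← unitsMap_ker_le_iff hn hm,
      ← factorsThrough_iff_ker_unitsMap]
    rintro ⟨_, χ', rfl⟩
    exact hχ' (Finset.mem_image.2 ⟨⟨χ', hχ⟩, Finset.mem_univ _, rfl⟩)

end CyclotomicSplitting

/-! ### The Euler product of the Dedekind zeta function -/

section EulerProduct

open Filter Topology

variable (E : Type*) [Field E] [NumberField E]

theorem dedekindZeta_lseriesSummable {s : ℂ} (hs : 1 < s.re) :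
    LSeriesSummable (fun n ↦ Nat.card {I : Ideal (𝓞 E) // absNorm I = n}) s := by
  have h : Tendsto (fun n : ℕ => (∑ k ∈ Finset.Icc 1 n,
      (Nat.card {I : Ideal (𝓞 E) // absNorm I = k} : ℝ)) / (n : ℝ)) atTop
      (𝓝 (NumberField.dedekindZeta_residue E)) := by
    refine ((NumberField.Ideal.tendsto_norm_le_div_atTop₀ E).comp
      tendsto_natCast_atTop_atTop).congr fun n ↦ ?_
    simp only [Function.comp_apply, Nat.cast_le, ← Nat.cast_sum]
    congr
    rw [← add_left_inj 1, ← card_norm_le_eq_card_norm_le_add_one,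
      show Finset.Icc 1 n = Finset.Ioc 0 n from Finset.Icc_succ_left_eq_Ioc _ _,
      show 1 = Nat.card {I : Ideal (𝓞 E) // absNorm I = 0} by simp [Ideal.absNorm_eq_zero_iff],
      Finset.sum_Ioc_add_eq_sum_Icc (n.zero_le),
      ← Finset.card_preimage_eq_sum_card_image_eq (fun k _ ↦ finite_setOfPred_absNorm_eq k)]
    simp [Set.coe_eq_subtype]
  have hO : (fun n : ℕ => ∑ k ∈ Finset.Icc 1 n,
      (Nat.card {I : Ideal (𝓞 E) // absNorm I = k} : ℝ)) =O[atTop] fun n ↦ (n : ℝ) ^ (1 : ℝ) := by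
    have h1 := h.isBigO_one ℝ
    have h2 := h1.mul (Asymptotics.isBigO_refl (fun n : ℕ => (n : ℝ)) atTop)
    refine (h2.congr' ?_ ?_)
    · filter_upwards [eventually_gt_atTop 0] with n hn
      have : (n : ℝ) ≠ 0 := by positivity
      field_simp
    · filter_upwards with n
      simp
  exact_mod_cast LSeriesSummable_of_sum_norm_bigO_and_nonneg hO (fun _ => Nat.cast_nonneg _)
    zero_le_one hs

/-- The Dedekind zeta function as a sum over ideals (the zero ideal contributes `0 ^ (-s) = 0`). -/
theorem hasSum_absNorm_cpow {s : ℂ} (hs : 1 < s.re) :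
    (Summable fun I : Ideal (𝓞 E) => ‖(absNorm I : ℂ) ^ (-s)‖) ∧
    HasSum (fun I : Ideal (𝓞 E) => (absNorm I : ℂ) ^ (-s)) (dedekindZeta E s) := by
  have hs0 : s ≠ 0 := by rintro rfl; simp at hs; linarith
  have hsum := dedekindZeta_lseriesSummable E hs
  let e := Equiv.sigmaFiberEquiv (fun I : Ideal (𝓞 E) => absNorm I)
  have hfin : ∀ n, Finite {I : Ideal (𝓞 E) // absNorm I = n} := fun n =>
    finite_setOfPred_absNorm_eq n
  have hterm : ∀ n, LSeries.term (fun n ↦ (Nat.card {I : Ideal (𝓞 E) // absNorm I = n} : ℂ)) s n =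
      Nat.card {I : Ideal (𝓞 E) // absNorm I = n} * (n : ℂ) ^ (-s) := by
    intro n
    rcases eq_or_ne n 0 with rfl | hn
    · simp [Complex.zero_cpow (neg_ne_zero.2 hs0)]
    · rw [LSeries.term_of_ne_zero hn, Complex.cpow_neg, div_eq_mul_inv]
  have hS : Summable fun I : Ideal (𝓞 E) => ‖(absNorm I : ℂ) ^ (-s)‖ := by
    refine e.summable_iff.1 ((summable_sigma_of_nonneg (fun _ => norm_nonneg _)).2 ?_)
    refine ⟨fun n => Summable.of_finite, hsum.norm.congr fun n => ?_⟩
    rw [hterm, tsum_congr (g := fun _ => ‖(n : ℂ) ^ (-s)‖)]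
    · rw [tsum_const, norm_mul, nsmul_eq_mul]; simp
    · rintro ⟨I, hI⟩
      simp [e, hI]
  refine ⟨hS, ?_⟩
  have hS' := hS.of_norm
  rw [← e.hasSum_iff]
  have h1 : HasSum (fun n => ∑' c : {I : Ideal (𝓞 E) // absNorm I = n}, (absNorm c.1 : ℂ) ^ (-s))
      (∑' x, ((fun I : Ideal (𝓞 E) => (absNorm I : ℂ) ^ (-s)) ∘ e) x) :=
    (e.summable_iff.2 hS').hasSum.sigma (fun n => (Summable.of_finite).hasSum)
  have h2 : HasSum (fun n => ∑' c : {I : Ideal (𝓞 E) // absNorm I = n}, (absNorm c.1 : ℂ) ^ (-s))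
      (dedekindZeta E s) := by
    convert! hsum.hasSum using 2 with n
    rw [hterm, tsum_congr (g := fun _ => (n : ℂ) ^ (-s)) (fun c => by rw [c.2]), tsum_const,
      nsmul_eq_mul]
  rw [h2.unique h1]
  exact (e.summable_iff.2 hS').hasSum

variable {E}

/-- The nonzero ideals all of whose prime factors lie in `S`. -/
def factoredIdeals (S : Finset (Ideal (𝓞 E))) : Set (Ideal (𝓞 E)) :=
  {I | I ≠ ⊥ ∧ ∀ P : Ideal (𝓞 E), P.IsPrime → P ∣ I → P ∈ S}

theorem factoredIdeals_empty : factoredIdeals (∅ : Finset (Ideal (𝓞 E))) = {⊤} := by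
  ext I
  simp only [factoredIdeals, Set.mem_ofPred, Finset.notMem_empty, imp_false,
    Set.mem_singleton_iff]
  constructor
  · rintro ⟨-, h⟩
    by_contra hI
    obtain ⟨M, hM, hIM⟩ := Ideal.exists_le_maximal I hI
    exact h M hM.isPrime (Ideal.dvd_iff_le.2 hIM)
  · rintro rfl
    refine ⟨top_ne_bot, fun P hP h => hP.ne_top (top_le_iff.1 (Ideal.dvd_iff_le.1 h))⟩

/-- Splitting off the power of one prime from an ideal. -/
def factoredIdealsInsertEquiv (S : Finset (Ideal (𝓞 E))) [DecidableEq (Ideal (𝓞 E))]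
    (P : Ideal (𝓞 E)) (hP : Prime P) (hPS : P ∉ S) :
    ℕ × factoredIdeals S ≃ factoredIdeals (insert P S) := by
  have hPp : P.IsPrime := Ideal.isPrime_of_prime hP
  have hnd : ∀ J : factoredIdeals S, ¬ P ∣ J.1 := fun J h => hPS (J.2.2 P hPp h)
  refine Equiv.ofBijective (fun x => ⟨P ^ x.1 * x.2.1, mul_ne_zero (pow_ne_zero _ hP.ne_zero) x.2.2.1,
    fun Q hQ hQd => ?_⟩) ⟨?_, ?_⟩
  · have hQ0 : Q ≠ ⊥ := by
      rintro rfl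
      exact mul_ne_zero (pow_ne_zero _ hP.ne_zero) x.2.2.1 (zero_dvd_iff.1 hQd)
    have hQ' : Prime Q := Ideal.prime_of_isPrime hQ0 hQ
    rcases hQ'.dvd_or_dvd hQd with h | h
    · have := (hQ'.dvd_prime_iff_associated hP).1 (hQ'.dvd_of_dvd_pow h)
      rw [associated_iff_eq] at this
      exact Finset.mem_insert.2 (Or.inl this)
    · exact Finset.mem_insert_of_mem (x.2.2.2 Q hQ h)
  · have key : ∀ (k k' : ℕ) (J J' : factoredIdeals S), P ^ k * J.1 = P ^ k' * J'.1 → k' ≤ k := by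
      intro k k' J J' h
      by_contra! hk
      obtain ⟨j, rfl⟩ := Nat.exists_eq_add_of_lt hk
      rw [show k + j + 1 = k + (j + 1) by ring, pow_add, mul_assoc] at h
      have := mul_left_cancel₀ (pow_ne_zero _ hP.ne_zero) h
      exact hnd J (this ▸ Dvd.intro _ (by rw [pow_succ', mul_assoc]))
    rintro ⟨k, J⟩ ⟨k', J'⟩ h
    have h' : P ^ k * J.1 = P ^ k' * J'.1 := congrArg Subtype.val h
    obtain rfl : k = k' := le_antisymm (key _ _ _ _ h'.symm) (key _ _ _ _ h')
    rw [Prod.mk.injEq]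
    exact ⟨rfl, Subtype.ext (mul_left_cancel₀ (pow_ne_zero _ hP.ne_zero) h')⟩
  · rintro ⟨I, hI0, hI⟩
    have hfin : FiniteMultiplicity P I := FiniteMultiplicity.of_prime_left hP hI0
    obtain ⟨J, hJ, hPJ⟩ := hfin.exists_eq_pow_mul_and_not_dvd
    refine ⟨⟨multiplicity P I, ⟨J, ?_, fun Q hQ hQd => ?_⟩⟩, Subtype.ext hJ.symm⟩
    · rintro rfl
      exact hI0 (by rw [hJ]; exact mul_zero _)
    · rcases Finset.mem_insert.1 (hI Q hQ (hJ ▸ hQd.mul_left _)) with rfl | h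
      · exact absurd hQd hPJ
      · exact h

theorem hasSum_factoredIdeals {s : ℂ} (hs : 1 < s.re) (S : Finset (Ideal (𝓞 E)))
    (hS : ∀ P ∈ S, Prime P) :
    HasSum (fun I : factoredIdeals S => (absNorm I.1 : ℂ) ^ (-s))
      (∏ P ∈ S, (1 - (absNorm P : ℂ) ^ (-s))⁻¹) := by
  classical
  have hnorm := (hasSum_absNorm_cpow E hs).1
  induction S using Finset.induction_on with
  | empty =>
    rw [Finset.prod_empty, factoredIdeals_empty]
    have := hasSum_unique (fun I : ({⊤} : Set (Ideal (𝓞 E))) => (absNorm I.1 : ℂ) ^ (-s))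
    convert! this using 1
    simp [Set.default_coe_singleton]
  | insert P S hPS ih =>
    have hP := hS P (Finset.mem_insert_self _ _)
    have ih' := ih fun Q hQ => hS Q (Finset.mem_insert_of_mem hQ)
    rw [Finset.prod_insert hPS, ← (factoredIdealsInsertEquiv S P hP hPS).hasSum_iff]
    have hN : 1 < absNorm P := by
      have h0 : absNorm P ≠ 0 := by
        rw [Ne, absNorm_eq_zero_iff]; exact hP.ne_zero
      have h1 : absNorm P ≠ 1 := by
        rw [Ne, absNorm_eq_one_iff]; exact (Ideal.isPrime_of_prime hP).ne_top
      omega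
    have hlt : ‖(absNorm P : ℂ) ^ (-s)‖ < 1 := by
      rw [Complex.norm_natCast_cpow_of_pos (by omega)]
      exact Real.rpow_lt_one_of_one_lt_of_neg (by exact_mod_cast hN) (by simp; linarith)
    have hgeo := hasSum_geometric_of_norm_lt_one hlt
    have hgeo' : Summable fun k : ℕ => ‖((absNorm P : ℂ) ^ (-s)) ^ k‖ := by
      simpa using summable_geometric_of_lt_one (norm_nonneg _) hlt
    have hJ : Summable fun I : factoredIdeals S => ‖(absNorm I.1 : ℂ) ^ (-s)‖ :=
      hnorm.subtype _
    have hsm : Summable fun x : ℕ × factoredIdeals S =>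
        ((absNorm P : ℂ) ^ (-s)) ^ x.1 * (absNorm x.2.1 : ℂ) ^ (-s) :=
      summable_mul_of_summable_norm (f := fun k : ℕ => ((absNorm P : ℂ) ^ (-s)) ^ k)
        (g := fun J : factoredIdeals S => (absNorm J.1 : ℂ) ^ (-s)) hgeo' hJ
    have hmul := hgeo.mul ih' hsm
    have hfun : ((fun I : factoredIdeals (insert P S) => (absNorm I.1 : ℂ) ^ (-s)) ∘
        factoredIdealsInsertEquiv S P hP hPS) = fun x : ℕ × factoredIdeals S =>
        ((absNorm P : ℂ) ^ (-s)) ^ x.1 * (absNorm x.2.1 : ℂ) ^ (-s) := by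
      funext ⟨k, J⟩
      change (absNorm (P ^ k * J.1) : ℂ) ^ (-s) = _
      rw [map_mul, map_pow, Nat.cast_mul, Nat.cast_pow, ← Nat.cast_pow, Complex.natCast_mul_natCast_cpow, Nat.cast_pow,
        ← Complex.natCast_cpow_natCast_mul, ← Complex.cpow_nat_mul]
    rw [hfun]
    exact hmul

/-- The Euler product of the Dedekind zeta function, grouped by rational primes. -/
theorem dedekindZeta_hasProd {s : ℂ} (hs : 1 < s.re) :
    HasProd (fun p : Nat.Primes => ∏ P ∈ primesAbove E p,
      (1 - (absNorm P : ℂ) ^ (-s))⁻¹) (dedekindZeta E s) := by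
  classical
  obtain ⟨hnorm, hsum⟩ := hasSum_absNorm_cpow E hs
  have hs0 : s ≠ 0 := by rintro rfl; simp at hs; linarith
  have hp0 : ∀ p : Nat.Primes, (span {((p : ℕ) : ℤ)}) ≠ ⊥ := fun p => by simpa using p.2.ne_zero
  have hpm : ∀ p : Nat.Primes, (span {((p : ℕ) : ℤ)}).IsMaximal := fun p =>
    PrincipalIdealRing.isMaximal_of_irreducible (Nat.prime_iff_prime_int.mp p.2).irreducible
  let S : Finset Nat.Primes → Finset (Ideal (𝓞 E)) := fun F =>
    F.biUnion fun p => primesAbove E p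
  have hSprime : ∀ F, ∀ P ∈ S F, Prime P := by
    intro F P hP
    obtain ⟨p, -, hp⟩ := Finset.mem_biUnion.1 hP
    rw [mem_primesAbove] at hp
    have := hp.2
    exact Ideal.prime_of_isPrime (Ideal.ne_bot_of_liesOver_of_ne_bot (hp0 p) P) hp.1
  have hprod : ∀ F : Finset Nat.Primes,
      ∏ p ∈ F, ∏ P ∈ primesAbove E p, (1 - (absNorm P : ℂ) ^ (-s))⁻¹ =
        ∏ P ∈ S F, (1 - (absNorm P : ℂ) ^ (-s))⁻¹ := by
    intro F
    rw [Finset.prod_biUnion]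
    · intro p _ q _ hpq
      refine Finset.disjoint_left.2 fun P hP hQ => ?_
      rw [mem_primesAbove] at hP hQ
      have h := (hP.2.over).trans hQ.2.over.symm
      apply hpq
      have h2 := congrArg absNorm h
      simp only [absNorm_span_singleton, Algebra.norm_self, MonoidHom.id_apply,
        Int.natAbs_natCast] at h2
      exact Subtype.ext h2
  have hlim : Tendsto (fun F : Finset Nat.Primes => ∑' I : Ideal (𝓞 E),
      (factoredIdeals (S F)).indicator (fun I => (absNorm I : ℂ) ^ (-s)) I) atTop
      (𝓝 (∑' I : Ideal (𝓞 E), (absNorm I : ℂ) ^ (-s))) := by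
    refine tendsto_tsum_of_dominated_convergence hnorm (fun I => ?_)
      (Eventually.of_forall fun F I => norm_indicator_le_norm_self _ _)
    rcases eq_or_ne I ⊥ with rfl | hI
    · refine tendsto_const_nhds.congr fun F => ?_
      by_cases h : (⊥ : Ideal (𝓞 E)) ∈ factoredIdeals (S F)
      · rw [Set.indicator_of_mem h]
      · rw [Set.indicator_of_notMem h]
        simp [Complex.zero_cpow (neg_ne_zero.2 hs0)]
    · refine tendsto_const_nhds.congr' ?_
      filter_upwards [eventually_ge_atTop
        ((absNorm I).primeFactors.subtype Nat.Prime : Finset Nat.Primes)] with F hF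
      rw [Set.indicator_of_mem]
      refine ⟨hI, fun P hP hPI => Finset.mem_biUnion.2 ?_⟩
      have hP0 : P ≠ ⊥ := by
        rintro rfl; exact hI (zero_dvd_iff.1 hPI)
      have : NeZero P := ⟨hP0⟩
      have hpr := Nat.absNorm_under_prime P
      refine ⟨⟨_, hpr⟩, hF ?_, ?_⟩
      · rw [Finset.mem_subtype, Nat.mem_primeFactors]
        refine ⟨hpr, (Int.absNorm_under_dvd_absNorm P).trans (absNorm_dvd_absNorm_of_le
          (Ideal.dvd_iff_le.1 hPI)), ?_⟩
        rwa [Ne, absNorm_eq_zero_iff]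
      · rw [mem_primesAbove]
        exact ⟨hP, Int.liesOver_span_absNorm P⟩
  rw [hsum.tsum_eq] at hlim
  refine hlim.congr fun F => ?_
  rw [hprod, ← (hasSum_factoredIdeals hs (S F) (hSprime F)).tsum_eq]
  exact (tsum_subtype (factoredIdeals (S F)) fun I => (absNorm I : ℂ) ^ (-s)).symm

end EulerProduct

/-! ### Dedekind zeta functions of abelian fields -/

section AbelianZeta

open DirichletCharacter IsCyclotomicExtension.Rat

theorem dedekindZeta_congr {E F : Type*} [Field E] [NumberField E] [Field F] [NumberField F]
    (e : E ≃+* F) (s : ℂ) : dedekindZeta E s = dedekindZeta F s := by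
  let e' : 𝓞 E ≃+* 𝓞 F := RingOfIntegers.mapRingEquiv e
  have h : ∀ I : Ideal (𝓞 E), absNorm (I.map e') = absNorm I := fun I => by
    rw [absNorm_apply, absNorm_apply, Submodule.cardQuot_apply, Submodule.cardQuot_apply]
    exact (Nat.card_congr (Ideal.quotientEquiv I (I.map e') e' rfl).toEquiv).symm
  unfold dedekindZeta
  congr 1
  funext n
  norm_cast
  refine Nat.card_congr
    { toFun := fun I => ⟨I.1.map e', by rw [h, I.2]⟩
      invFun := fun J => ⟨J.1.comap e', by
        rw [← h, Ideal.map_comap_of_surjective _ e'.surjective, J.2]⟩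
      left_inv := fun I => Subtype.ext (Ideal.comap_map_of_bijective e' e'.bijective)
      right_inv := fun J => Subtype.ext (Ideal.map_comap_of_surjective _ e'.surjective _) }

theorem primLFunction_hasProd {N : ℕ} [NeZero N] (χ : DirichletCharacter ℂ N) {s : ℂ}
    (hs : 1 < s.re) :
    HasProd (fun p : Nat.Primes => (1 - χ.primitiveCharacter (p : ℕ) * (p : ℂ) ^ (-s))⁻¹)
      (primLFunction χ s) := by
  have : NeZero χ.conductor := ⟨χ.conductor_ne_zero⟩
  unfold primLFunction
  rw [LFunction_eq_LSeries _ hs]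
  exact LSeries_eulerProduct_hasProd _ hs

theorem differentiableAt_primLFunction {N : ℕ} [NeZero N] (χ : DirichletCharacter ℂ N) {s : ℂ}
    (hs : s ≠ 1) : DifferentiableAt ℂ (primLFunction χ) s := by
  have : NeZero χ.conductor := ⟨χ.conductor_ne_zero⟩
  exact differentiableAt_LFunction χ.primitiveCharacter s (Or.inl hs)

/-- The cyclotomic field `ℚ(ζ_N)` inside `ℂ`. -/
def cycField (N : ℕ) : IntermediateField ℚ ℂ :=
  IntermediateField.adjoin ℚ {Complex.exp (2 * Real.pi * Complex.I / N)}

variable (N : ℕ) [NeZero N]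

theorem isPrimitiveRoot_exp : IsPrimitiveRoot (Complex.exp (2 * Real.pi * Complex.I / N)) N :=
  Complex.isPrimitiveRoot_exp N (NeZero.ne N)

theorem hasProd_prod_primLFunction {n : ℕ} [NeZero n] (S : Finset (DirichletCharacter ℂ n)) {s : ℂ}
    (hs : 1 < s.re) :
    HasProd (fun p : Nat.Primes => ∏ χ ∈ S, (1 - χ.primitiveCharacter (p : ℕ) * (p : ℂ) ^ (-s))⁻¹)
      (∏ χ ∈ S, primLFunction χ s) :=
  hasProd_prod fun χ _ => primLFunction_hasProd χ hs

theorem dedekindZeta_eq_prod_fieldChars {n : ℕ} [NeZero n] {K : Type*} [Field K] [NumberField K]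
    [IsCyclotomicExtension {n} ℚ K] [IsAbelianGalois ℚ K] (F : IntermediateField ℚ K) {s : ℂ}
    (hs : 1 < s.re) :
    dedekindZeta F s = ∏ χ ∈ fieldChars n F, primLFunction χ s := by
  have h2 := hasProd_prod_primLFunction (fieldChars n F) hs
  refine HasProd.unique (dedekindZeta_hasProd (E := F) hs) ?_
  convert! h2 using 2 with p
  have : Fact (p : ℕ).Prime := ⟨p.2⟩
  rw [Finset.prod_inv_distrib, Finset.prod_inv_distrib]
  exact congrArg _ (prod_primesOver_eq_prod_fieldChars F p s)

/-- The field `ℚ(ζ_N)` as an abstract field: its only `ℚ`-algebra structure is the one that every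
field of characteristic zero carries. -/
def CycType (N : ℕ) : Type := cycField N

instance : Field (CycType N) := inferInstanceAs (Field (cycField N))

instance : CharZero (CycType N) := inferInstanceAs (CharZero (cycField N))

/-- The inclusion of `ℚ(ζ_N)` into `ℂ`. -/
def cycEmb (N : ℕ) : CycType N →ₐ[ℚ] ℂ := (cycField N).val.toRingHom.toRatAlgHom

theorem fieldRange_cycEmb (N : ℕ) : (cycEmb N).fieldRange = cycField N := by
  ext x
  rw [AlgHom.mem_fieldRange]
  exact ⟨fun ⟨y, hy⟩ => hy ▸ y.2, fun h => ⟨⟨x, h⟩, rfl⟩⟩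

instance : IsCyclotomicExtension {N} ℚ (CycType N) := by
  have h : IsCyclotomicExtension {N} ℚ (cycField N) :=
    (IntermediateField.isCyclotomicExtension_singleton_iff_eq_adjoin _ _ _ _
      (isPrimitiveRoot_exp N)).mpr rfl
  exact IsCyclotomicExtension.equiv {N} ℚ (cycField N)
    ((RingEquiv.refl (cycField N) : cycField N ≃+* CycType N).toRatAlgEquiv)

instance : NumberField (CycType N) := IsCyclotomicExtension.numberField {N} ℚ (CycType N)

instance : IsAbelianGalois ℚ (CycType N) :=
  IsCyclotomicExtension.isAbelianGalois {N} ℚ (CycType N)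

/-- The Dirichlet characters modulo `N` attached to a subfield of `ℚ(ζ_N)`. -/
def charsOf (E : IntermediateField ℚ ℂ) : Finset (DirichletCharacter ℂ N) :=
  fieldChars N (E.comap (cycEmb N))

variable {N}

/-- The automorphism of `ℚ(ζ_N)` raising roots of unity to the power `a`. -/
def cycAut (a : (ZMod N)ˣ) : Gal(CycType N/ℚ) := (galEquivZMod N (CycType N)).symm a

theorem cycAut_apply (a : (ZMod N)ˣ) {x : CycType N} (hx : x ^ N = 1) :
    cycAut a x = x ^ (a : ZMod N).val := by
  rw [galEquivZMod_apply_of_pow_eq N (CycType N) (cycAut a) hx, cycAut, MulEquiv.apply_symm_apply]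

theorem mem_charsOf {E : IntermediateField ℚ ℂ} {χ : DirichletCharacter ℂ N} :
    χ ∈ charsOf N E ↔ ∀ a : (ZMod N)ˣ, (∀ x : CycType N, cycEmb N x ∈ E → cycAut a x = x) →
      χ a = 1 := by
  rw [charsOf, mem_fieldChars, (galEquivZMod N (CycType N)).symm.forall_congr_right.symm]
  refine forall_congr' fun a => ?_
  rw [MulEquiv.toEquiv_eq_coe, MulEquiv.coe_toEquiv, MulEquiv.apply_symm_apply]
  refine imp_congr_left ?_
  rw [IntermediateField.mem_fixingSubgroup_iff]
  rfl

omit [NeZero N] in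
theorem map_comap_cycEmb {E : IntermediateField ℚ ℂ} (h : E ≤ cycField N) :
    (E.comap (cycEmb N)).map (cycEmb N) = E := by
  ext x
  rw [IntermediateField.mem_map]
  refine ⟨fun ⟨y, hy, hyx⟩ => hyx ▸ hy, fun hx => ?_⟩
  obtain ⟨y, rfl⟩ : x ∈ (cycEmb N).fieldRange := fieldRange_cycEmb N ▸ h hx
  exact ⟨y, hx, rfl⟩

theorem coe_charsOf (E : IntermediateField ℚ ℂ) :
    (charsOf N E : Set (DirichletCharacter ℂ N)) =
      intermediateFieldEquivSubgroupChar N (CycType N) ℂ (E.comap (cycEmb N)) := by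
  simp [charsOf, fieldChars]

/-- A subfield of `ℚ(ζ_N)` in `ℂ` is isomorphic to its preimage in the abstract field. -/
def comapCycEmbEquiv {E : IntermediateField ℚ ℂ} (hE : E ≤ cycField N) :
    E.comap (cycEmb N) ≃ₐ[ℚ] E :=
  ((E.comap (cycEmb N)).equivMap (cycEmb N)).trans
    (IntermediateField.equivOfEq (map_comap_cycEmb hE))

theorem card_charsOf {E : IntermediateField ℚ ℂ} (hE : E ≤ cycField N) :
    (charsOf N E).card = Module.finrank ℚ E := by
  rw [← Set.ncard_coe_finset, coe_charsOf, ← Nat.card_coe_set_eq, SetLike.coe_sort_coe,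
    card_intermediateFieldEquivSubgroupChar]
  exact (comapCycEmbEquiv hE).toLinearEquiv.finrank_eq

theorem le_of_charsOf_subset {E F : IntermediateField ℚ ℂ} (hE : E ≤ cycField N)
    (hF : F ≤ cycField N) (h : charsOf N E ⊆ charsOf N F) : E ≤ F := by
  rw [← Finset.coe_subset, coe_charsOf, coe_charsOf, SetLike.coe_subset_coe, OrderIso.le_iff_le] at h
  rw [← map_comap_cycEmb hE, ← map_comap_cycEmb hF]
  exact IntermediateField.map_mono _ h

theorem charsOf_mono {E F : IntermediateField ℚ ℂ} (h : E ≤ F) : charsOf N E ⊆ charsOf N F := by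
  rw [← Finset.coe_subset, coe_charsOf, coe_charsOf, SetLike.coe_subset_coe, OrderIso.le_iff_le]
  exact (IntermediateField.gc_map_comap _).monotone_u h

theorem mul_mem_charsOf {E : IntermediateField ℚ ℂ} {χ ψ : DirichletCharacter ℂ N}
    (hχ : χ ∈ charsOf N E) (hψ : ψ ∈ charsOf N E) : χ * ψ ∈ charsOf N E := by
  rw [← Finset.mem_coe, coe_charsOf] at *
  exact mul_mem hχ hψ

theorem pow_card_charsOf {E : IntermediateField ℚ ℂ} {χ : DirichletCharacter ℂ N}
    (hχ : χ ∈ charsOf N E) : χ ^ (charsOf N E).card = 1 := by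
  have h := coe_charsOf (N := N) E
  rw [← Set.ncard_coe_finset, h, ← Nat.card_coe_set_eq, SetLike.coe_sort_coe]
  rw [← Finset.mem_coe, h] at hχ
  exact congrArg Subtype.val (pow_card_eq_one' (x := (⟨χ, hχ⟩ :
    intermediateFieldEquivSubgroupChar N (CycType N) ℂ (E.comap (cycEmb N)))))

theorem mem_charsOf_sup {E F : IntermediateField ℚ ℂ} (hE : E ≤ cycField N) (hF : F ≤ cycField N)
    {χ : DirichletCharacter ℂ N} (hχ : χ ∈ charsOf N (E ⊔ F)) :
    ∃ χ₁ ∈ charsOf N E, ∃ χ₂ ∈ charsOf N F, χ₁ * χ₂ = χ := by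
  have h : (E ⊔ F).comap (cycEmb N) =
      E.comap (cycEmb N) ⊔ F.comap (cycEmb N) := by
    apply IntermediateField.map_injective (cycEmb N)
    rw [map_comap_cycEmb (sup_le hE hF), IntermediateField.map_sup, map_comap_cycEmb hE, map_comap_cycEmb hF]
  rw [← Finset.mem_coe, coe_charsOf, h, OrderIso.map_sup, SetLike.mem_coe, Subgroup.mem_sup] at hχ
  obtain ⟨a, ha, b, hb, hab⟩ := hχ
  refine ⟨a, ?_, b, ?_, hab⟩
  · rw [← Finset.mem_coe, coe_charsOf]; exact ha
  · rw [← Finset.mem_coe, coe_charsOf]; exact hb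

/-- The Dedekind zeta function of an abelian field is the product of the `L`-functions of its
primitive Dirichlet characters. -/
theorem isDedekindZeta_prod_charsOf {E : IntermediateField ℚ ℂ} [NumberField E]
    (hE : E ≤ cycField N) :
    IsDedekindZeta E (fun s => ∏ χ ∈ charsOf N E, primLFunction χ s) where
  differentiableOn := fun s hs => by
    refine DifferentiableAt.differentiableWithinAt ?_
    exact DifferentiableAt.fun_finsetProd fun χ _ => differentiableAt_primLFunction χ hs
  eq_dedekindZeta := fun s hs => by
    exact ((dedekindZeta_congr (comapCycEmbEquiv hE).toRingEquiv s).symm.trans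
      (dedekindZeta_eq_prod_fieldChars (n := N) (E.comap (cycEmb N)) hs)).symm

end AbelianZeta

/-! ### Even characters of `2`-power level -/

section EvenChar

open DirichletCharacter

/-- The unit `5` modulo `2^(k+2)`; together with `-1` it generates all units. -/
def unitFive (k : ℕ) : (ZMod (2 ^ (k + 2)))ˣ :=
  ZMod.unitOfCoprime 5 (Nat.Coprime.pow_right _ (by norm_num))

theorem coe_unitFive (k : ℕ) : (unitFive k : ZMod (2 ^ (k + 2))) = 5 := by
  simp [unitFive]

theorem orderOf_unitFive (k : ℕ) : orderOf (unitFive k) = 2 ^ k := by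
  rw [← orderOf_units, coe_unitFive, ZMod.orderOf_five]

theorem four_dvd_two_pow (k : ℕ) : 4 ∣ 2 ^ (k + 2) := ⟨2 ^ k, by ring⟩

theorem card_units_two_pow (k : ℕ) : Nat.card (ZMod (2 ^ (k + 2)))ˣ = 2 ^ (k + 1) := by
  rw [Nat.card_eq_fintype_card, ZMod.card_units_eq_totient, Nat.totient_prime_pow_succ Nat.prime_two]
  simp

theorem eq_or_eq_neg_unitFive_pow {k : ℕ} (u : (ZMod (2 ^ (k + 2)))ˣ) :
    ∃ i : ℕ, u = unitFive k ^ i ∨ u = -unitFive k ^ i := by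
  set H := Subgroup.zpowers (unitFive k) with hH
  have hc : Nat.card H = 2 ^ k := by rw [Nat.card_zpowers, orderOf_unitFive]
  have hcu := card_units_two_pow k
  have hidx : H.index = 2 := by
    have := H.card_mul_index
    rw [hc, hcu] at this
    exact Nat.eq_of_mul_eq_mul_left (Nat.two_pow_pos k) (Eq.trans this (pow_succ 2 k) : 2 ^ k * H.index = 2 ^ k * 2)
  have hneg : (-1 : (ZMod (2 ^ (k + 2)))ˣ) ∉ H := by
    intro h
    have hfin := mem_powers_iff_mem_zpowers.2 h
    obtain ⟨i, hi⟩ := Submonoid.mem_powers_iff _ _ |>.1 hfin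
    -- modulo `4` the powers of `5` are `1`
    have h4 := congrArg (fun u : (ZMod (2 ^ (k + 2)))ˣ =>
      ZMod.castHom (four_dvd_two_pow k) (ZMod 4) u) hi
    simp only [Units.val_pow_eq_pow_val, coe_unitFive, map_pow, Units.val_neg, Units.val_one,
      map_neg, map_one] at h4
    rw [map_ofNat, show (OfNat.ofNat 5 : ZMod 4) = 1 from by decide, one_pow] at h4
    exact absurd h4 (by decide)
  by_cases hu : u ∈ H
  · obtain ⟨i, hi⟩ := Submonoid.mem_powers_iff _ _ |>.1 (mem_powers_iff_mem_zpowers.2 hu)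
    exact ⟨i, Or.inl hi.symm⟩
  · have : u * (-1) ∈ H := (Subgroup.mul_mem_iff_of_index_two hidx).2 (iff_of_false hu hneg)
    obtain ⟨i, hi⟩ := Submonoid.mem_powers_iff _ _ |>.1 (mem_powers_iff_mem_zpowers.2 this)
    exact ⟨i, Or.inr (by rw [hi]; simp)⟩

/-- An even character modulo `2^(k+2)` is determined by its value at `5`. -/
theorem even_ext {R : Type*} [CommRing R] {k : ℕ} {χ ψ : DirichletCharacter R (2 ^ (k + 2))}
    (hχ : χ.Even) (hψ : ψ.Even) (h : χ 5 = ψ 5) : χ = ψ := by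
  ext u
  obtain ⟨i, rfl | rfl⟩ := eq_or_eq_neg_unitFive_pow u
  · simp only [Units.val_pow_eq_pow_val, coe_unitFive, map_pow, h]
  · simp only [Units.val_neg, Units.val_pow_eq_pow_val, coe_unitFive, map_pow, h, hχ.eval_neg,
      hψ.eval_neg]

theorem char_five_pow {R : Type*} [CommRing R] {k : ℕ} (χ : DirichletCharacter R (2 ^ (k + 2))) :
    χ 5 ^ 2 ^ k = 1 := by
  rw [← map_pow, ← coe_unitFive, ← Units.val_pow_eq_pow_val, ← orderOf_unitFive k, pow_orderOf_eq_one]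
  simp

/-- The even characters modulo `2^(k+2)`. -/
def evenChars (k : ℕ) : Finset (DirichletCharacter ℂ (2 ^ (k + 2))) :=
  (Set.toFinite {χ : DirichletCharacter ℂ (2 ^ (k + 2)) | χ.Even}).toFinset

theorem mem_evenChars {k : ℕ} {χ : DirichletCharacter ℂ (2 ^ (k + 2))} :
    χ ∈ evenChars k ↔ χ.Even := by
  simp [evenChars]

theorem card_evenChars (k : ℕ) : (evenChars k).card = 2 ^ k := by
  set H := Subgroup.zpowers (-1 : (ZMod (2 ^ (k + 2)))ˣ) with hH
  have h := MulChar.card_subgroupOrderIsoSubgroupMulChar (R := ℂ) (H := H)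
  have hset : ((MulChar.subgroupOrderIsoSubgroupMulChar (ZMod (2 ^ (k + 2))) ℂ H).ofDual :
      Set (DirichletCharacter ℂ (2 ^ (k + 2)))) = evenChars k := by
    ext χ
    rw [SetLike.mem_coe, MulChar.mem_subgroupOrderIsoSubgroupMulChar_iff, Finset.mem_coe,
      mem_evenChars]
    refine ⟨fun h => ?_, ?_⟩
    · have := h (-1) (Subgroup.mem_zpowers _)
      rwa [Units.val_neg, Units.val_one] at this
    rintro h u ⟨i, rfl⟩
    have h' : χ ((-1 : (ZMod (2 ^ (k + 2)))ˣ) : ZMod (2 ^ (k + 2))) = 1 := by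
      rw [Units.val_neg, Units.val_one]; exact h
    have := congrArg Units.val (map_zpow χ.toUnitHom (-1) i)
    rw [MulChar.coe_toUnitHom] at this
    rw [this]
    have h1 : χ.toUnitHom (-1) = 1 := Units.ext (by rw [MulChar.coe_toUnitHom, h', Units.val_one])
    rw [h1, one_zpow, Units.val_one]
  have hc : (evenChars k).card = H.index := by
    rw [← Set.ncard_coe_finset, ← hset, ← Nat.card_coe_set_eq]
    exact h
  have hne : (-1 : (ZMod (2 ^ (k + 2)))ˣ) ≠ 1 := by
    intro h
    have h4 := congrArg (fun u : (ZMod (2 ^ (k + 2)))ˣ =>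
      ZMod.castHom (four_dvd_two_pow k) (ZMod 4) u) h
    simp only [Units.val_neg, Units.val_one, map_neg, map_one] at h4
    exact absurd h4 (by decide)
  have hcard : Nat.card H = 2 := by
    rw [hH, Nat.card_zpowers]
    exact orderOf_eq_prime (by simp) hne
  have h2 := H.card_mul_index
  rw [hcard, card_units_two_pow] at h2
  rw [hc]
  exact Nat.eq_of_mul_eq_mul_left two_pos (h2.trans (pow_succ' 2 k))

/-- Even characters modulo `2^(k+2)` correspond to the `2^k`-th roots of unity. -/
theorem exists_even_char {k : ℕ} {z : ℂ} (hz : z ^ 2 ^ k = 1) :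
    ∃ χ : DirichletCharacter ℂ (2 ^ (k + 2)), χ.Even ∧ χ 5 = z := by
  have h : (evenChars k).image (fun χ => χ 5) = Polynomial.nthRootsFinset (2 ^ k) (1 : ℂ) := by
    apply Finset.eq_of_subset_of_card_le
    · intro w hw
      obtain ⟨χ, -, rfl⟩ := Finset.mem_image.1 hw
      rw [Polynomial.mem_nthRootsFinset (by positivity)]
      exact char_five_pow χ
    · rw [(Complex.isPrimitiveRoot_exp (2 ^ k) (by positivity)).card_nthRootsFinset,
        Finset.card_image_of_injOn, card_evenChars]
      exact fun χ hχ ψ hψ h => even_ext (mem_evenChars.1 hχ) (mem_evenChars.1 hψ) h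
  have hz' : z ∈ (evenChars k).image (fun χ => χ 5) := by
    rw [h, Polynomial.mem_nthRootsFinset (by positivity)]
    exact hz
  obtain ⟨χ, hχ, rfl⟩ := Finset.mem_image.1 hz'
  exact ⟨χ, mem_evenChars.1 hχ, rfl⟩

theorem changeLevel_natCast {R : Type*} [CommRing R] {m n : ℕ} (h : m ∣ n)
    (χ : DirichletCharacter R m) {a : ℕ} (ha : a.Coprime n) : changeLevel h χ a = χ a := by
  have := changeLevel_eq_cast_of_dvd' χ h (a := a) (Nat.isCoprime_iff_coprime.2 ha)
  exact_mod_cast this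

theorem even_changeLevel {R : Type*} [CommRing R] {m n : ℕ} (h : m ∣ n)
    {χ : DirichletCharacter R m} (hχ : χ.Even) : (changeLevel h χ).Even := by
  have := changeLevel_eq_cast_of_dvd' χ h (a := -1) isCoprime_one_left.neg_left
  unfold DirichletCharacter.Even at *
  push_cast at this
  rw [this, hχ]

theorem changeLevel_five {R : Type*} [CommRing R] {j k : ℕ} (h : 2 ^ (j + 2) ∣ 2 ^ (k + 2))
    (χ : DirichletCharacter R (2 ^ (j + 2))) : changeLevel h χ 5 = χ 5 := by
  have := changeLevel_natCast h χ (a := 5) (Nat.Coprime.pow_right _ (by norm_num))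
  exact_mod_cast this

/-- An even character `χ` modulo `2^(k+2)` with `χ(5)^(2^j) = 1` is defined modulo `2^(j+2)`. -/
theorem exists_changeLevel_eq {j k : ℕ} (hjk : j ≤ k) {χ : DirichletCharacter ℂ (2 ^ (k + 2))}
    (hχ : χ.Even) (h : χ 5 ^ 2 ^ j = 1) : ∃ χ' : DirichletCharacter ℂ (2 ^ (j + 2)), χ'.Even ∧
      χ' 5 = χ 5 ∧ changeLevel (Nat.pow_dvd_pow 2 (by omega)) χ' = χ := by
  obtain ⟨χ', he, h5⟩ := exists_even_char h
  exact ⟨χ', he, h5, even_ext (even_changeLevel _ he) hχ (by rw [changeLevel_five, h5])⟩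

theorem IsLayerChar.isPrimitiveRoot {n : ℕ} (hn : 1 ≤ n) {χ : DirichletCharacter ℂ (2 ^ (n + 2))}
    (hχ : IsLayerChar χ) : IsPrimitiveRoot (χ 5) (2 ^ n) := by
  obtain ⟨n, rfl⟩ := Nat.exists_eq_add_of_le' hn
  have : Fact (Nat.Prime 2) := ⟨Nat.prime_two⟩
  rw [IsPrimitiveRoot.iff_orderOf]
  refine orderOf_eq_prime_pow (fun h => ?_) (char_five_pow χ)
  obtain ⟨χ', -, -, h'⟩ := exists_changeLevel_eq (Nat.le_succ n) hχ.1 h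
  have h2 : χ.conductor ∣ 2 ^ (n + 2) :=
    conductor_dvd_of_mem_conductorSet _ ⟨Nat.pow_dvd_pow 2 (by omega), χ', h'.symm⟩
  rw [hχ.2] at h2
  have := (Nat.pow_dvd_pow_iff_le_right (by norm_num : 1 < 2)).1 h2
  omega

theorem LFunction_congr {a b : ℕ} [NeZero a] [NeZero b] (h : a = b) {α : DirichletCharacter ℂ a}
    {β : DirichletCharacter ℂ b} (hαβ : ∀ x : ℤ, α x = β x) (s : ℂ) :
    LFunction α s = LFunction β s := by
  subst h
  have : α = β := by
    ext u
    have := hαβ (u : ZMod a).val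
    rwa [Int.cast_natCast, ZMod.natCast_zmod_val] at this
  rw [this]

theorem primLFunction_changeLevel {m n : ℕ} [NeZero m] [NeZero n] (h : m ∣ n)
    (χ : DirichletCharacter ℂ m) (s : ℂ) :
    primLFunction (changeLevel h χ) s = primLFunction χ s := by
  have : NeZero (changeLevel h χ).conductor := ⟨conductor_ne_zero _⟩
  have : NeZero χ.conductor := ⟨conductor_ne_zero _⟩
  exact LFunction_congr (conductor_changeLevel χ h) (primitiveCharacter_changeLevel_apply h χ) s

end EvenChar

/-! ### The layers of the cyclotomic `ℤ₂`-extension of `ℚ` -/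

section RationalLayers

open DirichletCharacter IsCyclotomicExtension.Rat

/-- The maximal real subfield of `ℚ(ζ_{2^(k+2)})`; it is the `k`-th layer of `ℚ_cyc`. -/
def realCyc (k : ℕ) : IntermediateField ℚ ℂ :=
  IntermediateField.adjoin ℚ {x : ℂ | ∃ ζ : ℂ, ζ ^ (2 ^ (k + 2)) = 1 ∧ x = ζ + ζ⁻¹}

theorem realCyc_mono {j k : ℕ} (h : j ≤ k) : realCyc j ≤ realCyc k := by
  refine IntermediateField.adjoin.mono _ _ _ ?_
  rintro _ ⟨ζ, hζ, rfl⟩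
  refine ⟨ζ, ?_, rfl⟩
  obtain ⟨c, hc⟩ := Nat.pow_dvd_pow 2 (show j + 2 ≤ k + 2 by omega)
  rw [hc, pow_mul, hζ, one_pow]

theorem cyclotomicRat_eq_iSup : cyclotomicRat = ⨆ k, realCyc k := by
  apply le_antisymm
  · rw [cyclotomicRat, IntermediateField.adjoin_le_iff]
    rintro _ ⟨k, ζ, hζ, rfl⟩
    refine le_iSup realCyc k (IntermediateField.subset_adjoin _ _ ⟨ζ, ?_, rfl⟩)
    rw [pow_add, pow_mul, hζ, one_pow]
  · refine iSup_le fun k => ?_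
    refine IntermediateField.adjoin.mono _ _ _ ?_
    rintro _ ⟨ζ, hζ, rfl⟩
    exact ⟨k + 2, ζ, hζ, rfl⟩

theorem realCyc_le (k : ℕ) : realCyc k ≤ cyclotomicRat := by
  rw [cyclotomicRat_eq_iSup]
  exact le_iSup realCyc k

variable {N : ℕ} [NeZero N]

theorem mem_cycField_of_pow_eq_one {ζ : ℂ} (h : ζ ^ N = 1) : ζ ∈ cycField N := by
  obtain ⟨i, -, rfl⟩ := (isPrimitiveRoot_exp N).eq_pow_of_pow_eq_one h
  exact pow_mem (IntermediateField.mem_adjoin_simple_self _ _) i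

omit [NeZero N] in
theorem exists_cycEmb_eq {z : ℂ} (h : z ∈ cycField N) : ∃ x : CycType N, cycEmb N x = z := by
  rw [← fieldRange_cycEmb] at h
  exact h

theorem cycField_mono {M : ℕ} (h : N ∣ M) [NeZero M] : cycField N ≤ cycField M := by
  rw [cycField, IntermediateField.adjoin_le_iff, Set.singleton_subset_iff]
  obtain ⟨c, rfl⟩ := h
  exact mem_cycField_of_pow_eq_one (by rw [pow_mul, (isPrimitiveRoot_exp N).pow_eq_one, one_pow])

theorem realCyc_le_cycField {k : ℕ} (h : 2 ^ (k + 2) ∣ N) : realCyc k ≤ cycField N := by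
  rw [realCyc, IntermediateField.adjoin_le_iff]
  rintro _ ⟨ζ, hζ, rfl⟩
  have : ζ ∈ cycField N := by
    obtain ⟨c, rfl⟩ := h
    exact mem_cycField_of_pow_eq_one (by rw [pow_mul, hζ, one_pow])
  exact add_mem this (inv_mem this)

/-- An automorphism of `ℚ(ζ_N)` that fixes generators of a subfield fixes the subfield. -/
theorem cycAut_fix_of_adjoin {S : Set ℂ} {a : (ZMod N)ˣ}
    (h : ∀ y ∈ S, ∃ x : CycType N, cycEmb N x = y ∧ cycAut a x = x) (x : CycType N)
    (hx : cycEmb N x ∈ IntermediateField.adjoin ℚ S) : cycAut a x = x := by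
  have hle : IntermediateField.adjoin ℚ S ≤
      (IntermediateField.fixedField (Subgroup.zpowers (cycAut a))).map (cycEmb N) := by
    rw [IntermediateField.adjoin_le_iff]
    intro y hy
    obtain ⟨x, rfl, hx⟩ := h y hy
    refine ⟨x, ?_, rfl⟩
    rintro ⟨_, i, rfl⟩
    have h1 : cycAut a ∈ stabilizer Gal(CycType N/ℚ) x := hx
    exact (zpow_mem h1 i : _)
  obtain ⟨y, hy, hyx⟩ := hle hx
  obtain rfl := (cycEmb N).injective hyx
  exact hy ⟨cycAut a, Subgroup.mem_zpowers _⟩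

theorem even_of_mem_charsOf_realCyc {k : ℕ} {χ : DirichletCharacter ℂ (2 ^ (k + 2))}
    (h : χ ∈ charsOf (2 ^ (k + 2)) (realCyc k)) : χ.Even := by
  have h1 := mem_charsOf.1 h (-1) ?_
  · rwa [Units.val_neg, Units.val_one] at h1
  refine cycAut_fix_of_adjoin ?_
  rintro _ ⟨ζ, hζ, rfl⟩
  obtain ⟨x, rfl⟩ := exists_cycEmb_eq (mem_cycField_of_pow_eq_one hζ)
  have hx : x ^ 2 ^ (k + 2) = 1 := (cycEmb _).injective ((map_pow _ _ _).trans (hζ.trans (map_one _).symm))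
  have hx0 : x ≠ 0 := by rintro rfl; simp at hx
  refine ⟨x + x⁻¹, by simp, ?_⟩
  have key : cycAut (-1 : (ZMod (2 ^ (k + 2)))ˣ) x = x⁻¹ := by
    rw [cycAut_apply _ hx]
    refine eq_inv_of_mul_eq_one_left ?_
    rw [← pow_succ]
    have hd : 2 ^ (k + 2) ∣ ((-1 : (ZMod (2 ^ (k + 2)))ˣ) : ZMod (2 ^ (k + 2))).val + 1 := by
      rw [← ZMod.natCast_eq_zero_iff, Nat.cast_add, ZMod.natCast_zmod_val]
      simp
    obtain ⟨c, hc⟩ := hd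
    rw [hc, pow_mul, hx, one_pow]
  rw [map_add, map_inv₀, key, inv_inv]
  exact add_comm (x⁻¹) x

/-- An even character modulo `2^(k+2)` is trivial on the automorphisms fixing `realCyc k`. -/
theorem changeLevel_mem_charsOf_realCyc {k : ℕ} (hk : 2 ^ (k + 2) ∣ N)
    {χ : DirichletCharacter ℂ (2 ^ (k + 2))} (hχ : χ.Even) :
    changeLevel hk χ ∈ charsOf N (realCyc k) := by
  rw [mem_charsOf]
  intro a ha
  obtain ⟨x, hx⟩ := exists_cycEmb_eq (N := N) (z := Complex.exp (2 * Real.pi * Complex.I / (2 ^ (k + 2) : ℕ)))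
    (cycField_mono hk (IntermediateField.mem_adjoin_simple_self _ _))
  have hprim : IsPrimitiveRoot x (2 ^ (k + 2)) := by
    have := isPrimitiveRoot_exp (2 ^ (k + 2))
    rw [← hx] at this
    exact this.of_map_of_injective (cycEmb N).injective
  have hxN : x ^ N = 1 := (hprim.pow_eq_one_iff_dvd N).2 hk
  have hx0 : x ≠ 0 := hprim.ne_zero (by positivity)
  have h1 := ha (x + x⁻¹) (by
    refine IntermediateField.subset_adjoin _ _ ⟨cycEmb N x, ?_, by simp⟩
    rw [← map_pow, hprim.pow_eq_one, map_one])
  rw [map_add, map_inv₀, cycAut_apply _ hxN] at h1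
  set y := x ^ (a : ZMod N).val with hy
  have hy0 : y ≠ 0 := pow_ne_zero _ hx0
  -- `y + y⁻¹ = x + x⁻¹` forces `y = x` or `y = x⁻¹`
  have h2 : (y - x) * (y * x - 1) = 0 := by
    field_simp at h1
    linear_combination h1
  have hval : changeLevel hk χ a = χ ((a : ZMod N).val : ℕ) := by
    have hc : ((a : ZMod N).val).Coprime N := ZMod.val_coe_unit_coprime a
    have := changeLevel_natCast hk χ hc
    rwa [ZMod.natCast_zmod_val] at this
  rw [hval]
  rcases mul_eq_zero.1 h2 with h3 | h3
  · have h4 : x ^ ((a : ZMod N).val + (2 ^ (k + 2) - 1)) = 1 := by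
      rw [pow_add, ← hy, sub_eq_zero.1 h3, ← pow_succ', Nat.sub_add_cancel Nat.one_le_two_pow,
        hprim.pow_eq_one]
    rw [hprim.pow_eq_one_iff_dvd] at h4
    have h5 := (ZMod.natCast_eq_zero_iff _ _).2 h4
    rw [Nat.cast_add, Nat.cast_sub Nat.one_le_two_pow, ZMod.natCast_self, Nat.cast_one, zero_sub,
      ← sub_eq_add_neg, sub_eq_zero] at h5
    rw [h5, map_one]
  · have : x ^ ((a : ZMod N).val + 1) = 1 := by rw [pow_succ]; exact sub_eq_zero.1 h3
    rw [hprim.pow_eq_one_iff_dvd] at this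
    have h4 := (ZMod.natCast_eq_zero_iff _ _).2 this
    push_cast at h4
    rw [eq_neg_of_add_eq_zero_left h4]
    exact hχ

theorem charsOf_realCyc (k : ℕ) : charsOf (2 ^ (k + 2)) (realCyc k) = evenChars k := by
  ext χ
  rw [mem_evenChars]
  refine ⟨even_of_mem_charsOf_realCyc, fun h => ?_⟩
  have := changeLevel_mem_charsOf_realCyc dvd_rfl h
  rwa [changeLevel_self] at this

theorem finrank_realCyc (k : ℕ) : Module.finrank ℚ (realCyc k) = 2 ^ k := by
  rw [← card_charsOf (realCyc_le_cycField (dvd_refl (2 ^ (k + 2)))), charsOf_realCyc, card_evenChars]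

theorem mem_charsOf_realCyc {k : ℕ} (hk : 2 ^ (k + 2) ∣ N) {η : DirichletCharacter ℂ N} :
    η ∈ charsOf N (realCyc k) ↔ ∃ χ ∈ evenChars k, changeLevel hk χ = η := by
  classical
  have h : charsOf N (realCyc k) = (evenChars k).image (changeLevel hk) := by
    symm
    apply Finset.eq_of_subset_of_card_le
    · intro η hη
      obtain ⟨χ, hχ, rfl⟩ := Finset.mem_image.1 hη
      exact changeLevel_mem_charsOf_realCyc hk (mem_evenChars.1 hχ)
    · rw [Finset.card_image_of_injective _ (changeLevel_injective hk), card_evenChars,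
        card_charsOf (realCyc_le_cycField hk), finrank_realCyc]
  rw [h, Finset.mem_image]

/-- A finite extension inside `F · ℚ_cyc` lies in `F · realCyc k` for some `k`. -/
theorem exists_le_sup_realCyc {F E : IntermediateField ℚ ℂ} [FiniteDimensional ℚ E]
    (h : E ≤ cyclotomicExt F) : ∃ k, E ≤ F ⊔ realCyc k := by
  rw [cyclotomicExt, cyclotomicRat_eq_iSup, sup_iSup] at h
  have hmono : Monotone fun k => F ⊔ realCyc k := fun i j hij => sup_le_sup_left (realCyc_mono hij) F
  have hmem : ∀ x : E, ∃ k, (x : ℂ) ∈ F ⊔ realCyc k := fun x => by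
    have := h x.2
    rwa [← SetLike.mem_coe, IntermediateField.coe_iSup_of_directed hmono.directed_le,
      Set.mem_iUnion] at this
  let b := Module.finBasis ℚ E
  choose k hk using fun i => hmem (b i)
  refine ⟨Finset.univ.sup k, fun x hx => ?_⟩
  have hsum := congrArg (algebraMap E ℂ) (b.sum_repr ⟨x, hx⟩)
  rw [map_sum] at hsum
  change _ = x at hsum
  rw [← hsum]
  refine sum_mem fun i _ => ?_
  rw [Algebra.smul_def, map_mul]
  exact mul_mem (IntermediateField.algebraMap_mem _ _)
    (hmono (Finset.le_sup (Finset.mem_univ i)) (hk i))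

theorem mem_charsOf_realCyc_of_pow_eq_one {n k : ℕ} (hn : 2 ^ (n + 2) ∣ N)
    (hk : 2 ^ (k + 2) ∣ N) (hnk : n ≤ k) {χ : DirichletCharacter ℂ (2 ^ (k + 2))} (hχ : χ.Even)
    (h : χ 5 ^ 2 ^ n = 1) : changeLevel hk χ ∈ charsOf N (realCyc n) := by
  obtain ⟨χ', he, -, rfl⟩ := exists_changeLevel_eq hnk hχ h
  rw [← changeLevel_trans]
  exact changeLevel_mem_charsOf_realCyc hn he

theorem isLayer_bot_iff {n : ℕ} {E : IntermediateField ℚ ℂ} : IsLayer ⊥ n E ↔ E = realCyc n := by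
  have hfin : ∀ n, FiniteDimensional ℚ (realCyc n) := fun n =>
    Module.finite_of_finrank_pos (by rw [finrank_realCyc]; positivity)
  constructor
  · intro h
    have hr := h.degree
    rw [IntermediateField.relfinrank_bot_left] at hr
    have hE : FiniteDimensional ℚ E := Module.finite_of_finrank_pos (by rw [hr]; positivity)
    obtain ⟨k', hk'⟩ := exists_le_sup_realCyc h.le_cyclotomicExt
    rw [bot_sup_eq] at hk'
    set k := max k' n
    have hnk : n ≤ k := le_max_right _ _
    have hEk : E ≤ realCyc k := hk'.trans (realCyc_mono (le_max_left _ _))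
    have hEN : E ≤ cycField (2 ^ (k + 2)) := hEk.trans (realCyc_le_cycField dvd_rfl)
    have hdvd : 2 ^ (n + 2) ∣ 2 ^ (k + 2) := Nat.pow_dvd_pow 2 (by omega)
    have hle : E ≤ realCyc n := by
      refine le_of_charsOf_subset hEN (realCyc_le_cycField hdvd) fun χ hχ => ?_
      have he : χ.Even := even_of_mem_charsOf_realCyc (charsOf_mono hEk hχ)
      have hp := pow_card_charsOf hχ
      rw [card_charsOf hEN, hr] at hp
      have h5 : χ 5 ^ 2 ^ n = 1 := by
        rw [← coe_unitFive, ← MulChar.pow_apply_coe, hp, MulChar.one_apply_coe]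
      have := mem_charsOf_realCyc_of_pow_eq_one hdvd dvd_rfl hnk he h5
      rwa [changeLevel_self] at this
    exact IntermediateField.eq_of_le_of_finrank_eq hle (by rw [hr, finrank_realCyc])
  · rintro rfl
    exact ⟨bot_le, (realCyc_le n).trans le_sup_right, by
      rw [IntermediateField.relfinrank_bot_left, finrank_realCyc]⟩

end RationalLayers

/-! ### The quadratic field `ℚ(√d)` inside a cyclotomic field -/

section QuadraticField

open DirichletCharacter IsCyclotomicExtension.Rat

variable {N : ℕ} [NeZero N]

theorem exists_isPrimitiveRoot_cycType {n : ℕ} [NeZero n] (h : n ∣ N) :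
    ∃ x : CycType N, IsPrimitiveRoot x n := by
  obtain ⟨x, hx⟩ := exists_cycEmb_eq (N := N)
    (cycField_mono h (IntermediateField.mem_adjoin_simple_self ℚ
      (Complex.exp (2 * Real.pi * Complex.I / n))))
  have := isPrimitiveRoot_exp n
  rw [← hx] at this
  exact ⟨x, this.of_map_of_injective (cycEmb N).injective⟩

/-- The quadratic Gauss sum for `p`, on which Galois acts through the Legendre symbol. -/
theorem exists_gaussSum {p : ℕ} [hp : Fact p.Prime] (hp2 : p ≠ 2) (h : p ∣ N) :
    ∃ G : CycType N, G ^ 2 = (jacobiSym (-1) p * p : ℤ) ∧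
      ∀ a : (ZMod N)ˣ, cycAut a G = (jacobiSym (a : ZMod N).val p : ℤ) * G := by
  obtain ⟨x, hx⟩ := exists_isPrimitiveRoot_cycType h
  set χ := (quadraticChar (ZMod p)).ringHomComp (Int.castRingHom (CycType N)) with hχ
  set e := AddChar.zmodChar p hx.pow_eq_one with he
  have hrc : ringChar (ZMod p) ≠ 2 := by rwa [ZMod.ringChar_zmod_n]
  have hinj : Function.Injective (Int.castRingHom (CycType N)) := Int.cast_injective
  have hne : χ ≠ 1 := by
    rw [hχ, MulChar.ringHomComp_ne_one_iff hinj]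
    exact quadraticChar_ne_one hrc
  have hq : χ.IsQuadratic := (quadraticChar_isQuadratic (ZMod p)).comp _
  have hJ : ∀ b : ℤ, χ b = (jacobiSym b p : ℤ) := fun b => by
    rw [← jacobiSym.legendreSym.to_jacobiSym]
    rfl
  refine ⟨gaussSum χ e, ?_, fun a => ?_⟩
  · rw [gaussSum_sq hne hq (AddChar.zmodChar_primitive_of_primitive_root p hx), ZMod.card]
    have := hJ (-1)
    push_cast at this ⊢
    rw [this]
  · have hc : ((a : ZMod N).val).Coprime p := (ZMod.val_coe_unit_coprime a).of_dvd_right h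
    have hu := gaussSum_mulShift χ e (ZMod.unitOfCoprime _ hc)
    have hsq : χ ((a : ZMod N).val : ℤ) * χ ((a : ZMod N).val : ℤ) = 1 := by
      rw [hJ, ← Int.cast_mul, ← pow_two, jacobiSym.sq_one (by exact_mod_cast hc), Int.cast_one]
    have hs : cycAut a (gaussSum χ e) = gaussSum χ (e.mulShift (ZMod.unitOfCoprime _ hc)) := by
      rw [gaussSum, gaussSum, map_sum]
      refine Finset.sum_congr rfl fun t _ => ?_
      rw [map_mul, AddChar.mulShift_apply, he, AddChar.zmodChar_apply, AddChar.zmodChar_apply]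
      congr 1
      · exact map_intCast _ _
      · rw [map_pow, cycAut_apply a ((hx.pow_eq_one_iff_dvd N).2 h), ← pow_mul,
          ZMod.coe_unitOfCoprime, ZMod.val_mul, ZMod.val_natCast]
        refine (pow_eq_pow_mod _ hx.pow_eq_one).trans ?_
        congr 1
        simp [Nat.mul_mod]
    rw [hs, ← hJ, ← hu]
    rw [ZMod.coe_unitOfCoprime]
    rw [Int.cast_natCast] at hsq ⊢
    rw [← mul_assoc, hsq, one_mul]

theorem exists_gaussSum_of_odd {d : ℕ} (hd : Odd d) (h : d ∣ N) :
    ∃ G : CycType N, G ^ 2 = (jacobiSym (-1) d * d : ℤ) ∧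
      ∀ a : (ZMod N)ˣ, cycAut a G = (jacobiSym (a : ZMod N).val d : ℤ) * G := by
  induction d using induction_on_primes with
  | zero => exact absurd hd (by decide)
  | one => exact ⟨1, by simp, by simp⟩
  | prime_mul p d hp ih =>
    have : Fact p.Prime := ⟨hp⟩
    rw [Nat.odd_mul] at hd
    have : NeZero d := ⟨by rintro rfl; exact absurd hd.2 (by decide)⟩
    have : NeZero p := ⟨hp.ne_zero⟩
    have hp2 : p ≠ 2 := by rintro rfl; exact absurd hd.1 (by decide)
    obtain ⟨G₁, h₁, h₁'⟩ := exists_gaussSum hp2 (dvd_of_mul_right_dvd h)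
    obtain ⟨G₂, h₂, h₂'⟩ := ih hd.2 (dvd_of_mul_left_dvd h)
    refine ⟨G₁ * G₂, ?_, fun a => ?_⟩
    · rw [mul_pow, h₁, h₂, jacobiSym.mul_right]
      push_cast
      ring
    · rw [map_mul, h₁', h₂', jacobiSym.mul_right]
      push_cast
      ring

omit [NeZero N] in
theorem odd_val_unit (h : 4 ∣ N) (a : (ZMod N)ˣ) : Odd (a : ZMod N).val := by
  have := (ZMod.val_coe_unit_coprime a).of_dvd_right (Dvd.dvd.trans (by norm_num : 2 ∣ 4) h)
  exact Nat.coprime_two_right.1 this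

theorem odd_mod_four {n : ℕ} (h : _root_.Odd n) : n % 4 = 1 ∨ n % 4 = 3 := by
  have := Nat.odd_iff.1 h
  omega

/-- The Galois action on `√d`, by Gauss sums and quadratic reciprocity. -/
theorem exists_cycAut_sqrt {d : ℕ} (hd : Odd d) (h : 4 * d ∣ N) :
    ∃ x : CycType N, cycEmb N x = (Real.sqrt d : ℝ) ∧
      ∀ a : (ZMod N)ˣ, cycAut a x = (jacobiSym d (a : ZMod N).val : ℤ) * x := by
  have h4 : 4 ∣ N := dvd_of_mul_right_dvd h
  suffices H : ∃ x : CycType N, x ^ 2 = d ∧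
      ∀ a : (ZMod N)ˣ, cycAut a x = (jacobiSym d (a : ZMod N).val : ℤ) * x by
    obtain ⟨x, hx, hx'⟩ := H
    have hsq : (cycEmb N x) ^ 2 = ((Real.sqrt d : ℝ) : ℂ) ^ 2 := by
      rw [← map_pow, hx, map_natCast, ← Complex.ofReal_pow, Real.sq_sqrt (Nat.cast_nonneg d)]
      simp
    rcases sq_eq_sq_iff_eq_or_eq_neg.1 hsq with h1 | h1
    · exact ⟨x, h1, hx'⟩
    · refine ⟨-x, by rw [map_neg, h1, neg_neg], fun a => ?_⟩
      rw [map_neg, hx', mul_neg]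
  obtain ⟨G, hG, hG'⟩ := exists_gaussSum_of_odd hd (dvd_of_mul_left_dvd h)
  rw [jacobiSym.at_neg_one hd] at hG
  rcases odd_mod_four hd with h1 | h1
  · refine ⟨G, ?_, fun a => ?_⟩
    · rw [hG, ZMod.χ₄_nat_one_mod_four h1]
      simp
    · rw [hG', jacobiSym.quadratic_reciprocity_one_mod_four h1 (odd_val_unit h4 a)]
  -- the Gauss sum is a square root of `-d`, to be multiplied by a fourth root of unity
  · obtain ⟨i, hi⟩ := exists_isPrimitiveRoot_cycType h4
    have hi2 : i ^ 2 = -1 := by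
      have h2 : IsPrimitiveRoot (i ^ 2) 2 := hi.pow (by norm_num) (by norm_num)
      exact h2.eq_neg_one_of_two_right
    refine ⟨i * G, ?_, fun a => ?_⟩
    · rw [mul_pow, hG, hi2, ZMod.χ₄_nat_three_mod_four h1]
      simp
    · have ho := odd_val_unit h4 a
      rw [map_mul, hG', cycAut_apply a ((hi.pow_eq_one_iff_dvd N).2 h4),
        ← Nat.div_add_mod (a : ZMod N).val 4, pow_add, pow_mul, hi.pow_eq_one, one_pow, one_mul,
        Nat.div_add_mod]
      rcases odd_mod_four ho with h2 | h2
      · rw [h2, pow_one, ← jacobiSym.quadratic_reciprocity_one_mod_four h2 hd]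
        ring
      · rw [h2, pow_succ, hi2, jacobiSym.quadratic_reciprocity_three_mod_four h1 h2]
        push_cast
        ring

theorem quadField_le_cycField {d : ℕ} (hd : Odd d) (h : 4 * d ∣ N) : quadField d ≤ cycField N := by
  rw [quadField, IntermediateField.adjoin_le_iff, Set.singleton_subset_iff]
  obtain ⟨x, hx, -⟩ := exists_cycAut_sqrt hd h
  rw [← hx, ← fieldRange_cycEmb]
  exact ⟨x, rfl⟩

theorem quadChar_natCast {d : ℕ} [NeZero d] {a : ℕ} (ha : Odd a) :
    quadChar d a = (jacobiSym d a : ℤ) := by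
  have hpar : Odd ((a : ZMod (4 * d)).val) := by
    rw [ZMod.val_natCast, Nat.odd_iff, Nat.mod_mod_of_dvd _ ⟨2 * d, by ring⟩]
    exact Nat.odd_iff.1 ha
  change (((if Odd (a : ZMod (4 * d)).val then jacobiSym d (a : ZMod (4 * d)).val else 0 : ℤ)) : ℂ) = _
  rw [if_pos hpar, ZMod.val_natCast, ← jacobiSym.mod_right' d ha]

theorem changeLevel_quadChar_apply {d : ℕ} [NeZero d] (h : 4 * d ∣ N) (a : (ZMod N)ˣ) :
    changeLevel h (quadChar d) a = (jacobiSym d (a : ZMod N).val : ℤ) := by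
  have := changeLevel_natCast h (quadChar d) (ZMod.val_coe_unit_coprime a)
  rw [ZMod.natCast_zmod_val] at this
  rw [this, quadChar_natCast (odd_val_unit (dvd_of_mul_right_dvd h) a)]

theorem quadChar_mem_charsOf {d : ℕ} [NeZero d] (hd : Odd d) (h : 4 * d ∣ N) :
    changeLevel h (quadChar d) ∈ charsOf N (quadField d) := by
  rw [mem_charsOf]
  intro a ha
  obtain ⟨x, hx, hx'⟩ := exists_cycAut_sqrt hd h
  have h1 := ha x (by rw [hx]; exact IntermediateField.mem_adjoin_simple_self _ _)
  rw [hx'] at h1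
  have hx0 : x ≠ 0 := by
    rintro rfl
    rw [map_zero] at hx
    have := (Complex.ofReal_eq_zero.1 hx.symm)
    rw [Real.sqrt_eq_zero (Nat.cast_nonneg d), Nat.cast_eq_zero] at this
    exact NeZero.ne d this
  rw [changeLevel_quadChar_apply]
  have : ((jacobiSym d (a : ZMod N).val : ℤ) : CycType N) = 1 := mul_right_cancel₀ hx0 (by rw [h1, one_mul])
  exact_mod_cast this

theorem even_quadChar {d : ℕ} [NeZero d] (hd : Odd d) : (quadChar d).Even := by
  have hd0 := Nat.pos_of_ne_zero (NeZero.ne d)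
  have h1 : (-1 : ZMod (4 * d)) = ((4 * d - 1 : ℕ) : ZMod (4 * d)) := by
    rw [Nat.cast_sub (by omega), ZMod.natCast_self]
    simp
  have hodd : _root_.Odd (4 * d - 1) := ⟨2 * d - 1, by omega⟩
  have h3 : (4 * d - 1) % 4 = 3 := by omega
  have hJ : jacobiSym ((4 * d - 1 : ℕ) : ℤ) d = jacobiSym (-1) d := by
    apply jacobiSym.mod_left'
    rw [Nat.cast_sub (by omega)]
    push_cast
    exact Int.ModEq.symm ((Int.modEq_iff_dvd).2 ⟨4, by ring⟩)
  unfold DirichletCharacter.Even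
  rw [h1, quadChar_natCast hodd]
  rcases odd_mod_four hd with h2 | h2
  · rw [jacobiSym.quadratic_reciprocity_one_mod_four h2 hodd, hJ, jacobiSym.at_neg_one hd,
      ZMod.χ₄_nat_one_mod_four h2, Int.cast_one]
  · rw [jacobiSym.quadratic_reciprocity_three_mod_four h2 h3, hJ, jacobiSym.at_neg_one hd,
      ZMod.χ₄_nat_three_mod_four h2]
    simp

theorem finrank_quadField_le (d : ℕ) : Module.finrank ℚ (quadField d) ≤ 2 := by
  have hint : IsIntegral ℚ ((Real.sqrt d : ℝ) : ℂ) := by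
    refine ⟨Polynomial.X ^ 2 - Polynomial.C (d : ℚ), Polynomial.monic_X_pow_sub_C _ two_ne_zero, ?_⟩
    simp [← Complex.ofReal_pow, Real.sq_sqrt]
  rw [quadField, IntermediateField.adjoin.finrank hint]
  have h0 : (Polynomial.X ^ 2 - Polynomial.C (d : ℚ)) ≠ 0 := Polynomial.X_pow_sub_C_ne_zero two_pos _
  refine (Polynomial.natDegree_le_of_dvd (minpoly.dvd _ _ ?_) h0).trans
    (Polynomial.natDegree_X_pow_sub_C (R := ℚ)).le
  simp [← Complex.ofReal_pow, Real.sq_sqrt]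

/-- For a prime `p ∣ d` there is a unit congruent to `1` modulo everything prime to `p`, on which
the quadratic character is `-1`. -/
theorem exists_quadChar_eq_neg_one {d p M : ℕ} [NeZero d] (hp : p.Prime) (hd : Odd d)
    (hsq : Squarefree d) (hpd : p ∣ d) (hM : p.Coprime M) (h4 : 4 ∣ M) (hdM : d ∣ p * M) :
    ∃ a : ℕ, a ≡ 1 [MOD M] ∧ a.Coprime (p * M) ∧ jacobiSym d a = -1 := by
  have : Fact p.Prime := ⟨hp⟩
  have hp2 : p ≠ 2 := by
    rintro rfl
    exact absurd (hd.of_dvd_nat hpd) (by decide)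
  obtain ⟨b, hb⟩ := quadraticChar_exists_neg_one (F := ZMod p) (by rwa [ZMod.ringChar_zmod_n])
  obtain ⟨a, ha1, ha2⟩ := Nat.chineseRemainder hM b.val 1
  have hJp : jacobiSym a p = -1 := by
    rw [← jacobiSym.legendreSym.to_jacobiSym, legendreSym, ← hb]
    congr 1
    have := (ZMod.natCast_eq_natCast_iff _ _ _).2 ha1
    rw [ZMod.natCast_zmod_val] at this
    exact_mod_cast this
  have hap : a.Coprime p := by
    by_contra hcon
    have : jacobiSym a p = 0 := jacobiSym.eq_zero_iff.2 ⟨hp.ne_zero, by exact_mod_cast hcon⟩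
    omega
  have haM : a.Coprime M := by
    rw [Nat.Coprime, ha2.gcd_eq, Nat.gcd_one_left]
  refine ⟨a, ha2, Nat.Coprime.mul_right hap haM, ?_⟩
  obtain ⟨c, rfl⟩ := hpd
  have hcM : c ∣ M := by
    have hpos := hp.pos
    exact Nat.dvd_of_mul_dvd_mul_left hpos hdM
  have : NeZero c := ⟨by rintro rfl; exact NeZero.ne (p * 0) (mul_zero p)⟩
  have : NeZero p := ⟨hp.ne_zero⟩
  have ha4 : a % 4 = 1 := ha2.of_dvd h4
  rw [← jacobiSym.quadratic_reciprocity_one_mod_four ha4 hd, jacobiSym.mul_right, hJp]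
  have hac : jacobiSym a c = 1 := by
    rw [jacobiSym.mod_left' (a₂ := 1), jacobiSym.one_left]
    exact_mod_cast ha2.of_dvd hcM
  rw [hac, mul_one]

end QuadraticField

/-! ### The layers of the cyclotomic `ℤ₂`-extension of `ℚ(√d)` -/

section QuadraticLayers

open DirichletCharacter

theorem two_pow_dvd_level (k d : ℕ) : 2 ^ (k + 2) ∣ 2 ^ (k + 2) * d := Dvd.intro _ rfl

theorem four_mul_dvd_level (k d : ℕ) : 4 * d ∣ 2 ^ (k + 2) * d :=
  Nat.mul_dvd_mul_right (four_dvd_two_pow k) d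

/-- A character of `2`-power level, seen modulo `2^(k+2) d`. -/
def liftTwo {k : ℕ} (χ : DirichletCharacter ℂ (2 ^ (k + 2))) (d : ℕ) :
    DirichletCharacter ℂ (2 ^ (k + 2) * d) :=
  changeLevel (two_pow_dvd_level k d) χ

/-- The quadratic character of `ℚ(√d)`, seen modulo `2^(k+2) d`. -/
def liftQuad (k d : ℕ) [NeZero d] : DirichletCharacter ℂ (2 ^ (k + 2) * d) :=
  changeLevel (four_mul_dvd_level k d) (quadChar d)

theorem liftTwo_mul {k : ℕ} (χ χ' : DirichletCharacter ℂ (2 ^ (k + 2))) (d : ℕ) :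
    liftTwo (χ * χ') d = liftTwo χ d * liftTwo χ' d :=
  map_mul _ _ _

theorem liftTwo_injective (k d : ℕ) [NeZero d] :
    Function.Injective fun χ : DirichletCharacter ℂ (2 ^ (k + 2)) => liftTwo χ d :=
  changeLevel_injective _

theorem twistedL_eq {k : ℕ} (χ : DirichletCharacter ℂ (2 ^ (k + 2))) (d : ℕ) [NeZero d] (s : ℂ) :
    twistedL χ d s = primLFunction (liftTwo χ d * liftQuad k d) s := by
  have : NeZero (Nat.lcm (2 ^ (k + 2)) (4 * d)) :=
    ⟨Nat.lcm_ne_zero (by positivity) (NeZero.ne (4 * d))⟩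
  have h : Nat.lcm (2 ^ (k + 2)) (4 * d) ∣ 2 ^ (k + 2) * d :=
    Nat.lcm_dvd (two_pow_dvd_level k d) (four_mul_dvd_level k d)
  have h1 : liftTwo χ d * liftQuad k d = changeLevel h (χ.mul (quadChar d)) := by
    rw [DirichletCharacter.mul, map_mul, ← changeLevel_trans, ← changeLevel_trans]
    rfl
  rw [h1, primLFunction_changeLevel]
  rfl

variable {d : ℕ} [NeZero d]

theorem liftQuad_apply {k : ℕ} {a : ℕ} (ha : a.Coprime (2 ^ (k + 2) * d)) :
    liftQuad k d a = (jacobiSym d a : ℤ) := by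
  rw [liftQuad, changeLevel_natCast _ _ ha, quadChar_natCast]
  refine Nat.coprime_two_right.1 (ha.of_dvd_right ?_)
  exact Dvd.dvd.mul_right (dvd_pow_self 2 (by omega)) _

omit [NeZero d] in
theorem liftTwo_apply {k : ℕ} (χ : DirichletCharacter ℂ (2 ^ (k + 2))) {a : ℕ}
    (ha : a.Coprime (2 ^ (k + 2) * d)) : liftTwo χ d a = χ a :=
  changeLevel_natCast _ _ ha

theorem liftQuad_mul_self (k : ℕ) : liftQuad k d * liftQuad k d = 1 := by
  ext u
  have hc := ZMod.val_coe_unit_coprime u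
  rw [MulChar.mul_apply, MulChar.one_apply_coe, ← ZMod.natCast_zmod_val (u : ZMod (2 ^ (k + 2) * d)),
    liftQuad_apply hc, ← Int.cast_mul, ← pow_two, jacobiSym.sq_one, Int.cast_one]
  exact (hc.of_dvd_right (Dvd.intro_left _ rfl)).symm

/-- A prime divisor `p` of `d` ramifies in `χ ψ_d` for every `χ` of `2`-power level. -/
theorem exists_liftTwo_mul_liftQuad_eq_neg_one (hd : _root_.Odd d) (hsq : Squarefree d) {p : ℕ}
    (hp : p.Prime) (hpd : p ∣ d) (k : ℕ) :
    ∃ a : ℕ, a.Coprime (2 ^ (k + 2) * d) ∧ a ≡ 1 [MOD 2 ^ (k + 2) * (d / p)] ∧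
      liftQuad k d a = -1 ∧ ∀ χ : DirichletCharacter ℂ (2 ^ (k + 2)), liftTwo χ d a = 1 := by
  have hpM : p * (2 ^ (k + 2) * (d / p)) = 2 ^ (k + 2) * d := by
    rw [mul_left_comm, Nat.mul_div_cancel' hpd]
  have hcop : p.Coprime (2 ^ (k + 2) * (d / p)) := by
    refine Nat.Coprime.mul_right ?_ ?_
    · refine Nat.Coprime.pow_right _ (Nat.coprime_two_right.2 (hd.of_dvd_nat hpd))
    · exact Nat.coprime_of_squarefree_mul (by rwa [Nat.mul_div_cancel' hpd])
  obtain ⟨a, h1, h2, h3⟩ := exists_quadChar_eq_neg_one hp hd hsq hpd hcop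
    (Dvd.dvd.mul_right (four_dvd_two_pow k) _) (by rw [hpM]; exact Dvd.intro_left _ rfl)
  rw [hpM] at h2
  refine ⟨a, h2, h1, ?_, fun χ => ?_⟩
  · rw [liftQuad_apply h2, h3]
    simp
  · rw [liftTwo_apply χ h2, (ZMod.natCast_eq_natCast_iff _ _ _).2 (h1.of_dvd (Dvd.intro _ rfl)),
      Nat.cast_one, map_one]

variable (hd : _root_.Odd d) (hsq : Squarefree d) (hd1 : 1 < d)
include hd hsq hd1

theorem liftTwo_ne_liftQuad {k : ℕ} (χ : DirichletCharacter ℂ (2 ^ (k + 2))) :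
    liftTwo χ d ≠ liftQuad k d := by
  intro h
  obtain ⟨p, hp, hpd⟩ := Nat.exists_prime_and_dvd hd1.ne'
  obtain ⟨a, -, -, h1, h2⟩ := exists_liftTwo_mul_liftQuad_eq_neg_one hd hsq hp hpd k
  have := h2 χ
  rw [h, h1] at this
  norm_num at this

theorem mem_charsOf_quadField {k : ℕ} {η : DirichletCharacter ℂ (2 ^ (k + 2) * d)} :
    η ∈ charsOf (2 ^ (k + 2) * d) (quadField d) ↔ η = 1 ∨ η = liftQuad k d := by
  classical
  have hne : (1 : DirichletCharacter ℂ (2 ^ (k + 2) * d)) ≠ liftQuad k d := by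
    have := liftTwo_ne_liftQuad hd hsq hd1 (1 : DirichletCharacter ℂ (2 ^ (k + 2)))
    rwa [liftTwo, map_one] at this
  have h : ({1, liftQuad k d} : Finset (DirichletCharacter ℂ (2 ^ (k + 2) * d))) =
      charsOf (2 ^ (k + 2) * d) (quadField d) := by
    apply Finset.eq_of_subset_of_card_le
    · intro η hη
      rw [Finset.mem_insert, Finset.mem_singleton] at hη
      rcases hη with rfl | rfl
      · exact mem_charsOf.2 fun a _ => MulChar.one_apply_coe a
      · exact quadChar_mem_charsOf hd (four_mul_dvd_level k d)
    · rw [Finset.card_pair hne, card_charsOf (quadField_le_cycField hd (four_mul_dvd_level k d))]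
      exact finrank_quadField_le d
  rw [← h, Finset.mem_insert, Finset.mem_singleton]

theorem finrank_quadField : Module.finrank ℚ (quadField d) = 2 := by
  classical
  refine le_antisymm (finrank_quadField_le d) ?_
  rw [← card_charsOf (quadField_le_cycField hd (four_mul_dvd_level 0 d)), ← Nat.lt_iff_add_one_le,
    Finset.one_lt_card]
  refine ⟨1, (mem_charsOf_quadField hd hsq hd1).2 (Or.inl rfl), liftQuad 0 d,
    (mem_charsOf_quadField hd hsq hd1).2 (Or.inr rfl), ?_⟩
  have := liftTwo_ne_liftQuad hd hsq hd1 (1 : DirichletCharacter ℂ (2 ^ (0 + 2)))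
  rwa [liftTwo, map_one] at this

omit hsq hd1 in
theorem quad_sup_le_cycField (k : ℕ) : quadField d ⊔ realCyc k ≤ cycField (2 ^ (k + 2) * d) :=
  sup_le (quadField_le_cycField hd (four_mul_dvd_level k d))
    (realCyc_le_cycField (two_pow_dvd_level k d))

theorem mem_charsOf_quad_sup {k : ℕ} {η : DirichletCharacter ℂ (2 ^ (k + 2) * d)} :
    η ∈ charsOf (2 ^ (k + 2) * d) (quadField d ⊔ realCyc k) ↔
      ∃ χ ∈ evenChars k, η = liftTwo χ d ∨ η = liftTwo χ d * liftQuad k d := by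
  constructor
  · intro h
    obtain ⟨χ₁, h₁, χ₂, h₂, rfl⟩ := mem_charsOf_sup
      (quadField_le_cycField hd (four_mul_dvd_level k d))
      (realCyc_le_cycField (two_pow_dvd_level k d)) h
    obtain ⟨χ, hχ, rfl⟩ := (mem_charsOf_realCyc (two_pow_dvd_level k d)).1 h₂
    refine ⟨χ, hχ, ?_⟩
    rcases (mem_charsOf_quadField hd hsq hd1).1 h₁ with rfl | rfl
    · exact Or.inl (one_mul _)
    · exact Or.inr (mul_comm _ _)
  · rintro ⟨χ, hχ, h⟩
    have h1 : liftTwo χ d ∈ charsOf (2 ^ (k + 2) * d) (quadField d ⊔ realCyc k) :=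
      charsOf_mono le_sup_right ((mem_charsOf_realCyc (two_pow_dvd_level k d)).2 ⟨χ, hχ, rfl⟩)
    rcases h with rfl | rfl
    · exact h1
    · exact mul_mem_charsOf h1 (charsOf_mono le_sup_left
        ((mem_charsOf_quadField hd hsq hd1).2 (Or.inr rfl)))

/-- A subgroup `X` of characters modulo `2^(k+2) d` that contains the quadratic character and
otherwise comes from even characters of `2`-power level consists of pairs `χ, χ ψ_d`. -/
theorem prod_eq_of_liftQuad_mem {k : ℕ} {X : Finset (DirichletCharacter ℂ (2 ^ (k + 2) * d))}
    {S : Finset (DirichletCharacter ℂ (2 ^ (k + 2)))}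
    (hX : ∀ η, η ∈ X ↔ ∃ χ ∈ S, η = liftTwo χ d ∨ η = liftTwo χ d * liftQuad k d)
    {M : Type*} [CommMonoid M] (f : DirichletCharacter ℂ (2 ^ (k + 2) * d) → M) :
    ∏ η ∈ X, f η = ∏ χ ∈ S, (f (liftTwo χ d) * f (liftTwo χ d * liftQuad k d)) := by
  classical
  have h : X = S.image (fun χ => liftTwo χ d) ∪
      S.image (fun χ => liftTwo χ d * liftQuad k d) := by
    ext η
    rw [hX, Finset.mem_union, Finset.mem_image, Finset.mem_image]
    constructor
    · rintro ⟨χ, hχ, rfl | rfl⟩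
      · exact Or.inl ⟨χ, hχ, rfl⟩
      · exact Or.inr ⟨χ, hχ, rfl⟩
    · rintro (⟨χ, hχ, rfl⟩ | ⟨χ, hχ, rfl⟩)
      · exact ⟨χ, hχ, Or.inl rfl⟩
      · exact ⟨χ, hχ, Or.inr rfl⟩
  have hinj := liftTwo_injective k d
  rw [h, Finset.prod_union, Finset.prod_image hinj.injOn, Finset.prod_image,
    Finset.prod_mul_distrib]
  · intro χ _ χ' _ h
    exact hinj (mul_right_cancel h)
  · rw [Finset.disjoint_left]
    rintro η h1 h2
    obtain ⟨χ, -, rfl⟩ := Finset.mem_image.1 h1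
    obtain ⟨χ', -, h3⟩ := Finset.mem_image.1 h2
    apply liftTwo_ne_liftQuad hd hsq hd1 (χ * χ'⁻¹)
    rw [liftTwo_mul, ← h3, mul_right_comm, ← liftTwo_mul, mul_inv_cancel, liftTwo, map_one, one_mul]

theorem card_eq_of_liftQuad_mem {k : ℕ} {X : Finset (DirichletCharacter ℂ (2 ^ (k + 2) * d))}
    {S : Finset (DirichletCharacter ℂ (2 ^ (k + 2)))}
    (hX : ∀ η, η ∈ X ↔ ∃ χ ∈ S, η = liftTwo χ d ∨ η = liftTwo χ d * liftQuad k d) :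
    X.card = 2 * S.card := by
  have h := prod_eq_of_liftQuad_mem hd hsq hd1 hX (fun _ => Multiplicative.ofAdd 1)
  rw [Finset.prod_const, Finset.prod_const, ← ofAdd_add, ← ofAdd_nsmul, ← ofAdd_nsmul] at h
  have h := Multiplicative.ofAdd.injective h
  simp only [smul_eq_mul, mul_one] at h
  omega

theorem finrank_quad_sup (k : ℕ) :
    Module.finrank ℚ (quadField d ⊔ realCyc k : IntermediateField ℚ ℂ) = 2 ^ (k + 1) := by
  rw [← card_charsOf (quad_sup_le_cycField hd k),
    card_eq_of_liftQuad_mem hd hsq hd1 (S := evenChars k)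
      (fun η => mem_charsOf_quad_sup hd hsq hd1), card_evenChars, pow_succ']

theorem isLayer_quadField_iff {n : ℕ} {E : IntermediateField ℚ ℂ} :
    IsLayer (quadField d) n E ↔ E = quadField d ⊔ realCyc n := by
  classical
  have hdeg : ∀ {E : IntermediateField ℚ ℂ}, quadField d ≤ E →
      2 * IntermediateField.relfinrank (quadField d) E = Module.finrank ℚ E := fun {E} h => by
    have := IntermediateField.relfinrank_mul_relfinrank (bot_le : ⊥ ≤ quadField d) h
    rwa [IntermediateField.relfinrank_bot_left, IntermediateField.relfinrank_bot_left,
      finrank_quadField hd hsq hd1] at this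
  have hfin : ∀ n, FiniteDimensional ℚ (quadField d ⊔ realCyc n : IntermediateField ℚ ℂ) :=
    fun n => Module.finite_of_finrank_pos (by rw [finrank_quad_sup hd hsq hd1]; positivity)
  constructor
  · intro h
    have hr := hdeg h.le
    rw [h.degree] at hr
    have hE : FiniteDimensional ℚ E := Module.finite_of_finrank_pos (by rw [← hr]; positivity)
    obtain ⟨k', hk'⟩ := exists_le_sup_realCyc h.le_cyclotomicExt
    set k := max k' n
    have hnk : n ≤ k := le_max_right _ _
    have hEk : E ≤ quadField d ⊔ realCyc k :=
      hk'.trans (sup_le_sup_left (realCyc_mono (le_max_left _ _)) _)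
    have hEN : E ≤ cycField (2 ^ (k + 2) * d) := hEk.trans (quad_sup_le_cycField hd k)
    set X := charsOf (2 ^ (k + 2) * d) E with hXdef
    have hψX : liftQuad k d ∈ X :=
      charsOf_mono h.le ((mem_charsOf_quadField hd hsq hd1).2 (Or.inr rfl))
    set S := (evenChars k).filter (fun χ => liftTwo χ d ∈ X) with hS
    have hX : ∀ η, η ∈ X ↔ ∃ χ ∈ S, η = liftTwo χ d ∨ η = liftTwo χ d * liftQuad k d := by
      intro η
      constructor
      · intro hη
        obtain ⟨χ, hχ, rfl | rfl⟩ := (mem_charsOf_quad_sup hd hsq hd1).1 (charsOf_mono hEk hη)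
        · exact ⟨χ, Finset.mem_filter.2 ⟨hχ, hη⟩, Or.inl rfl⟩
        · refine ⟨χ, Finset.mem_filter.2 ⟨hχ, ?_⟩, Or.inr rfl⟩
          have := mul_mem_charsOf hη hψX
          rwa [mul_assoc, liftQuad_mul_self, mul_one] at this
      · rintro ⟨χ, hχ, rfl | rfl⟩
        · exact (Finset.mem_filter.1 hχ).2
        · exact mul_mem_charsOf (Finset.mem_filter.1 hχ).2 hψX
    have hScard : S.card = 2 ^ n := by
      have := card_eq_of_liftQuad_mem hd hsq hd1 hX
      rw [card_charsOf hEN] at this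
      omega
    -- multiplication by `χ` permutes `S`, which has `2^n` elements: compare the products of the
    -- values at `5`
    have hpow : ∀ χ ∈ S, χ 5 ^ 2 ^ n = 1 := by
      intro χ hχ
      have hmul : ∀ θ ∈ S, χ * θ ∈ S := fun θ hθ => by
        rw [hS, Finset.mem_filter, mem_evenChars] at hχ hθ ⊢
        refine ⟨?_, ?_⟩
        · unfold DirichletCharacter.Even at *
          rw [MulChar.mul_apply, hχ.1, hθ.1, one_mul]
        · rw [liftTwo_mul]
          exact mul_mem_charsOf hχ.2 hθ.2
      have himg : S.image (fun θ => χ * θ) = S := by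
        apply Finset.eq_of_subset_of_card_le
        · intro θ hθ
          obtain ⟨θ', hθ', rfl⟩ := Finset.mem_image.1 hθ
          exact hmul θ' hθ'
        · rw [Finset.card_image_of_injective _ (mul_right_injective χ)]
      have hprod : ∏ θ ∈ S, θ 5 = ∏ θ ∈ S, (χ * θ) 5 := by
        conv_lhs => rw [← himg]
        rw [Finset.prod_image (mul_right_injective χ).injOn]
      simp only [MulChar.mul_apply, Finset.prod_mul_distrib, Finset.prod_const, hScard] at hprod
      have hne : ∏ θ ∈ S, θ 5 ≠ 0 := by
        refine Finset.prod_ne_zero_iff.2 fun θ _ h0 => ?_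
        have := char_five_pow θ
        rw [h0, zero_pow (by positivity)] at this
        exact zero_ne_one this
      exact (mul_eq_right₀ hne).1 hprod.symm
    have hdvd : 2 ^ (n + 2) ∣ 2 ^ (k + 2) * d :=
      (Nat.pow_dvd_pow 2 (by omega)).trans (two_pow_dvd_level k d)
    have hle2 : quadField d ⊔ realCyc n ≤ cycField (2 ^ (k + 2) * d) :=
      sup_le (quadField_le_cycField hd (four_mul_dvd_level k d)) (realCyc_le_cycField hdvd)
    have hle : E ≤ quadField d ⊔ realCyc n := by
      refine le_of_charsOf_subset hEN hle2 fun η hη => ?_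
      obtain ⟨χ, hχ, h2⟩ := (hX η).1 hη
      have h3 : liftTwo χ d ∈ charsOf (2 ^ (k + 2) * d) (quadField d ⊔ realCyc n) :=
        charsOf_mono le_sup_right (mem_charsOf_realCyc_of_pow_eq_one hdvd (two_pow_dvd_level k d) hnk
          (mem_evenChars.1 (Finset.mem_filter.1 hχ).1) (hpow χ hχ))
      rcases h2 with rfl | rfl
      · exact h3
      · exact mul_mem_charsOf h3 (charsOf_mono le_sup_left
          ((mem_charsOf_quadField hd hsq hd1).2 (Or.inr rfl)))
    exact IntermediateField.eq_of_le_of_finrank_eq hle (by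
      rw [← hr, finrank_quad_sup hd hsq hd1, pow_succ'])
  · rintro rfl
    refine ⟨le_sup_left, sup_le_sup_left (realCyc_le n) _, ?_⟩
    have := hdeg (le_sup_left : quadField d ≤ quadField d ⊔ realCyc n)
    rw [finrank_quad_sup hd hsq hd1, pow_succ'] at this
    omega

/-- The zeta function of the `n`-th layer over `ℚ(√d)` is a product of `L`-functions. -/
theorem isDedekindZeta_quad_sup (n : ℕ)
    [NumberField (quadField d ⊔ realCyc n : IntermediateField ℚ ℂ)] :
    IsDedekindZeta (quadField d ⊔ realCyc n : IntermediateField ℚ ℂ)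
      (fun s => ∏ χ ∈ evenChars n, (primLFunction χ s * twistedL χ d s)) := by
  convert! isDedekindZeta_prod_charsOf (quad_sup_le_cycField hd n) using 1
  funext s
  rw [prod_eq_of_liftQuad_mem hd hsq hd1 (fun η => mem_charsOf_quad_sup hd hsq hd1)]
  refine Finset.prod_congr rfl fun χ _ => ?_
  rw [twistedL_eq, liftTwo, primLFunction_changeLevel]

end QuadraticLayers

/-- The zeta function of the `n`-th layer over `ℚ` is a product of `L`-functions. -/
theorem isDedekindZeta_realCyc (n : ℕ) [NumberField (realCyc n)] :
    IsDedekindZeta (realCyc n) (fun s => ∏ χ ∈ evenChars n, primLFunction χ s) := by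
  have := isDedekindZeta_prod_charsOf (realCyc_le_cycField (dvd_refl (2 ^ (n + 2))))
  rwa [charsOf_realCyc] at this

/-! ### Congruences between generalized Bernoulli numbers -/

section BernoulliCongruence

variable {C : Type*} [NormedField C] [IsUltrametricDist C] [CharZero C]

/-- The value `-(M^(m-1) / m) ∑ φ(a) B_m(a / M)` of the `L`-function of `φ` at `1 - m`. -/
def bernVal {F : Type*} [Field F] {M : ℕ} [NeZero M] (φ : ZMod M → F) (m : ℕ) : F :=
  -((M : F) ^ (m - 1) / m) * ∑ a : ZMod M, φ a * ((Polynomial.bernoulli m).eval (a.val / M : ℚ) : ℚ)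

/-- The tail of `M^(n+1) B_{n+2}(x / M)`, divided by `M`. -/
def bernTail (n : ℕ) (M x : ℚ) : ℚ :=
  ∑ i ∈ Finset.range (n + 1), bernoulli (n + 2 - i) * (n + 2).choose i * x ^ i * M ^ (n - i)

theorem bernoulli_eval_div (n : ℕ) {M : ℚ} (hM : M ≠ 0) (x : ℚ) :
    M ^ (n + 1) * (Polynomial.bernoulli (n + 2)).eval (x / M) =
      x ^ (n + 2) / M - (n + 2) / 2 * x ^ (n + 1) + M * bernTail n M x := by
  rw [Polynomial.bernoulli_def, Polynomial.eval_finsetSum, Finset.sum_range_succ,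
    Finset.sum_range_succ, bernTail, mul_add, mul_add, Finset.mul_sum, Finset.mul_sum]
  have h1 : ∀ i ∈ Finset.range (n + 1), M ^ (n + 1) * Polynomial.eval (x / M)
      (Polynomial.monomial i (bernoulli (n + 2 - i) * ((n + 2).choose i : ℚ))) =
      M * (bernoulli (n + 2 - i) * (n + 2).choose i * x ^ i * M ^ (n - i)) := by
    intro i hi
    have hi' : i ≤ n := Nat.lt_succ_iff.1 (Finset.mem_range.1 hi)
    rw [Polynomial.eval_monomial, div_pow]
    obtain ⟨j, rfl⟩ := Nat.exists_eq_add_of_le hi'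
    rw [Nat.add_sub_cancel_left]
    field_simp
    ring
  rw [Finset.sum_congr rfl h1]
  generalize ∑ i ∈ Finset.range (n + 1),
    M * (bernoulli (n + 2 - i) * (n + 2).choose i * x ^ i * M ^ (n - i)) = s
  have e1 : n + 2 - (n + 1) = 1 := by omega
  have e2 : (n + 2).choose (n + 1) = n + 2 := by
    rw [Nat.choose_succ_self_right]
  rw [Polynomial.eval_monomial, Polynomial.eval_monomial, e1, e2, bernoulli_one, Nat.sub_self,
    bernoulli_zero, Nat.choose_self, div_pow, div_pow]
  push_cast
  field_simp
  ring

variable (C) in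
/-- A bound for the norms of the tails that does not depend on the level `M`. -/
def bernBound (n : ℕ) : ℝ :=
  ∑ i ∈ Finset.range (n + 1), ‖((bernoulli (n + 2 - i) * (n + 2).choose i : ℚ) : C)‖

omit [IsUltrametricDist C] [CharZero C] in
theorem bernBound_nonneg (n : ℕ) : 0 ≤ bernBound C n :=
  Finset.sum_nonneg fun _ _ => norm_nonneg _

omit [CharZero C] in
theorem norm_natCast_pow_le_one (x i : ℕ) : ‖((x : C)) ^ i‖ ≤ 1 := by
  rw [norm_pow]
  exact pow_le_one₀ (norm_nonneg _) (IsUltrametricDist.norm_natCast_le_one C x)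

theorem norm_bernTail_le (n M x : ℕ) : ‖((bernTail n M x : ℚ) : C)‖ ≤ bernBound C n := by
  rw [bernTail, Rat.cast_sum]
  refine (norm_sum_le _ _).trans (Finset.sum_le_sum fun i _ => ?_)
  rw [Rat.cast_mul, Rat.cast_mul, norm_mul, norm_mul]
  push_cast
  exact mul_le_of_le_one_right (by positivity) (norm_natCast_pow_le_one _ _) |>.trans
    (mul_le_of_le_one_right (by positivity) (norm_natCast_pow_le_one _ _))

omit [CharZero C] in
theorem norm_add_le_of_le {x y : C} {r : ℝ} (hx : ‖x‖ ≤ r) (hy : ‖y‖ ≤ r) : ‖x + y‖ ≤ r :=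
  (IsUltrametricDist.norm_add_le_max x y).trans (max_le hx hy)

omit [CharZero C] in
theorem norm_sub_le_of_le {x y : C} {r : ℝ} (hx : ‖x‖ ≤ r) (hy : ‖y‖ ≤ r) : ‖x - y‖ ≤ r := by
  rw [sub_eq_add_neg]
  exact norm_add_le_of_le hx (by rwa [norm_neg])

variable (h2 : ‖(2 : C)‖ = 1 / 2)
include h2

/-- The expansion of `B_m` at `b / M` and at `a / M`, for `c a = b + M q`: up to multiples of `M`,
only the term `m b^(m-1) (q - h)` remains. -/
theorem bernoulli_eval_sub_mul (n : ℕ) {M a b q c h : ℕ} (hM : M ≠ 0) (hcab : c * a = b + M * q)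
    (hch : c = 2 * h + 1) :
    ∃ T : ℚ, (M : ℚ) ^ (n + 1) * (Polynomial.bernoulli (n + 2)).eval (b / M : ℚ) -
        c ^ (n + 2) * ((M : ℚ) ^ (n + 1) * (Polynomial.bernoulli (n + 2)).eval (a / M : ℚ)) +
        (n + 2) * b ^ (n + 1) * (q - h) = M * T ∧ ‖(T : C)‖ ≤ bernBound C n + 2 := by
  obtain ⟨k, hk⟩ := Polynomial.powAddExpansion b (M * q) (n + 2)
  obtain ⟨k', hk'⟩ : ∃ k' : ℕ, (b + M * q) ^ (n + 1) = b ^ (n + 1) + M * k' := by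
    obtain ⟨l, hl⟩ := Polynomial.powAddExpansion b (M * q) (n + 1)
    exact ⟨(n + 1 : ℕ) * b ^ n * q + l * M * q ^ 2, by rw [hl, Nat.add_sub_cancel]; push_cast; ring⟩
  have hMq : (M : ℚ) ≠ 0 := Nat.cast_ne_zero.2 hM
  refine ⟨bernTail n M b - k * q ^ 2 + c * (n + 2) / 2 * k' - c ^ (n + 2) * bernTail n M a, ?_, ?_⟩
  · rw [bernoulli_eval_div n hMq, bernoulli_eval_div n hMq]
    have e1 : ((c : ℚ) * a) ^ (n + 2) = b ^ (n + 2) + (n + 2) * b ^ (n + 1) * (M * q) +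
        k * (M * q) ^ 2 := by
      have : (c * a) ^ (n + 2) = b ^ (n + 2) + (n + 2) * b ^ (n + 1) * (M * q) + k * (M * q) ^ 2 := by
        rw [hcab, hk]
        rfl
      exact_mod_cast this
    have e2 : ((c : ℚ) * a) ^ (n + 1) = b ^ (n + 1) + M * k' := by
      have : (c * a) ^ (n + 1) = b ^ (n + 1) + M * k' := by rw [hcab, hk']
      exact_mod_cast this
    have e3 : (c : ℚ) = 2 * h + 1 := by exact_mod_cast hch
    have e4 : (c : ℚ) ^ (n + 2) * (a ^ (n + 2) / M - (n + 2) / 2 * a ^ (n + 1) +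
        M * bernTail n M a) = ((c : ℚ) * a) ^ (n + 2) / M -
        c * (n + 2) / 2 * ((c : ℚ) * a) ^ (n + 1) + c ^ (n + 2) * M * bernTail n M a := by
      rw [mul_pow, mul_pow]
      ring
    rw [e4, e1, e2, e3]
    field_simp
    ring
  · have hB : 0 ≤ bernBound C n := bernBound_nonneg n
    push_cast
    refine norm_sub_le_of_le (norm_add_le_of_le (norm_sub_le_of_le ?_ ?_) ?_) ?_
    · exact (norm_bernTail_le n M b).trans (by linarith)
    · have : ‖((k * q ^ 2 : ℕ) : C)‖ ≤ 1 := IsUltrametricDist.norm_natCast_le_one C _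
      push_cast at this
      linarith
    · have : ‖((c * (n + 2) * k' : ℕ) : C)‖ ≤ 1 := IsUltrametricDist.norm_natCast_le_one C _
      push_cast at this
      rw [div_mul_eq_mul_div, norm_div, h2]
      linarith
    · rw [norm_mul]
      have := mul_le_mul (norm_natCast_pow_le_one (C := C) c (n + 2)) (norm_bernTail_le (C := C) n M a)
        (norm_nonneg _) zero_le_one
      linarith

/-- The sum `∑ φ(b) b^(m-1) (q - h)` over the residues `a`, where `c a = b + M q` with `0 ≤ b < M`
and `c = 2 h + 1`, for `m = n + 2`. -/
def stickelbergerSum {M : ℕ} [NeZero M] (φ : ZMod M → C) (n c h : ℕ) : C :=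
  ∑ a : ZMod M, φ (c * a) * ((c * a : ZMod M).val : C) ^ (n + 1) * (((c * a.val / M : ℕ) : C) - h)

omit h2 in
theorem mul_val_eq {M : ℕ} [NeZero M] (c : ℕ) (a : ZMod M) :
    c * a.val = (c * a : ZMod M).val + M * (c * a.val / M) := by
  rw [ZMod.val_mul, ZMod.val_natCast, Nat.mod_mul_mod, Nat.mod_add_div]

/-- Modulo the level, `(1 - φ(c) c^m) L(φ, 1 - m)` is a sum with integral terms. -/
theorem norm_sub_stickelbergerSum_le {M : ℕ} [NeZero M] (φ : DirichletCharacter C M)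
    (hφ : ∀ a, ‖φ a‖ ≤ 1) (n : ℕ) {c h : ℕ} (hch : c = 2 * h + 1) (hc : c.Coprime M) :
    ‖(1 - φ c * c ^ (n + 2)) * bernVal φ (n + 2) - stickelbergerSum φ n c h‖ ≤
      (bernBound C n + 2) / ‖((n + 2 : ℕ) : C)‖ * ‖(M : C)‖ := by
  have hM : M ≠ 0 := NeZero.ne M
  have hMC : (M : C) ≠ 0 := Nat.cast_ne_zero.2 hM
  have hnC : ((n + 2 : ℕ) : C) ≠ 0 := Nat.cast_ne_zero.2 (by omega)
  choose T hT hT' using fun a : ZMod M =>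
    bernoulli_eval_sub_mul h2 n hM (mul_val_eq c a) hch
  set B : ZMod M → C := fun a =>
    (M : C) ^ (n + 1) * ((Polynomial.bernoulli (n + 2)).eval (a.val / M : ℚ) : ℚ) with hB
  have hval : bernVal φ (n + 2) = -(1 / ((n + 2 : ℕ) : C)) * ∑ a, φ a * B a := by
    rw [bernVal, hB, Finset.mul_sum, Finset.mul_sum]
    refine Finset.sum_congr rfl fun a _ => ?_
    simp only [show n + 2 - 1 = n + 1 by omega]
    ring
  have hperm : ∑ a, φ a * B a = ∑ a : ZMod M, φ (c * a) * B (c * a) := by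
    set u := ZMod.unitOfCoprime c hc
    refine (Fintype.sum_equiv (Units.mulLeft u) _ _ fun a => ?_).symm
    simp [u]
  have hTC : ∀ a : ZMod M, B (c * a) - (c : C) ^ (n + 2) * B a +
      ((n + 2 : ℕ) : C) * ((c * a : ZMod M).val : C) ^ (n + 1) * (((c * a.val / M : ℕ) : C) - h) =
      M * (T a : C) := fun a => by
    have := congrArg (fun x : ℚ => (x : C)) (hT a)
    push_cast at this
    rw [hB]
    push_cast
    exact this
  have key : (1 - φ c * c ^ (n + 2)) * bernVal φ (n + 2) - stickelbergerSum φ n c h =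
      -(1 / ((n + 2 : ℕ) : C)) * (M * ∑ a : ZMod M, φ (c * a) * (T a : C)) := by
    have e1 : (1 - φ c * c ^ (n + 2)) * bernVal φ (n + 2) = -(1 / ((n + 2 : ℕ) : C)) *
        ∑ a : ZMod M, φ (c * a) * (B (c * a) - (c : C) ^ (n + 2) * B a) := by
      rw [sub_mul, one_mul]
      nth_rewrite 1 [hval]
      rw [hperm, hval, mul_left_comm, ← mul_sub, Finset.mul_sum, ← Finset.sum_sub_distrib]
      congr 1
      refine Finset.sum_congr rfl fun a _ => ?_
      rw [map_mul]
      ring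
    have e2 : stickelbergerSum φ n c h = (1 / ((n + 2 : ℕ) : C)) * ∑ a : ZMod M, φ (c * a) *
        (((n + 2 : ℕ) : C) * ((c * a : ZMod M).val : C) ^ (n + 1) * (((c * a.val / M : ℕ) : C) - h)) := by
      rw [stickelbergerSum, Finset.mul_sum]
      refine Finset.sum_congr rfl fun a _ => ?_
      field_simp
    have e3 : (M : C) * ∑ a : ZMod M, φ (c * a) * (T a : C) = ∑ a : ZMod M, φ (c * a) *
        (B (c * a) - (c : C) ^ (n + 2) * B a) + ∑ a : ZMod M, φ (c * a) *
        (((n + 2 : ℕ) : C) * ((c * a : ZMod M).val : C) ^ (n + 1) * (((c * a.val / M : ℕ) : C) - h)) := by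
      rw [← Finset.sum_add_distrib, Finset.mul_sum]
      refine Finset.sum_congr rfl fun a _ => ?_
      rw [← mul_add, hTC]
      ring
    rw [e1, e2, e3]
    ring
  rw [key, norm_mul, norm_neg, norm_div, norm_one, norm_mul]
  have hsum : ‖∑ a : ZMod M, φ (c * a) * (T a : C)‖ ≤ bernBound C n + 2 := by
    refine IsUltrametricDist.norm_sum_le_of_forall_le_of_nonneg
      (by linarith [bernBound_nonneg (C := C) n]) fun a _ => ?_
    rw [norm_mul]
    exact (mul_le_of_le_one_left (norm_nonneg _) (hφ _)).trans (hT' a)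
  calc 1 / ‖((n + 2 : ℕ) : C)‖ * (‖(M : C)‖ * ‖∑ a : ZMod M, φ (c * a) * (T a : C)‖)
      ≤ 1 / ‖((n + 2 : ℕ) : C)‖ * (‖(M : C)‖ * (bernBound C n + 2)) := by gcongr
    _ = _ := by ring

omit [CharZero C] in
/-- In a sum over `ℤ/M` of a function that is even up to `δ`, the terms at `a` and `-a` add up to
twice one of them, up to `δ`. -/
theorem norm_sum_le_of_almost_even {M : ℕ} [NeZero M] (T : ZMod M → C) {ε δ : ℝ} (hδ : 0 ≤ δ)
    (hT : ∀ a, ‖T a‖ ≤ ε) (hTδ : ∀ a, ‖T (-a) - T a‖ ≤ δ) (h0 : ∀ a, a = -a → T a = 0) :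
    ‖∑ a, T a‖ ≤ max (ε / 2) δ := by
  classical
  set P := Finset.univ.filter (fun a : ZMod M => a ≠ -a ∧ 2 * a.val < M) with hP
  set P' := Finset.univ.filter (fun a : ZMod M => a ≠ -a ∧ ¬ 2 * a.val < M) with hP'
  have hne0 : ∀ a : ZMod M, a ≠ -a → a ≠ 0 := fun a ha h => ha (by rw [h, neg_zero])
  have hmid : ∀ a : ZMod M, 2 * a.val = M → a = -a := fun a ha => by
    rw [eq_neg_iff_add_eq_zero, ← ZMod.natCast_zmod_val a, ← Nat.cast_add, ← two_mul, ha,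
      ZMod.natCast_self]
  have hsplit : ∑ a, T a = ∑ a ∈ P, T a + ∑ a ∈ P', T a := by
    rw [← Finset.sum_filter_add_sum_filter_not Finset.univ (fun a : ZMod M => a = -a),
      Finset.sum_eq_zero (fun a ha => h0 a (Finset.mem_filter.1 ha).2), zero_add,
      ← Finset.sum_filter_add_sum_filter_not _ (fun a : ZMod M => 2 * a.val < M),
      Finset.filter_filter, Finset.filter_filter]
  have hflip : ∑ a ∈ P', T a = ∑ a ∈ P, T (-a) := by
    refine Finset.sum_nbij' (fun a => -a) (fun a => -a) ?_ ?_ (fun a _ => neg_neg a)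
      (fun a _ => neg_neg a) (fun a _ => by rw [neg_neg])
    · intro a ha
      obtain ⟨h1, h3⟩ := (Finset.mem_filter.1 ha).2
      refine Finset.mem_filter.2 ⟨Finset.mem_univ _, by rw [neg_neg]; exact h1.symm, ?_⟩
      have hlt := ZMod.val_lt a
      have hm := mt (hmid a) h1
      rw [ZMod.neg_val, if_neg (hne0 a h1)]
      omega
    · intro a ha
      obtain ⟨h1, h3⟩ := (Finset.mem_filter.1 ha).2
      refine Finset.mem_filter.2 ⟨Finset.mem_univ _, by rw [neg_neg]; exact h1.symm, ?_⟩
      have hlt := ZMod.val_lt a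
      rw [ZMod.neg_val, if_neg (hne0 a h1)]
      omega
  rw [hsplit, hflip, ← Finset.sum_add_distrib]
  refine IsUltrametricDist.norm_sum_le_of_forall_le_of_nonneg (le_max_of_le_right hδ) fun a _ => ?_
  rw [show T a + T (-a) = 2 * T a + (T (-a) - T a) by ring]
  refine norm_add_le_of_le (le_max_of_le_left ?_) (le_max_of_le_right (hTδ a))
  rw [norm_mul, h2]
  linarith [hT a]

/-- Since the terms of the sum are even functions of `a` modulo `M`, a congruence between the
characters gains a factor `2`. -/
theorem norm_stickelbergerSum_sub_le {M : ℕ} [NeZero M] (h4 : 4 ∣ M) {φ φ' : DirichletCharacter C M}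
    (hφ : ∀ a, ‖φ a‖ ≤ 1) (hφ' : ∀ a, ‖φ' a‖ ≤ 1) (he : φ.Even) (he' : φ'.Even) {ε : ℝ}
    (hε : ∀ a, ‖φ a - φ' a‖ ≤ ε) {n : ℕ} (hn : Even n) {c h : ℕ} (hch : c = 2 * h + 1)
    (hc : c.Coprime M) :
    ‖stickelbergerSum φ n c h - stickelbergerSum φ' n c h‖ ≤ max (ε / 2) ‖(M : C)‖ := by
  have hcu : IsUnit (c : ZMod M) := (ZMod.isUnit_iff_coprime c M).2 hc
  set T : ZMod M → C := fun a => (φ (c * a) - φ' (c * a)) *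
    (((c * a : ZMod M).val : C) ^ (n + 1) * (((c * a.val / M : ℕ) : C) - h)) with hTdef
  have hsub : stickelbergerSum φ n c h - stickelbergerSum φ' n c h = ∑ a, T a := by
    rw [stickelbergerSum, stickelbergerSum, ← Finset.sum_sub_distrib]
    refine Finset.sum_congr rfl fun a _ => ?_
    rw [hTdef]
    ring
  have hint : ∀ x : ℤ, ‖(x : C)‖ ≤ 1 := IsUltrametricDist.norm_intCast_le_one C
  rw [hsub]
  refine norm_sum_le_of_almost_even h2 T (norm_nonneg _) (fun a => ?_) (fun a => ?_) fun a ha => ?_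
  · rw [hTdef, norm_mul]
    have h1 : ∀ b q : ℕ, ‖(b : C) ^ (n + 1) * ((q : C) - h)‖ ≤ 1 := fun b q => by
      have := hint ((b : ℤ) ^ (n + 1) * ((q : ℤ) - h))
      push_cast at this
      exact this
    exact (mul_le_of_le_one_right (norm_nonneg _) (h1 _ _)).trans (hε _)
  · by_cases ha0 : a = 0
    · rw [ha0, neg_zero, sub_self, norm_zero]
      exact norm_nonneg _
    have hb0 : (c * a : ZMod M) ≠ 0 := fun h => ha0 (hcu.mul_right_eq_zero.1 h)
    have hb : (c * -a : ZMod M).val = M - (c * a : ZMod M).val := by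
      rw [mul_neg, ZMod.neg_val, if_neg hb0]
    have hlt := ZMod.val_lt (c * a : ZMod M)
    have hqq : c * (-a).val / M + c * a.val / M = 2 * h := by
      have e1 := mul_val_eq c a
      have e2 := mul_val_eq c (-a)
      have e3 : (-a).val = M - a.val := by rw [ZMod.neg_val, if_neg ha0]
      have hlt' := ZMod.val_lt a
      have e4 : c * (-a).val + c * a.val = c * M := by
        rw [← mul_add, e3, Nat.sub_add_cancel hlt'.le]
      rw [e1, e2, hb] at e4
      have e5 : M * (c * (-a).val / M + c * a.val / M + 1) = M * (2 * h + 1) := by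
        rw [← hch, mul_comm M c, ← e4, mul_add, mul_add]
        omega
      have := Nat.eq_of_mul_eq_mul_left (Nat.pos_of_ne_zero (NeZero.ne M)) e5
      omega
    obtain ⟨k, hk⟩ : (M : ℤ) ∣ ((M : ℤ) - (c * a : ZMod M).val) ^ (n + 1) +
        ((c * a : ZMod M).val : ℤ) ^ (n + 1) := by
      have := Odd.add_dvd_pow_add_pow ((M : ℤ) - (c * a : ZMod M).val) (c * a : ZMod M).val
        hn.add_one
      rwa [sub_add_cancel] at this
    have hkC : ((M : C) - (c * a : ZMod M).val) ^ (n + 1) + ((c * a : ZMod M).val : C) ^ (n + 1) =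
        M * k := by exact_mod_cast congrArg (fun x : ℤ => (x : C)) hk
    have hqC : ((c * (-a).val / M : ℕ) : C) + ((c * a.val / M : ℕ) : C) = 2 * h := by
      exact_mod_cast congrArg (fun x : ℕ => (x : C)) hqq
    have hbC : ((c * -a : ZMod M).val : C) = M - (c * a : ZMod M).val := by
      rw [hb, Nat.cast_sub hlt.le]
    have hφn : φ (c * -a) = φ (c * a) := by rw [mul_neg, he.eval_neg]
    have hφn' : φ' (c * -a) = φ' (c * a) := by rw [mul_neg, he'.eval_neg]
    have hTe : T (-a) - T a = (φ (c * a) - φ' (c * a)) * ((M : C) *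
        (k * (h - ((c * a.val / M : ℕ) : C)))) := by
      simp only [hTdef]
      rw [hφn, hφn', hbC, eq_sub_of_add_eq hqC, ← mul_sub]
      congr 1
      rw [← mul_assoc, ← hkC]
      ring
    rw [hTe, norm_mul, norm_mul]
    have h1 : ∀ q : ℕ, ‖(k : C) * (h - (q : C))‖ ≤ 1 := fun q => by
      have := hint (k * (h - (q : ℤ)))
      push_cast at this
      exact this
    exact (mul_le_of_le_one_left (by positivity) (norm_sub_le_of_le (hφ _) (hφ' _))).trans
      (mul_le_of_le_one_right (norm_nonneg _) (h1 _))
  · -- such an `a` is not a unit, as `4 ∣ M`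
    have hnu : ¬ IsUnit (c * a : ZMod M) := fun hu => by
      have hau : IsUnit a := isUnit_of_mul_isUnit_right hu
      have h3 : (2 : ZMod M) * a = 0 := by rw [two_mul]; nth_rewrite 2 [ha]; exact add_neg_cancel a
      have h4' : ((2 : ℕ) : ZMod M) = 0 := by exact_mod_cast hau.mul_left_eq_zero.1 h3
      rw [ZMod.natCast_eq_zero_iff] at h4'
      have := Nat.le_of_dvd (by norm_num) (h4.trans h4')
      omega
    simp only [hTdef]
    rw [φ.map_nonunit hnu, φ'.map_nonunit hnu, sub_self, zero_mul]

/-- Even characters that are `2`-adically close have close `L`-values, up to an error that tends to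
`0` with the level. -/
theorem norm_bernVal_sub_le {M : ℕ} [NeZero M] (h4 : 4 ∣ M) {φ φ' : DirichletCharacter C M}
    (hφ : ∀ a, ‖φ a‖ ≤ 1) (hφ' : ∀ a, ‖φ' a‖ ≤ 1) (he : φ.Even) (he' : φ'.Even) {ε : ℝ}
    (hε : ∀ a, ‖φ a - φ' a‖ ≤ ε) {n : ℕ} (hn : Even n) {c : ℕ} (hco : Odd c)
    (hc : c.Coprime M) :
    ‖(1 - φ c * c ^ (n + 2)) * bernVal φ (n + 2) - (1 - φ' c * c ^ (n + 2)) * bernVal φ' (n + 2)‖ ≤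
      max (ε / 2) (((bernBound C n + 2) / ‖((n + 2 : ℕ) : C)‖ + 1) * ‖(M : C)‖) := by
  obtain ⟨h, hch⟩ := hco
  have h1 := norm_sub_stickelbergerSum_le h2 φ hφ n hch hc
  have h1' := norm_sub_stickelbergerSum_le h2 φ' hφ' n hch hc
  have h3 := norm_stickelbergerSum_sub_le h2 h4 hφ hφ' he he' hε hn hch hc
  have hK : 0 ≤ (bernBound C n + 2) / ‖((n + 2 : ℕ) : C)‖ :=
    div_nonneg (by linarith [bernBound_nonneg (C := C) n]) (norm_nonneg _)
  have hM := norm_nonneg (M : C)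
  set K := (bernBound C n + 2) / ‖((n + 2 : ℕ) : C)‖
  set x := (1 - φ c * c ^ (n + 2)) * bernVal φ (n + 2)
  set y := (1 - φ' c * c ^ (n + 2)) * bernVal φ' (n + 2)
  set s := stickelbergerSum φ n c h
  set t := stickelbergerSum φ' n c h
  have hKM : K * ‖(M : C)‖ ≤ (K + 1) * ‖(M : C)‖ := by linarith
  have hM1 : ‖(M : C)‖ ≤ (K + 1) * ‖(M : C)‖ := by nlinarith
  rw [show x - y = ((x - s) - (y - t)) + (s - t) by ring]
  refine norm_add_le_of_le (norm_sub_le_of_le ?_ ?_) (h3.trans (max_le_max le_rfl hM1))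
  · exact le_max_of_le_right (h1.trans hKM)
  · exact le_max_of_le_right (h1'.trans hKM)

end BernoulliCongruence

/-! ### `L`-values as algebraic numbers and their `2`-adic norms -/

section LValues

open DirichletCharacter

theorem map_bernVal {F F' : Type*} [Field F] [Field F'] (f : F →+* F') {M : ℕ} [NeZero M]
    (φ : ZMod M → F) (m : ℕ) : f (bernVal φ m) = bernVal (fun a => f (φ a)) m := by
  simp only [bernVal, map_mul, map_neg, map_div₀, map_pow, map_natCast, map_sum, map_ratCast]

/-- The values of `L`-functions at negative integers in terms of Bernoulli polynomials. -/
theorem LFunction_eq_bernVal {M : ℕ} [NeZero M] (χ : DirichletCharacter ℂ M) (n : ℕ) :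
    LFunction χ (1 - (n + 2 : ℕ)) = bernVal χ (n + 2) := by
  have hM : (M : ℂ) ≠ 0 := Nat.cast_ne_zero.2 (NeZero.ne M)
  have hs : (1 : ℂ) - (n + 2 : ℕ) = -((n + 1 : ℕ) : ℂ) := by push_cast; ring
  rw [DirichletCharacter.LFunction, ZMod.LFunction, hs, neg_neg, Complex.cpow_natCast, bernVal,
    show n + 2 - 1 = n + 1 by omega, Finset.mul_sum, Finset.mul_sum]
  refine Finset.sum_congr rfl fun a _ => ?_
  have hx : ((a.val : ℝ) / M) ∈ Set.Icc (0 : ℝ) 1 := by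
    have hpos : (0 : ℝ) < M := Nat.cast_pos.2 (Nat.pos_of_ne_zero (NeZero.ne M))
    refine ⟨by positivity, (div_le_one hpos).2 ?_⟩
    exact_mod_cast (ZMod.val_lt a).le
  have hev : Polynomial.eval (((a.val : ℝ) / M : ℝ) : ℂ) (Polynomial.map (algebraMap ℚ ℂ)
      (Polynomial.bernoulli (n + 1 + 1))) =
      ((Polynomial.bernoulli (n + 2)).eval (a.val / M : ℚ) : ℚ) := by
    have : (((a.val : ℝ) / M : ℝ) : ℂ) = algebraMap ℚ ℂ (a.val / M : ℚ) := by
      push_cast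
      simp
    rw [this, Polynomial.eval_map_algebraMap, Polynomial.aeval_algebraMap_apply]
    simp
  rw [ZMod.toAddCircle_apply, HurwitzZeta.hurwitzZeta_neg_nat (Nat.succ_ne_zero n) hx, hev]
  push_cast
  ring

theorem isAlgebraic_char {M : ℕ} [NeZero M] (χ : DirichletCharacter ℂ M) (a : ZMod M) :
    χ a ∈ algebraicClosure ℚ ℂ := by
  rw [mem_algebraicClosure_iff]
  by_cases ha : IsUnit a
  · have h := congrArg (fun ψ : DirichletCharacter ℂ M => ψ a) χ.pow_card_eq_one
    obtain ⟨u, rfl⟩ := ha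
    simp only [MulChar.pow_apply_coe, MulChar.one_apply_coe] at h
    refine (IsIntegral.of_pow (n := Fintype.card (ZMod M)ˣ) Fintype.card_pos (x := χ u) (R := ℚ) ?_).isAlgebraic
    rw [h]
    exact isIntegral_one
  · rw [χ.map_nonunit ha]
    exact isAlgebraic_zero

/-- A Dirichlet character with values in the field of algebraic numbers. -/
def algChar {M : ℕ} [NeZero M] (χ : DirichletCharacter ℂ M) :
    DirichletCharacter (algebraicClosure ℚ ℂ) M where
  toFun a := ⟨χ a, isAlgebraic_char χ a⟩
  map_one' := Subtype.ext (map_one χ)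
  map_mul' a b := Subtype.ext (map_mul χ a b)
  map_nonunit' _ ha := Subtype.ext (χ.map_nonunit ha)

/-- A Dirichlet character with values in `ℚ̄₂`, through an embedding of `ℚ̄`. -/
def adicChar (ι : Embedding2) {M : ℕ} [NeZero M] (χ : DirichletCharacter ℂ M) :
    DirichletCharacter (PadicAlgCl 2) M :=
  (algChar χ).ringHomComp ι

theorem coe_algChar {M : ℕ} [NeZero M] (χ : DirichletCharacter ℂ M) (a : ZMod M) :
    (algChar χ a : ℂ) = χ a := rfl

theorem adicChar_apply (ι : Embedding2) {M : ℕ} [NeZero M] (χ : DirichletCharacter ℂ M)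
    (a : ZMod M) : adicChar ι χ a = ι (algChar χ a) := rfl

/-- The value at `1 - m` of the `L`-function of `χ`, as an algebraic number. -/
def algL {M : ℕ} [NeZero M] (χ : DirichletCharacter ℂ M) (m : ℕ) : algebraicClosure ℚ ℂ :=
  bernVal (algChar χ) m

theorem coe_algL {M : ℕ} [NeZero M] (χ : DirichletCharacter ℂ M) (n : ℕ) :
    (algL χ (n + 2) : ℂ) = LFunction χ (1 - (n + 2 : ℕ)) := by
  rw [LFunction_eq_bernVal]
  exact map_bernVal (algebraMap (algebraicClosure ℚ ℂ) ℂ) _ _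

theorem map_algL (ι : Embedding2) {M : ℕ} [NeZero M] (χ : DirichletCharacter ℂ M) (m : ℕ) :
    ι (algL χ m) = bernVal (adicChar ι χ) m :=
  map_bernVal ι _ _

theorem norm_two : ‖(2 : PadicAlgCl 2)‖ = 1 / 2 := by
  have : Fact (Nat.Prime 2) := ⟨Nat.prime_two⟩
  have h := PadicAlgCl.norm_extends 2 (2 : ℚ_[2])
  have h2 := Padic.norm_p (p := 2)
  rw [map_ofNat] at h
  rw [h]
  exact_mod_cast h2.trans (by norm_num)

theorem norm_adicChar_le_one (ι : Embedding2) {M : ℕ} [NeZero M] (χ : DirichletCharacter ℂ M)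
    (a : ZMod M) : ‖adicChar ι χ a‖ ≤ 1 := by
  by_cases ha : IsUnit a
  · obtain ⟨u, rfl⟩ := ha
    have h := congrArg (fun ψ : DirichletCharacter (PadicAlgCl 2) M => ψ u)
      (adicChar ι χ).pow_card_eq_one
    simp only [MulChar.pow_apply_coe, MulChar.one_apply_coe] at h
    exact ((pow_eq_one_iff_of_nonneg (norm_nonneg _) Fintype.card_ne_zero).1
      (by rw [← norm_pow, h, norm_one])).le
  · rw [MulChar.map_nonunit _ ha, norm_zero]
    exact zero_le_one

theorem algChar_changeLevel {M M' : ℕ} [NeZero M] [NeZero M'] (h : M ∣ M')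
    (χ : DirichletCharacter ℂ M) : algChar (changeLevel h χ) = changeLevel h (algChar χ) := by
  ext u
  rw [coe_algChar, changeLevel_eq_cast_of_dvd, changeLevel_eq_cast_of_dvd, coe_algChar]

theorem adicChar_changeLevel_unit (ι : Embedding2) {M M' : ℕ} [NeZero M] [NeZero M'] (h : M ∣ M')
    (χ : DirichletCharacter ℂ M) (u : (ZMod M')ˣ) :
    adicChar ι (changeLevel h χ) u = adicChar ι χ (ZMod.cast (u : ZMod M')) := by
  rw [adicChar_apply, algChar_changeLevel, changeLevel_eq_cast_of_dvd, adicChar_apply]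

theorem even_adicChar (ι : Embedding2) {M : ℕ} [NeZero M] {χ : DirichletCharacter ℂ M}
    (hχ : χ.Even) : (adicChar ι χ).Even := by
  have h : algChar χ (-1) = 1 := Subtype.ext hχ
  unfold DirichletCharacter.Even
  rw [adicChar_apply, h, map_one]

theorem cpow_neg_one_sub (p n : ℕ) : (p : ℂ) ^ (-(1 - ((n + 2 : ℕ) : ℂ))) = (p : ℂ) ^ (n + 1) := by
  rw [← Complex.cpow_natCast]
  congr 1
  push_cast
  ring

theorem one_sub_natCast_ne_one (n : ℕ) : (1 : ℂ) - ((n + 2 : ℕ) : ℂ) ≠ 1 := by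
  intro h
  have : ((n + 2 : ℕ) : ℂ) = 0 := by linear_combination -h
  exact absurd (Nat.cast_eq_zero.1 this) (by omega)

/-- Passing to a level with the same prime divisors does not change the `L`-value. -/
theorem algL_changeLevel {M M' : ℕ} [NeZero M] [NeZero M'] (h : M ∣ M')
    (hp : ∀ p : ℕ, p.Prime → p ∣ M' → p ∣ M) (χ : DirichletCharacter ℂ M) (n : ℕ) :
    algL (changeLevel h χ) (n + 2) = algL χ (n + 2) := by
  apply Subtype.ext
  rw [coe_algL, coe_algL, LFunction_changeLevel h χ (Or.inr (one_sub_natCast_ne_one n)),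
    Finset.prod_eq_one, mul_one]
  intro p hpM
  have hpp := Nat.prime_of_mem_primeFactors hpM
  rw [χ.map_nonunit, zero_mul, sub_zero]
  rw [ZMod.isUnit_iff_coprime, Nat.Prime.coprime_iff_not_dvd hpp, not_not]
  exact hp p hpp (Nat.dvd_of_mem_primeFactors hpM)

/-- Even characters of level divisible by `4` that are `2`-adically close have close
`L`-values. The error term of the congruence is removed by passing to the levels `M 2^t`, at which
the `L`-values are the same. -/
theorem norm_algL_sub_le (ι : Embedding2) {M : ℕ} [NeZero M] (h4 : 4 ∣ M)
    {χ χ' : DirichletCharacter ℂ M} (he : χ.Even) (he' : χ'.Even) {ε : ℝ} (hε0 : 0 < ε)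
    (hε : ∀ a, ‖adicChar ι χ a - adicChar ι χ' a‖ ≤ ε) {n : ℕ} (hn : _root_.Even n) {c : ℕ}
    (hc : c.Coprime M) :
    ‖(1 - adicChar ι χ c * (c : PadicAlgCl 2) ^ (n + 2)) * ι (algL χ (n + 2)) -
      (1 - adicChar ι χ' c * (c : PadicAlgCl 2) ^ (n + 2)) * ι (algL χ' (n + 2))‖ ≤ ε / 2 := by
  have h2M : 2 ∣ M := Dvd.dvd.trans (by norm_num) h4
  have hco : _root_.Odd c := Nat.coprime_two_right.1 (hc.of_dvd_right h2M)
  set K := (bernBound (PadicAlgCl 2) n + 2) / ‖((n + 2 : ℕ) : PadicAlgCl 2)‖ + 1 with hK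
  set x := (1 - adicChar ι χ c * (c : PadicAlgCl 2) ^ (n + 2)) * ι (algL χ (n + 2)) -
      (1 - adicChar ι χ' c * (c : PadicAlgCl 2) ^ (n + 2)) * ι (algL χ' (n + 2)) with hx
  -- the estimate at level `M 2^t`
  have key : ∀ t : ℕ, ‖x‖ ≤ max (ε / 2) (K * ‖(M : PadicAlgCl 2)‖ * (1 / 2) ^ t) := by
    intro t
    have hdvd : M ∣ M * 2 ^ t := Dvd.intro _ rfl
    have hprimes : ∀ p : ℕ, p.Prime → p ∣ M * 2 ^ t → p ∣ M := fun p hp h => by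
      rcases hp.dvd_mul.1 h with h | h
      · exact h
      · rwa [(Nat.prime_dvd_prime_iff_eq hp Nat.prime_two).1 (hp.dvd_of_dvd_pow h)]
    have hct : c.Coprime (M * 2 ^ t) :=
      hc.mul_right (Nat.Coprime.pow_right _ (Nat.coprime_two_right.2 hco))
    have hcval : ∀ χ : DirichletCharacter ℂ M,
        adicChar ι (changeLevel hdvd χ) c = adicChar ι χ c := fun χ => by
      rw [adicChar_apply, algChar_changeLevel, changeLevel_natCast _ _ hct, adicChar_apply]
    have h := norm_bernVal_sub_le norm_two (h4.trans hdvd)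
      (φ := adicChar ι (changeLevel hdvd χ)) (φ' := adicChar ι (changeLevel hdvd χ'))
      (norm_adicChar_le_one ι _) (norm_adicChar_le_one ι _)
      (even_adicChar ι (even_changeLevel hdvd he)) (even_adicChar ι (even_changeLevel hdvd he'))
      (ε := ε) (fun a => ?_) hn hco hct
    · rw [← map_algL, ← map_algL, algL_changeLevel hdvd hprimes, algL_changeLevel hdvd hprimes,
        hcval, hcval] at h
      refine h.trans_eq ?_
      rw [← hK, Nat.cast_mul, norm_mul, Nat.cast_pow, norm_pow, Nat.cast_ofNat, norm_two, mul_assoc]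
    · by_cases ha : IsUnit a
      · obtain ⟨u, rfl⟩ := ha
        rw [adicChar_changeLevel_unit, adicChar_changeLevel_unit]
        exact hε _
      · rw [MulChar.map_nonunit _ ha, MulChar.map_nonunit _ ha, sub_self, norm_zero]
        exact hε0.le
  have hlim : Filter.Tendsto (fun t : ℕ => max (ε / 2) (K * ‖(M : PadicAlgCl 2)‖ * (1 / 2) ^ t))
      Filter.atTop (nhds (max (ε / 2) (K * ‖(M : PadicAlgCl 2)‖ * 0))) :=
    tendsto_const_nhds.max ((tendsto_pow_atTop_nhds_zero_of_lt_one (by norm_num)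
      (by norm_num)).const_mul _)
  have := ge_of_tendsto' hlim key
  rwa [mul_zero, max_eq_left (by linarith)] at this

end LValues

/-! ### Roots of unity of `2`-power order -/

section RootsOfUnity

variable {C : Type*} [NormedField C] [IsUltrametricDist C] (h2 : ‖(2 : C)‖ = 1 / 2)

omit [IsUltrametricDist C] in
theorem norm_rootOfUnity {z : C} {n : ℕ} (hn : n ≠ 0) (hz : z ^ n = 1) : ‖z‖ = 1 :=
  (pow_eq_one_iff_of_nonneg (norm_nonneg _) hn).1 (by rw [← norm_pow, hz, norm_one])

theorem norm_pow_sub_one_le {z : C} (hz : ‖z‖ ≤ 1) (i : ℕ) : ‖z ^ i - 1‖ ≤ ‖z - 1‖ := by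
  rw [← geom_sum_mul, norm_mul]
  refine mul_le_of_le_one_left (norm_nonneg _) ?_
  refine IsUltrametricDist.norm_sum_le_of_forall_le_of_nonneg zero_le_one fun i _ => ?_
  rw [norm_pow]
  exact pow_le_one₀ (norm_nonneg _) hz

include h2

theorem norm_natCast_of_odd {a : ℕ} (ha : Odd a) : ‖(a : C)‖ = 1 := by
  obtain ⟨k, rfl⟩ := ha
  have h1 : ‖((2 * k : ℕ) : C)‖ < ‖(1 : C)‖ := by
    rw [Nat.cast_mul, norm_mul, Nat.cast_ofNat, h2, norm_one]
    have := IsUltrametricDist.norm_natCast_le_one C k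
    linarith
  rw [Nat.cast_add, Nat.cast_one, IsUltrametricDist.norm_add_eq_max_of_norm_ne_norm h1.ne,
    max_eq_right h1.le, norm_one]

theorem norm_natCast_eq {a : ℕ} (ha : a ≠ 0) : ‖(a : C)‖ = (1 / 2) ^ padicValNat 2 a := by
  obtain ⟨k, m, hm, rfl⟩ := Nat.exists_eq_two_pow_mul_odd ha
  have : Fact (Nat.Prime 2) := ⟨Nat.prime_two⟩
  rw [padicValNat.mul (by positivity) (by rintro rfl; simp at ha), padicValNat.prime_pow,
    padicValNat.eq_zero_of_not_dvd (by rwa [← even_iff_two_dvd, Nat.not_even_iff_odd]), add_zero,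
    Nat.cast_mul, norm_mul, norm_natCast_of_odd h2 hm, mul_one, Nat.cast_pow, norm_pow,
    Nat.cast_ofNat, h2]

/-- `1 - z` generates the prime above `2` when `z` is a primitive `2^j`-th root of unity. -/
theorem norm_sub_one_pow {j : ℕ} {z : C} (hz : IsPrimitiveRoot z (2 ^ (j + 1))) :
    ‖z - 1‖ ^ 2 ^ j = 1 / 2 := by
  induction j generalizing z with
  | zero =>
    rw [zero_add, pow_one] at hz
    rw [hz.eq_neg_one_of_two_right, pow_zero, pow_one, show (-1 - 1 : C) = -2 by ring, norm_neg, h2]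
  | succ j ih =>
    have h1 := ih (hz.pow (by positivity) (by rw [pow_succ']))
    have hle : 1 / 2 ≤ ‖z ^ 2 - 1‖ := by
      by_contra! hlt
      have hlt' := pow_lt_pow_left₀ hlt (norm_nonneg _) (Nat.two_pow_pos j).ne'
      rw [h1] at hlt'
      exact absurd hlt' (not_lt.2 (pow_le_of_le_one (by norm_num) (by norm_num)
        (Nat.two_pow_pos j).ne'))
    have hfac : z ^ 2 - 1 = (z - 1) * ((z - 1) + 2) := by ring
    have hgt : ‖(2 : C)‖ < ‖z - 1‖ := by
      by_contra! hle'
      have : ‖z - 1 + 2‖ ≤ 1 / 2 := h2 ▸ norm_add_le_of_le hle' le_rfl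
      rw [hfac, norm_mul] at hle
      rw [h2] at hle'
      nlinarith [norm_nonneg (z - 1), norm_nonneg (z - 1 + 2)]
    rw [hfac, norm_mul, IsUltrametricDist.norm_add_eq_max_of_norm_ne_norm hgt.ne',
      max_eq_left hgt.le, ← pow_two, ← pow_mul, ← pow_succ'] at h1
    exact h1

theorem norm_sub_one {j : ℕ} (hj : 1 ≤ j) {z : C} (hz : IsPrimitiveRoot z (2 ^ j)) :
    ‖z - 1‖ = (2 : ℝ) ^ (-((2 : ℝ) ^ (1 - (j : ℤ)))) := by
  obtain ⟨j, rfl⟩ := Nat.exists_eq_add_of_le' hj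
  have h := norm_sub_one_pow h2 hz
  have h0 : (2 : ℝ) ^ j ≠ 0 := by positivity
  have e : (2 : ℝ) ^ (1 - ((j + 1 : ℕ) : ℤ)) = ((2 : ℝ) ^ j)⁻¹ := by
    rw [← zpow_natCast, ← zpow_neg]
    congr 1
    push_cast
    ring
  rw [e, Real.rpow_neg zero_le_two, ← Real.inv_rpow zero_le_two, ← one_div (2 : ℝ), ← h,
    ← Real.rpow_natCast, ← Real.rpow_mul (norm_nonneg _)]
  push_cast
  rw [mul_inv_cancel₀ h0, Real.rpow_one]

theorem one_half_le_norm_sub_one {j : ℕ} (hj : 1 ≤ j) {z : C} (hz : IsPrimitiveRoot z (2 ^ j)) :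
    1 / 2 ≤ ‖z - 1‖ := by
  obtain ⟨j, rfl⟩ := Nat.exists_eq_add_of_le' hj
  have h := norm_sub_one_pow h2 hz
  by_contra! hlt
  have hlt' := pow_lt_pow_left₀ hlt (norm_nonneg _) (Nat.two_pow_pos j).ne'
  rw [h] at hlt'
  exact absurd hlt' (not_lt.2 (pow_le_of_le_one (by norm_num) (by norm_num)
    (Nat.two_pow_pos j).ne'))

theorem norm_one_sub_mul {j : ℕ} (hj : 1 ≤ j) {z x : C} (hz : IsPrimitiveRoot z (2 ^ j))
    (hx : ‖x - 1‖ ≤ 1 / 4) : ‖1 - z * x‖ = ‖z - 1‖ := by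
  have hz1 := norm_rootOfUnity (by positivity) hz.pow_eq_one
  have hlt : ‖z * (x - 1)‖ < ‖z - 1‖ := by
    rw [norm_mul, hz1, one_mul]
    exact hx.trans_lt (lt_of_lt_of_le (by norm_num) (one_half_le_norm_sub_one h2 hj hz))
  rw [show 1 - z * x = -((z - 1) + z * (x - 1)) by ring, norm_neg,
    IsUltrametricDist.norm_add_eq_max_of_norm_ne_norm hlt.ne', max_eq_left hlt.le]

theorem norm_intCast_le_quarter {x : ℤ} (hx : (4 : ℤ) ∣ x) : ‖(x : C)‖ ≤ 1 / 4 := by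
  obtain ⟨y, rfl⟩ := hx
  have := IsUltrametricDist.norm_intCast_le_one C y
  rw [Int.cast_mul, norm_mul, show ((4 : ℤ) : C) = 2 * 2 by norm_num, norm_mul, h2]
  linarith

/-- The values of an integral polynomial at primitive `2^j`-th roots of unity have the same norm, if
one of them exceeds `‖z - 1‖ ^ s`. The proof is by induction on `s`: divide by `X - 1` as long as the value at `1` is even, using that
`2 = -(z - 1) (1 + z + ⋯ + z^(2^(j-1) - 1))`. -/
theorem norm_eval_eq_of_lt {j : ℕ} (hj : 1 ≤ j) {z z' : C} (hz : IsPrimitiveRoot z (2 ^ j))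
    (hz' : IsPrimitiveRoot z' (2 ^ j)) (s : ℕ) (P : Polynomial ℤ)
    (hP : ‖z - 1‖ ^ s < ‖Polynomial.aeval z P‖) :
    ‖Polynomial.aeval z' P‖ = ‖Polynomial.aeval z P‖ := by
  have hle : ∀ {w : C}, IsPrimitiveRoot w (2 ^ j) → ∀ Q : Polynomial ℤ, ‖Polynomial.aeval w Q‖ ≤ 1 := by
    intro w hw Q
    rw [Polynomial.aeval_eq_sum_range]
    refine IsUltrametricDist.norm_sum_le_of_forall_le_of_nonneg zero_le_one fun i _ => ?_
    rw [zsmul_eq_mul, norm_mul, norm_pow, norm_rootOfUnity (by positivity) hw.pow_eq_one, one_pow,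
      mul_one]
    exact IsUltrametricDist.norm_intCast_le_one C _
  have hlt1 : ∀ {w : C}, IsPrimitiveRoot w (2 ^ j) → ‖w - 1‖ < 1 := by
    intro w hw
    obtain ⟨i, hi⟩ := Nat.exists_eq_add_of_le' hj
    by_contra! hge
    have h3 := one_le_pow₀ hge (n := 2 ^ i)
    rw [norm_sub_one_pow h2 (hi ▸ hw)] at h3
    norm_num at h3
  have heq : ‖z' - 1‖ = ‖z - 1‖ := by rw [norm_sub_one h2 hj hz, norm_sub_one h2 hj hz']
  have hpos : 0 < ‖z - 1‖ := lt_of_lt_of_le (by norm_num) (one_half_le_norm_sub_one h2 hj hz)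
  have hdiv : ∀ P : Polynomial ℤ, ∃ Q : Polynomial ℤ, ∀ w : C,
      Polynomial.aeval w P = (w - 1) * Polynomial.aeval w Q + ((P.eval 1 : ℤ) : C) := by
    intro P
    obtain ⟨Q, hQ⟩ := Polynomial.X_sub_C_dvd_sub_C_eval (a := (1 : ℤ)) (p := P)
    refine ⟨Q, fun w => ?_⟩
    have := congrArg (Polynomial.aeval w) hQ
    rw [map_sub, map_mul, map_sub, Polynomial.aeval_X, Polynomial.aeval_C, Polynomial.aeval_C,
      map_one, eq_intCast] at this
    linear_combination this
  induction s generalizing P with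
  | zero =>
    rw [pow_zero] at hP
    exact absurd (hle hz P) (not_le.2 hP)
  | succ s ih =>
    obtain ⟨Q, hQw⟩ := hdiv P
    rcases Int.even_or_odd (P.eval 1) with ⟨e, he⟩ | ho
    · -- the value at `1` is even
      set V : Polynomial ℤ := ∑ i ∈ Finset.range (2 ^ (j - 1)), Polynomial.X ^ i with hV
      have hVw : ∀ {w : C}, IsPrimitiveRoot w (2 ^ j) → (2 : C) = -((w - 1) * Polynomial.aeval w V) := by
        intro w hw
        have h1 : w ^ 2 ^ (j - 1) = -1 := by
          have : IsPrimitiveRoot (w ^ 2 ^ (j - 1)) 2 :=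
            hw.pow (by positivity) (by rw [← pow_succ, Nat.sub_add_cancel hj])
          exact this.eq_neg_one_of_two_right
        rw [hV, map_sum]
        simp only [map_pow, Polynomial.aeval_X]
        rw [mul_geom_sum, h1]
        norm_num
      have hstep : ∀ {w : C}, IsPrimitiveRoot w (2 ^ j) →
          Polynomial.aeval w P = (w - 1) * Polynomial.aeval w (Q - Polynomial.C e * V) := by
        intro w hw
        rw [hQw w, he, map_sub, map_mul, Polynomial.aeval_C, eq_intCast]
        push_cast
        linear_combination (e : C) * hVw hw
      have hn := hstep hz
      have hn' := hstep hz'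
      have := ih (Q - Polynomial.C e * V) (by
        rw [hn, norm_mul, pow_succ'] at hP
        exact lt_of_mul_lt_mul_left hP (norm_nonneg _))
      rw [hn, hn', norm_mul, norm_mul, this, heq]
    · -- the value at `1` is odd
      have hunit : ‖((P.eval 1 : ℤ) : C)‖ = 1 := by
        have h3 := norm_natCast_of_odd h2 (Int.natAbs_odd.2 ho)
        rcases Int.natAbs_eq (P.eval 1) with h4 | h4
        · rw [h4, Int.cast_natCast, h3]
        · rw [h4, Int.cast_neg, norm_neg, Int.cast_natCast, h3]
      have hone : ∀ {w : C}, IsPrimitiveRoot w (2 ^ j) → ‖Polynomial.aeval w P‖ = 1 := by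
        intro w hw
        have hlt : ‖(w - 1) * Polynomial.aeval w Q‖ < ‖((P.eval 1 : ℤ) : C)‖ := by
          rw [hunit, norm_mul]
          exact (mul_le_of_le_one_right (norm_nonneg _) (hle hw Q)).trans_lt (hlt1 hw)
        rw [hQw w, IsUltrametricDist.norm_add_eq_max_of_norm_ne_norm hlt.ne, max_eq_right hlt.le,
          hunit]
      rw [hone hz, hone hz']

/-- The norm of an integral polynomial at a primitive `2^j`-th root of unity does not depend on the
choice of the root. -/
theorem norm_aeval_eq {j : ℕ} (hj : 1 ≤ j) {z z' : C} (hz : IsPrimitiveRoot z (2 ^ j))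
    (hz' : IsPrimitiveRoot z' (2 ^ j)) (P : Polynomial ℤ) :
    ‖Polynomial.aeval z' P‖ = ‖Polynomial.aeval z P‖ := by
  have key : ∀ {z z' : C}, IsPrimitiveRoot z (2 ^ j) → IsPrimitiveRoot z' (2 ^ j) →
      Polynomial.aeval z P ≠ 0 → ‖Polynomial.aeval z' P‖ = ‖Polynomial.aeval z P‖ := by
    intro z z' hz hz' h0
    have hlt : ‖z - 1‖ < 1 := by
      rw [norm_sub_one h2 hj hz]
      exact Real.rpow_lt_one_of_one_lt_of_neg one_lt_two (neg_lt_zero.2 (by positivity))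
    obtain ⟨s, hs⟩ := exists_pow_lt_of_lt_one (norm_pos_iff.2 h0) hlt
    exact norm_eval_eq_of_lt h2 hj hz hz' s P hs
  by_cases h0 : Polynomial.aeval z P = 0
  · by_cases h0' : Polynomial.aeval z' P = 0
    · rw [h0, h0']
    · exact (key hz' hz h0').symm
  · exact key hz hz' h0

end RootsOfUnity

/-! ### The order of the `L`-values of the layers of `ℚ_cyc` -/

section RationalOrder

open DirichletCharacter

theorem hasOrd2_coe_iff {ι : Embedding2} {x : algebraicClosure ℚ ℂ} {r : ℝ} :
    HasOrd2 ι x r ↔ ‖ι x‖ = (2 : ℝ) ^ (-r) := by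
  have hord : ord2 ι x = -Real.logb 2 ‖ι x‖ := by
    rw [ord2, dif_pos x.2]
  constructor
  · rintro ⟨-, h0, h⟩
    have hx : x ≠ 0 := fun h => h0 (by rw [h]; rfl)
    rw [← h, hord, neg_neg, Real.rpow_logb two_pos (by norm_num)]
    exact norm_pos_iff.2 ((map_ne_zero ι).2 hx)
  · intro h
    refine ⟨mem_algebraicClosure_iff.1 x.2, fun h0 => ?_, ?_⟩
    · have hx : x = 0 := Subtype.ext h0
      rw [hx, map_zero, norm_zero] at h
      exact absurd h (Real.rpow_pos_of_pos two_pos _).ne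
    · rw [hord, h, Real.logb_rpow two_pos (by norm_num), neg_neg]

theorem ord2_coe (ι : Embedding2) (x : algebraicClosure ℚ ℂ) :
    ord2 ι x = -Real.logb 2 ‖ι x‖ := by
  rw [ord2, dif_pos x.2]

/-- `ord₂ B_m = -1` for even `m > 0`, by the theorem of von Staudt and Clausen. -/
theorem norm_bernoulli {m : ℕ} (hm : m ≠ 0) (hm2 : _root_.Even m) :
    ‖((bernoulli m : ℚ) : PadicAlgCl 2)‖ = 2 := by
  obtain ⟨k, hk⟩ := hm2
  rw [← two_mul] at hk
  subst hk
  obtain ⟨y, hy⟩ := Bernoulli.vonStaudt_clausen k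
  set s := (Finset.range (2 * k + 2)).filter (fun p => p.Prime ∧ p - 1 ∣ 2 * k) with hs
  have h2s : 2 ∈ s := by
    rw [hs, Finset.mem_filter, Finset.mem_range]
    exact ⟨by omega, Nat.prime_two, one_dvd _⟩
  have hB : ((bernoulli (2 * k) : ℚ) : PadicAlgCl 2) =
      ((y : PadicAlgCl 2) - ∑ p ∈ s.erase 2, 1 / (p : PadicAlgCl 2)) + (-(1 / 2)) := by
    have := congrArg (fun x : ℚ => (x : PadicAlgCl 2)) hy
    rw [← Finset.add_sum_erase _ _ h2s] at this
    push_cast at this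
    linear_combination -this
  have hsmall : ‖(y : PadicAlgCl 2) - ∑ p ∈ s.erase 2, 1 / (p : PadicAlgCl 2)‖ ≤ 1 := by
    refine norm_sub_le_of_le (IsUltrametricDist.norm_intCast_le_one _ y) ?_
    refine IsUltrametricDist.norm_sum_le_of_forall_le_of_nonneg zero_le_one fun p hp => ?_
    obtain ⟨hp2, hp⟩ := Finset.mem_erase.1 hp
    have hpp := (Finset.mem_filter.1 hp).2.1
    rw [norm_div, norm_one, norm_natCast_of_odd norm_two (hpp.odd_of_ne_two hp2), div_one]
  have hhalf : ‖(-(1 / 2) : PadicAlgCl 2)‖ = 2 := by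
    rw [norm_neg, norm_div, norm_one, norm_two]
    norm_num
  rw [hB, IsUltrametricDist.norm_add_eq_max_of_norm_ne_norm (by rw [hhalf]; linarith), hhalf,
    max_eq_right (by linarith)]

theorem algL_one_level_one (n : ℕ) (hn : _root_.Even n) :
    algL (1 : DirichletCharacter ℂ 1) (n + 2) =
      ((-(bernoulli (n + 2)) / (n + 2 : ℕ) : ℚ) : algebraicClosure ℚ ℂ) := by
  apply Subtype.ext
  rw [coe_algL, DirichletCharacter.LFunction_modOne_eq,
    show (1 : ℂ) - (n + 2 : ℕ) = -((n + 1 : ℕ) : ℂ) by push_cast; ring,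
    riemannZeta_neg_nat_eq_bernoulli, Odd.neg_one_pow hn.add_one]
  have : (((-(bernoulli (n + 2)) / (n + 2 : ℕ) : ℚ) : algebraicClosure ℚ ℂ) : ℂ) =
      ((-(bernoulli (n + 2)) / (n + 2 : ℕ) : ℚ) : ℂ) := map_ratCast (algebraMap (algebraicClosure ℚ ℂ) ℂ) _
  rw [this]
  push_cast
  ring

theorem norm_algL_one_level_one (ι : Embedding2) {n : ℕ} (hn : _root_.Even n) :
    ‖ι (algL (1 : DirichletCharacter ℂ 1) (n + 2))‖ = 2 / ‖((n + 2 : ℕ) : PadicAlgCl 2)‖ := by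
  rw [algL_one_level_one n hn, map_ratCast, Rat.cast_div, Rat.cast_neg, Rat.cast_natCast, norm_div,
    norm_neg, norm_bernoulli (by omega) (hn.add even_two)]

/-- The `L`-value at an imprimitive level, with its Euler factors. -/
theorem algL_changeLevel_eq_mul {M M' : ℕ} [NeZero M] [NeZero M'] (h : M ∣ M')
    (χ : DirichletCharacter ℂ M) (n : ℕ) :
    algL (changeLevel h χ) (n + 2) = algL χ (n + 2) *
      ∏ p ∈ M'.primeFactors, (1 - algChar χ p * (p : algebraicClosure ℚ ℂ) ^ (n + 1)) := by
  apply Subtype.ext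
  have : ((algL χ (n + 2) * ∏ p ∈ M'.primeFactors,
      (1 - algChar χ p * (p : algebraicClosure ℚ ℂ) ^ (n + 1)) : algebraicClosure ℚ ℂ) : ℂ) =
      (algL χ (n + 2) : ℂ) * ∏ p ∈ M'.primeFactors, (1 - χ p * (p : ℂ) ^ (n + 1)) := by
    push_cast
    rfl
  rw [this, coe_algL, coe_algL, LFunction_changeLevel h χ (Or.inr (one_sub_natCast_ne_one n))]
  simp_rw [cpow_neg_one_sub]

theorem norm_algL_one_two_pow (ι : Embedding2) {n : ℕ} (hn : _root_.Even n) (j : ℕ) :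
    ‖ι (algL (1 : DirichletCharacter ℂ (2 ^ (j + 2))) (n + 2))‖ =
      2 / ‖((n + 2 : ℕ) : PadicAlgCl 2)‖ := by
  have h1 : (1 : DirichletCharacter ℂ (2 ^ (j + 2))) = changeLevel (one_dvd _) 1 := by
    rw [map_one]
  rw [h1, algL_changeLevel_eq_mul, Nat.primeFactors_prime_pow (by omega) Nat.prime_two,
    Finset.prod_singleton, map_mul, norm_mul, norm_algL_one_level_one ι hn]
  have h3 : ι (1 - algChar (1 : DirichletCharacter ℂ 1) (2 : ℕ) *
      ((2 : ℕ) : algebraicClosure ℚ ℂ) ^ (n + 1)) = -((2 ^ (n + 1) - 1 : ℕ) : PadicAlgCl 2) := by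
    have : algChar (1 : DirichletCharacter ℂ 1) ((2 : ℕ) : ZMod 1) = 1 :=
      Subtype.ext (by rw [coe_algChar, Subsingleton.elim ((2 : ℕ) : ZMod 1) 1, map_one]; rfl)
    rw [this, one_mul, Nat.cast_sub Nat.one_le_two_pow, map_sub, map_pow, map_one, map_natCast]
    push_cast
    ring
  have hodd : _root_.Odd (2 ^ (n + 1) - 1) :=
    Nat.Even.sub_odd Nat.one_le_two_pow ((even_two).pow_of_ne_zero (by omega)) odd_one
  rw [h3, norm_neg, norm_natCast_of_odd norm_two hodd, mul_one]

theorem norm_one_sub_five_pow {m : ℕ} (hm : m ≠ 0) (hm2 : _root_.Even m) :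
    ‖1 - (5 : PadicAlgCl 2) ^ m‖ = 1 / 4 * ‖(m : PadicAlgCl 2)‖ := by
  have : Fact (Nat.Prime 2) := ⟨Nat.prime_two⟩
  have h1 := padicValNat.pow_two_sub_pow (x := 5) (y := 1) (by norm_num) (by norm_num) (by norm_num)
    hm hm2
  have e1 : padicValNat 2 (5 + 1) = 1 := by
    rw [show 5 + 1 = 2 * 3 by norm_num, padicValNat.mul (by norm_num) (by norm_num),
      padicValNat.self (by norm_num), padicValNat.eq_zero_of_not_dvd (by norm_num)]
  have e2 : padicValNat 2 (5 - 1) = 2 := by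
    rw [show 5 - 1 = 2 ^ 2 by norm_num, padicValNat.prime_pow]
  rw [e1, e2, one_pow] at h1
  have hpos : 1 < 5 ^ m := Nat.one_lt_pow hm (by norm_num)
  have h3 : (1 - (5 : PadicAlgCl 2) ^ m) = -((5 ^ m - 1 : ℕ) : PadicAlgCl 2) := by
    rw [Nat.cast_sub hpos.le]
    push_cast
    ring
  rw [h3, norm_neg, norm_natCast_eq norm_two (by omega), norm_natCast_eq norm_two hm,
    show padicValNat 2 (5 ^ m - 1) = 2 + padicValNat 2 m by omega, pow_add]
  norm_num

theorem IsPrimitiveRoot.algChar {M : ℕ} [NeZero M] {χ : DirichletCharacter ℂ M} {a : ZMod M} {k : ℕ}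
    (h : IsPrimitiveRoot (χ a) k) : IsPrimitiveRoot (algChar χ a) k :=
  IsPrimitiveRoot.of_map_of_injective (f := algebraMap (algebraicClosure ℚ ℂ) ℂ) h
    (algebraMap (algebraicClosure ℚ ℂ) ℂ).injective

theorem isPrimitiveRoot_adicChar (ι : Embedding2) {M : ℕ} [NeZero M] {χ : DirichletCharacter ℂ M}
    {a : ZMod M} {k : ℕ} (h : IsPrimitiveRoot (χ a) k) : IsPrimitiveRoot (adicChar ι χ a) k :=
  (IsPrimitiveRoot.algChar h).map_of_injective ι.injective

/-- The values of an even character modulo `2^(j+2)` are powers of its value at `5`. -/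
theorem exists_eq_five_pow {R : Type*} [CommRing R] {j : ℕ} {χ : DirichletCharacter R (2 ^ (j + 2))}
    (hχ : χ.Even) (u : (ZMod (2 ^ (j + 2)))ˣ) : ∃ i : ℕ, χ u = χ 5 ^ i := by
  obtain ⟨i, rfl | rfl⟩ := eq_or_eq_neg_unitFive_pow u
  · exact ⟨i, by rw [Units.val_pow_eq_pow_val, coe_unitFive, map_pow]⟩
  · exact ⟨i, by rw [Units.val_neg, Units.val_pow_eq_pow_val, coe_unitFive, hχ.eval_neg, map_pow]⟩

theorem adicChar_one_unit (ι : Embedding2) {M : ℕ} [NeZero M] (u : (ZMod M)ˣ) :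
    adicChar ι (1 : DirichletCharacter ℂ M) u = 1 := by
  have : algChar (1 : DirichletCharacter ℂ M) u = 1 := Subtype.ext (MulChar.one_apply_coe u)
  rw [adicChar_apply, this, map_one]

theorem even_one {R : Type*} [CommRing R] (M : ℕ) : (1 : DirichletCharacter R M).Even := by
  unfold DirichletCharacter.Even
  have := MulChar.one_apply_coe (R' := R) (-1 : (ZMod M)ˣ)
  rwa [Units.val_neg, Units.val_one] at this

/-- The `L`-value of a character of `ℚ_cyc` of level `j`, compared with the value of `ζ`: the
character is congruent to the trivial one modulo `χ(5) - 1`. -/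
theorem norm_algL_mul {ι : Embedding2} {n j : ℕ} (hn : _root_.Even n) (hj : 1 ≤ j)
    {χ : DirichletCharacter ℂ (2 ^ (j + 2))} (hχ : χ.Even) (hz : IsPrimitiveRoot (χ 5) (2 ^ j)) :
    ‖ι (algL χ (n + 2))‖ * ‖adicChar ι χ 5 - 1‖ = 1 / 2 := by
  set z := adicChar ι χ 5 with hzdef
  have hzp : IsPrimitiveRoot z (2 ^ j) := isPrimitiveRoot_adicChar ι hz
  have hz1 := norm_rootOfUnity (by positivity) hzp.pow_eq_one
  have hpos : 0 < ‖z - 1‖ :=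
    lt_of_lt_of_le (by norm_num) (one_half_le_norm_sub_one norm_two hj hzp)
  have hlt : ‖z - 1‖ < 1 := by
    rw [norm_sub_one norm_two hj hzp]
    exact Real.rpow_lt_one_of_one_lt_of_neg one_lt_two (neg_lt_zero.2 (by positivity))
  have hc : Nat.Coprime 5 (2 ^ (j + 2)) := Nat.Coprime.pow_right _ (by norm_num)
  have hclose : ∀ a, ‖adicChar ι χ a - adicChar ι (1 : DirichletCharacter ℂ (2 ^ (j + 2))) a‖ ≤
      ‖z - 1‖ := by
    intro a
    by_cases ha : IsUnit a
    · obtain ⟨u, rfl⟩ := ha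
      obtain ⟨i, hi⟩ := exists_eq_five_pow (even_adicChar ι hχ) u
      rw [hi, adicChar_one_unit]
      exact norm_pow_sub_one_le hz1.le i
    · rw [MulChar.map_nonunit _ ha, MulChar.map_nonunit _ ha, sub_self, norm_zero]
      exact norm_nonneg _
  have h := norm_algL_sub_le ι (four_dvd_two_pow j) hχ (even_one _) hpos hclose hn hc
  have h5 : adicChar ι (1 : DirichletCharacter ℂ (2 ^ (j + 2))) ((5 : ℕ) : ZMod (2 ^ (j + 2))) = 1 := by
    have := adicChar_one_unit ι (ZMod.unitOfCoprime 5 hc)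
    rwa [ZMod.coe_unitOfCoprime] at this
  have hm2 : _root_.Even (n + 2) := hn.add even_two
  have hmn : ‖((n + 2 : ℕ) : PadicAlgCl 2)‖ ≠ 0 :=
    norm_ne_zero_iff.2 (Nat.cast_ne_zero.2 (by omega))
  rw [h5, one_mul, Nat.cast_ofNat, Nat.cast_ofNat, ← hzdef] at h
  set y := (1 - (5 : PadicAlgCl 2) ^ (n + 2)) *
    ι (algL (1 : DirichletCharacter ℂ (2 ^ (j + 2))) (n + 2)) with hy
  have hynorm : ‖y‖ = 1 / 2 := by
    rw [hy, norm_mul, norm_one_sub_five_pow (by omega) hm2, norm_algL_one_two_pow ι hn]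
    field_simp
    norm_num
  have hx : ‖(1 - z * (5 : PadicAlgCl 2) ^ (n + 2)) * ι (algL χ (n + 2))‖ = 1 / 2 := by
    have hlt2 : ‖(1 - z * (5 : PadicAlgCl 2) ^ (n + 2)) * ι (algL χ (n + 2)) - y‖ < ‖y‖ := by
      rw [hynorm]
      linarith
    rw [← hynorm, ← sub_add_cancel ((1 - z * (5 : PadicAlgCl 2) ^ (n + 2)) * ι (algL χ (n + 2))) y,
      IsUltrametricDist.norm_add_eq_max_of_norm_ne_norm hlt2.ne, max_eq_right hlt2.le]
  have h5m : ‖(5 : PadicAlgCl 2) ^ (n + 2) - 1‖ ≤ 1 / 4 := by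
    rw [norm_sub_rev, norm_one_sub_five_pow (by omega) hm2]
    have := IsUltrametricDist.norm_natCast_le_one (PadicAlgCl 2) (n + 2)
    linarith
  rw [norm_mul, norm_one_sub_mul norm_two hj hzp h5m] at hx
  rw [mul_comm]
  exact hx

theorem norm_algL {ι : Embedding2} {n j : ℕ} (hn : _root_.Even n) (hj : 1 ≤ j)
    {χ : DirichletCharacter ℂ (2 ^ (j + 2))} (hχ : χ.Even) (hz : IsPrimitiveRoot (χ 5) (2 ^ j)) :
    ‖ι (algL χ (n + 2))‖ = (2 : ℝ) ^ (-(1 - (2 : ℝ) ^ (1 - (j : ℤ)))) := by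
  have h := norm_algL_mul (ι := ι) hn hj hχ hz
  rw [norm_sub_one norm_two hj (isPrimitiveRoot_adicChar ι hz)] at h
  rw [neg_sub, Real.rpow_sub two_pos, Real.rpow_one]
  rw [Real.rpow_neg zero_le_two] at h
  have h0 : (2 : ℝ) ^ ((2 : ℝ) ^ (1 - (j : ℤ))) ≠ 0 := (Real.rpow_pos_of_pos two_pos _).ne'
  field_simp at h ⊢
  linarith

/-- A prime `p` divides the conductor if the character is non-trivial on the units that are `1`
modulo the prime-to-`p` part of the level. -/
theorem dvd_conductor_of_apply_ne_one {M M' p e a : ℕ} [NeZero M] (hp : p.Prime) (hM : M = p ^ e * M')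
    (χ : DirichletCharacter ℂ M) (ha : a.Coprime M) (ha1 : a ≡ 1 [MOD M']) (h : χ a ≠ 1) :
    p ∣ χ.conductor := by
  by_contra hpc
  apply h
  have hcop : (χ.conductor).Coprime (p ^ e) :=
    Nat.Coprime.pow_right _ ((Nat.Prime.coprime_iff_not_dvd hp).2 hpc).symm
  have hdvd : χ.conductor ∣ M' := hcop.dvd_of_dvd_mul_left (hM ▸ χ.conductor_dvd_level)
  have h1 := primitiveCharacter_apply_of_isCoprime χ (a := a) (Nat.isCoprime_iff_coprime.2 ha)
  rw [Int.cast_natCast, Int.cast_natCast] at h1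
  rw [← h1, (ZMod.natCast_eq_natCast_iff _ _ _).2 (ha1.of_dvd hdvd), Nat.cast_one, map_one]

/-- If all primes dividing the level divide the conductor, there are no extra Euler factors. -/
theorem primLFunction_eq_algL {M : ℕ} [NeZero M] (χ : DirichletCharacter ℂ M)
    (h : ∀ p : ℕ, p.Prime → p ∣ M → p ∣ χ.conductor) (n : ℕ) :
    primLFunction χ (1 - (n + 2 : ℕ)) = algL χ (n + 2) := by
  have : NeZero χ.conductor := ⟨conductor_ne_zero _⟩
  have h1 := algL_changeLevel χ.conductor_dvd_level h χ.primitiveCharacter n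
  rw [changeLevel_primitiveCharacter] at h1
  rw [h1, coe_algL]
  rfl

theorem primLFunction_eq_algL_of_isPrimitiveRoot {j : ℕ} (hj : 1 ≤ j)
    {χ : DirichletCharacter ℂ (2 ^ (j + 2))} (hz : IsPrimitiveRoot (χ 5) (2 ^ j)) (n : ℕ) :
    primLFunction χ (1 - (n + 2 : ℕ)) = algL χ (n + 2) := by
  refine primLFunction_eq_algL χ (fun p hp hpM => ?_) n
  obtain rfl := (Nat.prime_dvd_prime_iff_eq hp Nat.prime_two).1 (hp.dvd_of_dvd_pow hpM)
  refine dvd_conductor_of_apply_ne_one (a := 5) (M' := 1) (e := j + 2) hp (mul_one _).symm χ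
    (Nat.Coprime.pow_right _ (by norm_num)) (Nat.modEq_one) ?_
  exact hz.ne_one (Nat.one_lt_two_pow (by omega))

/-- `ord₂ L(χ, 1 - m) = 1 - 2^(1-j)` for the characters of level `j ≥ 1` of `ℚ_cyc`. -/
theorem hasOrd2_primLFunction (ι : Embedding2) {n j : ℕ} (hn : _root_.Even n) (hj : 1 ≤ j)
    {χ : DirichletCharacter ℂ (2 ^ (j + 2))} (hχ : χ.Even) (hz : IsPrimitiveRoot (χ 5) (2 ^ j)) :
    HasOrd2 ι (primLFunction χ (1 - (n + 2 : ℕ))) (1 - (2 : ℝ) ^ (1 - (j : ℤ))) := by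
  rw [primLFunction_eq_algL_of_isPrimitiveRoot hj hz, hasOrd2_coe_iff]
  exact norm_algL hn hj hχ hz

theorem hasOrd2_primLFunction_one (ι : Embedding2) {n : ℕ} (hn : _root_.Even n) {M : ℕ} [NeZero M] :
    HasOrd2 ι (primLFunction (1 : DirichletCharacter ℂ M) (1 - (n + 2 : ℕ)))
      (-1 - padicValNat 2 (n + 2)) := by
  have h1 : (1 : DirichletCharacter ℂ M) = changeLevel (one_dvd _) 1 := by rw [map_one]
  rw [h1, primLFunction_changeLevel, primLFunction_eq_algL, hasOrd2_coe_iff,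
    norm_algL_one_level_one ι hn, norm_natCast_eq norm_two (by omega)]
  · rw [neg_sub, sub_neg_eq_add, Real.rpow_add two_pos, Real.rpow_one, Real.rpow_natCast,
      one_div, inv_pow, div_inv_eq_mul, mul_comm]
  · intro p hp h
    exact absurd (Nat.dvd_one.1 h) hp.one_lt.ne'

end RationalOrder

/-! ### The order of the twisted `L`-values for large level -/

section TwistedOrder

open DirichletCharacter

theorem orderOf_one_add {f i k : ℕ} (h : k + 2 = i + (f + 2)) {u : ℤ} (hu : _root_.Odd u) :
    orderOf (1 + 2 ^ (f + 2) * u : ZMod (2 ^ (k + 2))) = 2 ^ i := by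
  rw [h]
  exact ZMod.orderOf_one_add_mul_prime_pow Nat.prime_two (f + 2) (by omega) (by omega) u
    (fun h2 => by
      have := Int.odd_iff.1 hu
      push_cast at h2
      omega) i

/-- The value of a character of exact level `j` at `1 + 2^(f+2) u`, `u` odd. -/
theorem isPrimitiveRoot_apply_one_add {f j : ℕ} (hf : f ≤ j) {χ : DirichletCharacter ℂ (2 ^ (j + 2))}
    (hz : IsPrimitiveRoot (χ 5) (2 ^ j)) {u : ℤ} (hu : _root_.Odd u) {x : ℤ}
    (hx : x = 1 + 2 ^ (f + 2) * u) : IsPrimitiveRoot (χ x) (2 ^ (j - f)) := by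
  have ho : orderOf (x : ZMod (2 ^ (j + 2))) = 2 ^ (j - f) := by
    rw [← orderOf_one_add (f := f) (i := j - f) (k := j) (by omega) hu, hx]
    push_cast
    rfl
  have hunit : IsUnit (x : ZMod (2 ^ (j + 2))) :=
    (orderOf_pos_iff.1 (by rw [ho]; positivity)).isUnit
  obtain ⟨v, hv⟩ := hunit
  obtain ⟨i, hi⟩ := eq_or_eq_neg_unitFive_pow v
  have hpow : v = unitFive j ^ i := by
    rcases hi with hi | hi
    · exact hi
    -- `v` is `1` modulo `4`
    · exfalso
      have h4 := congrArg (fun u : (ZMod (2 ^ (j + 2)))ˣ =>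
        ZMod.castHom (four_dvd_two_pow j) (ZMod 4) u) hi
      simp only [Units.val_neg, Units.val_pow_eq_pow_val, coe_unitFive, map_pow, map_neg] at h4
      rw [map_ofNat, show (OfNat.ofNat 5 : ZMod 4) = 1 from by decide, one_pow, hv, map_intCast, hx,
        pow_add] at h4
      push_cast at h4
      rw [show (2 : ZMod 4) ^ f * 4 = 2 ^ f * 0 from congrArg _ (by decide), mul_zero, zero_mul, add_zero] at h4
      exact absurd h4 (by decide)
  have hx5 : (x : ZMod (2 ^ (j + 2))) = 5 ^ i := by
    rw [← hv, hpow, Units.val_pow_eq_pow_val, coe_unitFive]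
  have ho5 : orderOf (5 : ZMod (2 ^ (j + 2))) = 2 ^ j := ZMod.orderOf_five j
  have hfin5 : IsOfFinOrder (5 : ZMod (2 ^ (j + 2))) :=
    orderOf_pos_iff.1 (by rw [ho5]; positivity)
  have hfinz : IsOfFinOrder (χ 5) := orderOf_pos_iff.1 (by rw [← hz.eq_orderOf]; positivity)
  rw [IsPrimitiveRoot.iff_orderOf, hx5, map_pow, hfinz.orderOf_pow, ← hz.eq_orderOf, ← ho, hx5,
    hfin5.orderOf_pow, ho5]

theorem pStar_eq_or {p : ℕ} (hp : _root_.Odd p) : pStar p = p ∨ pStar p = -p := by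
  rw [pStar, jacobiSym.at_neg_one hp]
  rcases odd_mod_four hp with h | h
  · left
    rw [ZMod.χ₄_nat_one_mod_four h, one_mul]
  · right
    rw [ZMod.χ₄_nat_three_mod_four h, neg_one_mul]

theorem exists_pStar_eq {p : ℕ} (hp : _root_.Odd p) (hp1 : 1 < p) :
    ∃ u : ℤ, _root_.Odd u ∧ pStar p = 1 + 2 ^ (fp p + 2) * u := by
  have : Fact (Nat.Prime 2) := ⟨Nat.prime_two⟩
  have h4 : (4 : ℤ) ∣ pStar p - 1 := by
    rw [pStar, jacobiSym.at_neg_one hp]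
    rcases odd_mod_four hp with h | h
    · rw [ZMod.χ₄_nat_one_mod_four h]
      omega
    · rw [ZMod.χ₄_nat_three_mod_four h]
      omega
  obtain ⟨y, hy⟩ := h4
  have hdiv : (pStar p - 1) / 4 = y := by
    rw [hy]
    exact Int.mul_ediv_cancel_left _ (by norm_num)
  have hy0 : y ≠ 0 := by
    rintro rfl
    rcases pStar_eq_or hp with h | h <;> omega
  have hf : fp p = padicValInt 2 y := by rw [fp, hdiv]
  obtain ⟨u, hu⟩ : (2 : ℤ) ^ fp p ∣ y := by
    rw [hf]
    exact_mod_cast padicValInt_dvd (p := 2) y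
  refine ⟨u, ?_, ?_⟩
  · rw [← Int.not_even_iff_odd, even_iff_two_dvd]
    rintro ⟨w, rfl⟩
    have h3 : (2 : ℤ) ^ (fp p + 1) ∣ y := ⟨w, by rw [hu]; ring⟩
    have h3' : ((2 : ℕ) : ℤ) ^ (fp p + 1) ∣ y := by exact_mod_cast h3
    rw [padicValInt_dvd_iff, or_iff_right hy0, hf] at h3'
    omega
  · rw [eq_add_of_sub_eq' hy, hu]
    ring

theorem IsPrimitiveRoot.neg_two_pow {R : Type*} [CommRing R] [IsDomain R] {v : R} {i : ℕ}
    (hi : 2 ≤ i) (hv : IsPrimitiveRoot v (2 ^ i)) : IsPrimitiveRoot (-v) (2 ^ i) := by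
  have h1 : v ^ 2 ^ (i - 1) = -1 := by
    have : IsPrimitiveRoot (v ^ 2 ^ (i - 1)) 2 :=
      hv.pow (by positivity) (by rw [← pow_succ, Nat.sub_add_cancel (by omega)])
    exact this.eq_neg_one_of_two_right
  have h2 : -v = v ^ (2 ^ (i - 1) + 1) := by rw [pow_succ, h1, neg_one_mul]
  rw [h2]
  refine hv.pow_of_coprime _ (Nat.Coprime.pow_right _ (Nat.coprime_two_right.2 ?_))
  exact ((even_two).pow_of_ne_zero (by omega)).add_one

theorem norm_pow_sub_one_le_quarter {x : ℤ} (hx : (4 : ℤ) ∣ x - 1) (i : ℕ) :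
    ‖((x : PadicAlgCl 2)) ^ i - 1‖ ≤ 1 / 4 := by
  have h : ((x : PadicAlgCl 2)) ^ i - 1 = ((x ^ i - 1 : ℤ) : PadicAlgCl 2) := by push_cast; ring
  rw [h]
  refine norm_intCast_le_quarter norm_two (hx.trans ?_)
  have := sub_dvd_pow_sub_pow x 1 i
  rwa [one_pow] at this

/-- The Euler factor at an odd prime `p`. -/
theorem norm_euler_factor (ι : Embedding2) {j p : ℕ} (hp : _root_.Odd p) (hp1 : 1 < p)
    (hj : fp p + 2 ≤ j) {χ : DirichletCharacter ℂ (2 ^ (j + 2))} (hχ : χ.Even)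
    (hz : IsPrimitiveRoot (χ 5) (2 ^ j)) {n : ℕ} (hn : _root_.Even n) :
    ‖1 - adicChar ι χ p * (p : PadicAlgCl 2) ^ (n + 1)‖ =
      (2 : ℝ) ^ (-((2 : ℝ) ^ (1 - (j : ℤ)) * 2 ^ fp p)) := by
  obtain ⟨u, hu, hpu⟩ := exists_pStar_eq hp hp1
  have hprim := isPrimitiveRoot_apply_one_add (by omega) hz hu hpu
  have h4 : (4 : ℤ) ∣ pStar p - 1 := ⟨2 ^ fp p * u, by rw [hpu]; ring⟩
  have hχp : IsPrimitiveRoot (χ p) (2 ^ (j - fp p)) := by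
    rcases pStar_eq_or hp with h | h
    · rwa [h, Int.cast_natCast] at hprim
    · rwa [h, Int.cast_neg, Int.cast_natCast, hχ.eval_neg] at hprim
  have hv := isPrimitiveRoot_adicChar ι hχp
  have hexp : (2 : ℝ) ^ (1 - ((j - fp p : ℕ) : ℤ)) = (2 : ℝ) ^ (1 - (j : ℤ)) * 2 ^ fp p := by
    rw [← zpow_natCast (2 : ℝ) (fp p), ← zpow_add₀ two_ne_zero]
    congr 1
    omega
  rw [← hexp]
  rcases pStar_eq_or hp with h | h
  · have h1 := norm_pow_sub_one_le_quarter h4 (n + 1)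
    rw [h, Int.cast_natCast] at h1
    rw [norm_one_sub_mul norm_two (by omega) hv h1, norm_sub_one norm_two (by omega) hv]
  · have h1 := norm_pow_sub_one_le_quarter h4 (n + 1)
    rw [h, Int.cast_neg, Int.cast_natCast, Odd.neg_pow hn.add_one] at h1
    have hv' := IsPrimitiveRoot.neg_two_pow (by omega) hv
    rw [show 1 - adicChar ι χ p * (p : PadicAlgCl 2) ^ (n + 1) =
      1 - -adicChar ι χ p * -(p : PadicAlgCl 2) ^ (n + 1) by ring,
      norm_one_sub_mul norm_two (by omega) hv' h1, norm_sub_one norm_two (by omega) hv']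

theorem algChar_mul {M : ℕ} [NeZero M] (χ ψ : DirichletCharacter ℂ M) :
    algChar (χ * ψ) = algChar χ * algChar ψ := by
  ext u
  rfl

theorem adicChar_mul_apply (ι : Embedding2) {M : ℕ} [NeZero M] (χ ψ : DirichletCharacter ℂ M)
    (a : ZMod M) : adicChar ι (χ * ψ) a = adicChar ι χ a * adicChar ι ψ a := by
  rw [adicChar_apply, algChar_mul, MulChar.mul_apply, map_mul, adicChar_apply, adicChar_apply]

variable {d : ℕ} [NeZero d]

omit [NeZero d] in
theorem even_liftTwo {k : ℕ} {χ : DirichletCharacter ℂ (2 ^ (k + 2))} (hχ : χ.Even) :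
    (liftTwo χ d).Even :=
  even_changeLevel _ hχ

theorem even_liftTwo_mul_liftQuad (hd : _root_.Odd d) {k : ℕ}
    {χ : DirichletCharacter ℂ (2 ^ (k + 2))} (hχ : χ.Even) : (liftTwo χ d * liftQuad k d).Even := by
  have h1 := even_liftTwo (d := d) hχ
  have h2 : (liftQuad k d).Even := even_changeLevel _ (even_quadChar hd)
  unfold DirichletCharacter.Even at *
  rw [MulChar.mul_apply, h1, h2, one_mul]

theorem adicChar_liftTwo_natCast (ι : Embedding2) {k : ℕ} (χ : DirichletCharacter ℂ (2 ^ (k + 2)))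
    {a : ℕ} (ha : a.Coprime (2 ^ (k + 2) * d)) : adicChar ι (liftTwo χ d) a = adicChar ι χ a := by
  rw [adicChar_apply, adicChar_apply]
  congr 1
  exact Subtype.ext (liftTwo_apply χ ha)

theorem adicChar_liftQuad_natCast (ι : Embedding2) {k : ℕ} {a : ℕ}
    (ha : a.Coprime (2 ^ (k + 2) * d)) :
    adicChar ι (liftQuad k d) a = (jacobiSym d a : ℤ) := by
  have h : algChar (liftQuad k d) a = ((jacobiSym d a : ℤ) : algebraicClosure ℚ ℂ) := by
    apply Subtype.ext
    rw [coe_algChar, liftQuad_apply ha]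
    exact (map_intCast (algebraMap (algebraicClosure ℚ ℂ) ℂ) _).symm
  rw [adicChar_apply, h, map_intCast]

/-- Twisting by the quadratic character is a congruence modulo `2`. -/
theorem norm_adicChar_twist_sub_le (ι : Embedding2) {k : ℕ} (χ : DirichletCharacter ℂ (2 ^ (k + 2)))
    (a : ZMod (2 ^ (k + 2) * d)) :
    ‖adicChar ι (liftTwo χ d * liftQuad k d) a - adicChar ι (liftTwo χ d) a‖ ≤ 1 / 2 := by
  by_cases ha : IsUnit a
  · obtain ⟨u, rfl⟩ := ha
    have hc := ZMod.val_coe_unit_coprime u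
    have hq : adicChar ι (liftQuad k d) u = (jacobiSym d (u : ZMod (2 ^ (k + 2) * d)).val : ℤ) := by
      have := adicChar_liftQuad_natCast ι hc
      rwa [ZMod.natCast_zmod_val] at this
    have hJ := jacobiSym.eq_one_or_neg_one (a := d) (b := (u : ZMod (2 ^ (k + 2) * d)).val)
      (hc.of_dvd_right (Dvd.intro_left _ rfl)).symm
    rw [adicChar_mul_apply, hq, ← mul_sub_one, norm_mul]
    refine (mul_le_of_le_one_left (norm_nonneg _) (norm_adicChar_le_one ι _ _)).trans ?_
    rcases hJ with hJ | hJ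
    · rw [hJ, Int.cast_one, sub_self, norm_zero]
      norm_num
    · rw [hJ, Int.cast_neg, Int.cast_one, show (-1 - 1 : PadicAlgCl 2) = -2 by ring, norm_neg,
        norm_two]
  · rw [MulChar.map_nonunit _ ha, MulChar.map_nonunit _ ha, sub_self, norm_zero]
    norm_num

variable (hd : _root_.Odd d)
include hd

/-- Making `χ` imprimitive at the primes dividing `d` multiplies the value by Euler factors. -/
theorem norm_algL_liftTwo (ι : Embedding2) {j : ℕ} (hj : 1 ≤ j)
    (hjp : ∀ p ∈ d.primeFactors, fp p + 2 ≤ j) {χ : DirichletCharacter ℂ (2 ^ (j + 2))}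
    (hχ : χ.Even) (hz : IsPrimitiveRoot (χ 5) (2 ^ j)) {n : ℕ} (hn : _root_.Even n) :
    ‖ι (algL (liftTwo χ d) (n + 2))‖ =
      (2 : ℝ) ^ (-(1 + (2 : ℝ) ^ (1 - (j : ℤ)) * (-1 + sumFp d))) := by
  have hcop : (2 ^ (j + 2)).Coprime d := Nat.Coprime.pow_left _ (Nat.coprime_two_left.2 hd)
  have h2 : adicChar ι χ (2 : ℕ) = 0 := by
    refine MulChar.map_nonunit _ fun h => ?_
    rw [ZMod.isUnit_iff_coprime, Nat.coprime_pow_right_iff (by omega)] at h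
    norm_num at h
  have hprod : ∏ p ∈ d.primeFactors, ‖1 - adicChar ι χ p * (p : PadicAlgCl 2) ^ (n + 1)‖ =
      (2 : ℝ) ^ (-((2 : ℝ) ^ (1 - (j : ℤ)) * sumFp d)) := by
    rw [sumFp, Finset.mul_sum, ← Finset.sum_neg_distrib, Real.rpow_sum_of_pos two_pos]
    refine Finset.prod_congr rfl fun p hp => ?_
    have hpp := Nat.prime_of_mem_primeFactors hp
    exact norm_euler_factor ι (hd.of_dvd_nat (Nat.dvd_of_mem_primeFactors hp)) hpp.one_lt
      (hjp p hp) hχ hz hn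
  rw [liftTwo, algL_changeLevel_eq_mul, map_mul, norm_mul, norm_algL hn hj hχ hz,
    Nat.Coprime.primeFactors_mul hcop, Nat.primeFactors_prime_pow (by omega) Nat.prime_two,
    Finset.prod_union, Finset.prod_singleton, map_mul, norm_mul, map_prod, norm_prod]
  · have e1 : ι (1 - algChar χ ((2 : ℕ) : ZMod (2 ^ (j + 2))) *
        ((2 : ℕ) : algebraicClosure ℚ ℂ) ^ (n + 1)) = 1 := by
      rw [map_sub, map_mul, map_one, ← adicChar_apply, h2, zero_mul, sub_zero]
    have e2 : ∀ p : ℕ, ι (1 - algChar χ (p : ZMod (2 ^ (j + 2))) *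
        (p : algebraicClosure ℚ ℂ) ^ (n + 1)) =
        1 - adicChar ι χ p * (p : PadicAlgCl 2) ^ (n + 1) := fun p => by
      rw [map_sub, map_mul, map_one, map_pow, map_natCast ι, ← adicChar_apply]
    rw [e1, norm_one, one_mul]
    simp_rw [e2]
    rw [hprod, ← Real.rpow_add two_pos]
    congr 1
    ring
  · rw [Finset.disjoint_singleton_left]
    intro h
    exact absurd (hd.of_dvd_nat (Nat.dvd_of_mem_primeFactors h)) (by decide)

/-- For large `j` the value for `χ ψ_d` has the same order as the value for `χ` made imprimitive at
the primes dividing `d`. -/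
theorem norm_algL_twist (ι : Embedding2) {j : ℕ} (hj : 1 ≤ j)
    (hjp : ∀ p ∈ d.primeFactors, fp p + 2 ≤ j) (hjS : (2 : ℝ) ^ (1 - (j : ℤ)) * sumFp d < 1)
    {χ : DirichletCharacter ℂ (2 ^ (j + 2))} (hχ : χ.Even) (hz : IsPrimitiveRoot (χ 5) (2 ^ j))
    {n : ℕ} (hn : _root_.Even n) :
    ‖ι (algL (liftTwo χ d * liftQuad j d) (n + 2))‖ =
      (2 : ℝ) ^ (-(1 + (2 : ℝ) ^ (1 - (j : ℤ)) * (-1 + sumFp d))) := by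
  have hlift := norm_algL_liftTwo hd ι hj hjp hχ hz hn
  -- for this `c`, `ψ_d(c) = 1` and `χ(c)` is a primitive `2^j`-th root of unity
  set c := 1 + 4 * d with hc
  have hcN : c.Coprime (2 ^ (j + 2) * d) := by
    refine Nat.Coprime.mul_right (Nat.Coprime.pow_right _ (Nat.coprime_two_right.2 ?_)) ?_
    · exact ⟨2 * d, by omega⟩
    · rw [hc]
      exact (Nat.coprime_add_mul_right_left 1 d 4).2 (Nat.coprime_one_left d)
  have hcodd : _root_.Odd c := ⟨2 * d, by omega⟩
  have hc4 : c % 4 = 1 := by omega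
  have hψc : jacobiSym d c = 1 := by
    rw [← jacobiSym.quadratic_reciprocity_one_mod_four hc4 hd, jacobiSym.mod_left' (a₂ := 1),
      jacobiSym.one_left]
    rw [hc]
    push_cast
    exact Int.add_mul_emod_self_right 1 4 d
  have hw : IsPrimitiveRoot (adicChar ι χ c) (2 ^ j) := by
    have := isPrimitiveRoot_apply_one_add (f := 0) (Nat.zero_le j) hz
      (u := d) (by exact_mod_cast hd) (x := c) (by rw [hc]; push_cast; ring)
    rw [Int.cast_natCast] at this
    exact isPrimitiveRoot_adicChar ι this
  have hc1 : ‖(c : PadicAlgCl 2) ^ (n + 2) - 1‖ ≤ 1 / 4 := by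
    have := norm_pow_sub_one_le_quarter (x := c) ⟨d, by rw [hc]; push_cast; ring⟩ (n + 2)
    rwa [Int.cast_natCast] at this
  have h := norm_algL_sub_le ι ((four_dvd_two_pow j).trans (two_pow_dvd_level j d))
    (even_liftTwo_mul_liftQuad hd hχ) (even_liftTwo hχ) (by norm_num : (0 : ℝ) < 1 / 2)
    (norm_adicChar_twist_sub_le ι χ) hn hcN
  rw [adicChar_mul_apply, adicChar_liftQuad_natCast ι hcN, hψc, Int.cast_one, mul_one,
    adicChar_liftTwo_natCast ι χ hcN, ← mul_sub, norm_mul, norm_one_sub_mul norm_two hj hw hc1,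
    norm_sub_one norm_two hj hw] at h
  set t := (2 : ℝ) ^ (1 - (j : ℤ)) with ht
  have hlt : ‖ι (algL (liftTwo χ d * liftQuad j d) (n + 2)) - ι (algL (liftTwo χ d) (n + 2))‖ <
      ‖ι (algL (liftTwo χ d) (n + 2))‖ := by
    rw [hlift]
    have h1 : ‖ι (algL (liftTwo χ d * liftQuad j d) (n + 2)) - ι (algL (liftTwo χ d) (n + 2))‖ ≤
        (2 : ℝ) ^ (-(2 - t)) := by
      have e : (2 : ℝ) ^ (-(2 - t)) = 1 / 2 / 2 * (2 : ℝ) ^ t := by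
        rw [neg_sub, Real.rpow_sub two_pos, Real.rpow_two]
        ring
      rw [e]
      rw [Real.rpow_neg zero_le_two] at h
      have hpos : 0 < (2 : ℝ) ^ t := Real.rpow_pos_of_pos two_pos _
      rw [inv_mul_le_iff₀ hpos] at h
      linarith
    refine h1.trans_lt (Real.rpow_lt_rpow_of_exponent_lt one_lt_two ?_)
    linarith
  rw [← hlift, ← sub_add_cancel (ι (algL (liftTwo χ d * liftQuad j d) (n + 2)))
      (ι (algL (liftTwo χ d) (n + 2))),
    IsUltrametricDist.norm_add_eq_max_of_norm_ne_norm hlt.ne, max_eq_right hlt.le]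

variable (hsq : Squarefree d)
include hsq

/-- All primes dividing the level `2^(j+2) d` ramify in `χ ψ_d` if `χ` is not trivial. -/
theorem dvd_conductor_twist {j : ℕ} {χ : DirichletCharacter ℂ (2 ^ (j + 2))} (h5 : χ 5 ≠ 1) (p : ℕ)
    (hp : p.Prime) (hpN : p ∣ 2 ^ (j + 2) * d) :
    p ∣ (liftTwo χ d * liftQuad j d).conductor := by
  have hcop : (2 ^ (j + 2)).Coprime d := Nat.Coprime.pow_left _ (Nat.coprime_two_left.2 hd)
  rcases hp.dvd_mul.1 hpN with h | h
  · obtain rfl := (Nat.prime_dvd_prime_iff_eq hp Nat.prime_two).1 (hp.dvd_of_dvd_pow h)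
    obtain ⟨a, ha1, ha2⟩ := Nat.chineseRemainder hcop 5 1
    have haN : a.Coprime (2 ^ (j + 2) * d) := by
      refine Nat.Coprime.mul_right ?_ ?_
      · rw [Nat.Coprime, ha1.gcd_eq]
        exact Nat.Coprime.pow_right _ (by norm_num)
      · rw [Nat.Coprime, ha2.gcd_eq, Nat.gcd_one_left]
    refine dvd_conductor_of_apply_ne_one hp rfl _ haN ha2 ?_
    have ha4 : a % 4 = 1 := ha1.of_dvd (four_dvd_two_pow j)
    have hJ : jacobiSym d a = 1 := by
      rw [← jacobiSym.quadratic_reciprocity_one_mod_four ha4 hd, jacobiSym.mod_left' (a₂ := 1),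
        jacobiSym.one_left]
      exact_mod_cast ha2
    rw [MulChar.mul_apply, liftTwo_apply χ haN, liftQuad_apply haN, hJ, Int.cast_one, mul_one,
      (ZMod.natCast_eq_natCast_iff _ _ _).2 ha1]
    exact_mod_cast h5
  · obtain ⟨a, ha, ha1, ha2, ha3⟩ := exists_liftTwo_mul_liftQuad_eq_neg_one hd hsq hp h j
    refine dvd_conductor_of_apply_ne_one (e := 1) (M' := 2 ^ (j + 2) * (d / p)) hp ?_ _ ha ha1 ?_
    · rw [pow_one, mul_left_comm, Nat.mul_div_cancel' h]
    · rw [MulChar.mul_apply, ha2, ha3]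
      norm_num

theorem twistedL_eq_algL {j : ℕ} {χ : DirichletCharacter ℂ (2 ^ (j + 2))} (h5 : χ 5 ≠ 1) (n : ℕ) :
    twistedL χ d (1 - (n + 2 : ℕ)) = algL (liftTwo χ d * liftQuad j d) (n + 2) := by
  rw [twistedL_eq, primLFunction_eq_algL _ (dvd_conductor_twist hd hsq h5)]

end TwistedOrder

theorem explicitBound_spec {d : ℕ} (hd1 : 1 < d) {j : ℕ} (hj : explicitBound d ≤ j) :
    1 ≤ j ∧ (∀ p ∈ d.primeFactors, fp p + 2 ≤ j) ∧ (2 : ℝ) ^ (1 - (j : ℤ)) * sumFp d < 1 := by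
  have h := Nat.ceil_le.1 hj
  set f := d.primeFactors.sup fp with hf
  set τ := d.primeFactors.card with hτ
  have hτ1 : 1 ≤ τ := Finset.card_pos.2 (Nat.nonempty_primeFactors.2 hd1)
  have hτ1' : (1 : ℝ) ≤ τ := by exact_mod_cast hτ1
  have hlog : 0 ≤ Real.logb 2 τ := Real.logb_nonneg one_lt_two hτ1'
  have hfj : f + 2 ≤ j := by
    have : ((f + 2 : ℕ) : ℝ) ≤ j := by push_cast; linarith
    exact_mod_cast this
  refine ⟨by omega, fun p hp => le_trans (Nat.add_le_add_right (Finset.le_sup hp) 2) hfj, ?_⟩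
  have hS : sumFp d ≤ τ * 2 ^ f := by
    rw [sumFp, hτ, ← nsmul_eq_mul]
    exact Finset.sum_le_card_nsmul _ _ _ fun p hp =>
      pow_le_pow_right₀ one_le_two (Finset.le_sup hp)
  have hτf : (τ : ℝ) * 2 ^ f ≤ (2 : ℝ) ^ ((j : ℝ) - 2) := by
    calc (τ : ℝ) * 2 ^ f = (2 : ℝ) ^ (Real.logb 2 τ + f) := by
          rw [Real.rpow_add two_pos, Real.rpow_logb two_pos (by norm_num) (by linarith),
            Real.rpow_natCast]
      _ ≤ _ := Real.rpow_le_rpow_of_exponent_le one_le_two (by linarith)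
  have hz : (2 : ℝ) ^ (1 - (j : ℤ)) = (2 : ℝ) ^ (1 - (j : ℝ)) := by
    rw [← Real.rpow_intCast]
    push_cast
    rfl
  calc (2 : ℝ) ^ (1 - (j : ℤ)) * sumFp d ≤ (2 : ℝ) ^ (1 - (j : ℤ)) * (2 : ℝ) ^ ((j : ℝ) - 2) := by
        gcongr
        exact hS.trans hτf
    _ = (2 : ℝ) ^ (-1 : ℝ) := by
        rw [hz, ← Real.rpow_add two_pos]
        congr 1
        ring
    _ < 1 := by
        rw [Real.rpow_neg_one]
        norm_num

/-! ### Non-vanishing and independence of choices -/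

section Independence

open DirichletCharacter

/-- By the functional equation, `L(χ, 1 - m)` does not vanish for even primitive `χ` and even
`m > 0`, since neither `L(χ⁻¹, m)` nor the gamma factor at `1 - m` has a zero or pole. -/
theorem LFunction_one_sub_ne_zero {M : ℕ} [NeZero M] {χ : DirichletCharacter ℂ M} (hχ : χ.Even)
    (hp : χ.IsPrimitive) {n : ℕ} (hn : _root_.Even n) : LFunction χ (1 - (n + 2 : ℕ)) ≠ 0 := by
  have hinv : χ⁻¹.Even := by
    have h : χ (-1) = 1 := hχ
    unfold DirichletCharacter.Even
    rw [MulChar.inv_apply_eq_inv', h, inv_one]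
  intro h0
  have hs0 : (1 : ℂ) - (n + 2 : ℕ) ≠ 0 := by
    have : (1 : ℂ) - (n + 2 : ℕ) = -((n + 1 : ℕ) : ℂ) := by push_cast; ring
    rw [this, neg_ne_zero]
    exact Nat.cast_ne_zero.2 (by omega)
  have hΓ : Complex.Gammaℝ (1 - (n + 2 : ℕ)) ≠ 0 := by
    rw [Ne, Complex.Gammaℝ_eq_zero_iff]
    rintro ⟨k, hk⟩
    have h1 : ((n + 1 : ℕ) : ℂ) = (2 * k : ℕ) := by
      push_cast at hk ⊢
      linear_combination -hk
    have h2 : n + 1 = 2 * k := by exact_mod_cast h1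
    obtain ⟨l, rfl⟩ := hn
    omega
  rw [LFunction_eq_completed_div_gammaFactor _ _ (Or.inl hs0), hχ.gammaFactor_def,
    div_eq_zero_iff, or_iff_left hΓ] at h0
  have hp' : χ⁻¹.IsPrimitive := by
    rwa [isPrimitive_def, conductor_inv]
  have h1 := hp'.completedLFunction_one_sub (1 - (n + 2 : ℕ))
  rw [inv_inv, h0, mul_zero, sub_sub_cancel] at h1
  refine LFunction_ne_zero_of_one_le_re χ⁻¹ (s := (n + 2 : ℕ)) (Or.inr ?_) ?_ ?_
  · norm_cast
    omega
  · rw [Complex.natCast_re]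
    push_cast
    linarith [(Nat.cast_nonneg n : (0 : ℝ) ≤ n)]
  · rw [LFunction_eq_completed_div_gammaFactor _ _ (Or.inl ?_), h1, zero_div]
    norm_cast

theorem even_primitiveCharacter {M : ℕ} {χ : DirichletCharacter ℂ M} (hχ : χ.Even) :
    χ.primitiveCharacter.Even := by
  have h := χ.primitiveCharacter_apply_of_isCoprime (a := -1) isCoprime_one_left.neg_left
  unfold DirichletCharacter.Even at *
  push_cast at h
  rw [h, hχ]

theorem primLFunction_ne_zero {M : ℕ} [NeZero M] {χ : DirichletCharacter ℂ M} (hχ : χ.Even)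
    {n : ℕ} (hn : _root_.Even n) : primLFunction χ (1 - (n + 2 : ℕ)) ≠ 0 := by
  have : NeZero χ.conductor := ⟨conductor_ne_zero _⟩
  exact LFunction_one_sub_ne_zero (even_primitiveCharacter hχ) χ.primitiveCharacter_isPrimitive hn

theorem exists_primLFunction_eq {M : ℕ} [NeZero M] (χ : DirichletCharacter ℂ M) (n : ℕ) :
    ∃ x : algebraicClosure ℚ ℂ, primLFunction χ (1 - (n + 2 : ℕ)) = x := by
  have : NeZero χ.conductor := ⟨conductor_ne_zero _⟩
  exact ⟨algL χ.primitiveCharacter (n + 2), (coe_algL _ _).symm⟩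

theorem isAlgebraic_primLFunction {M : ℕ} [NeZero M] (χ : DirichletCharacter ℂ M) (n : ℕ) :
    IsAlgebraic ℚ (primLFunction χ (1 - (n + 2 : ℕ))) := by
  obtain ⟨x, hx⟩ := exists_primLFunction_eq χ n
  rw [hx]
  exact (mem_algebraicClosure_iff).1 x.2

variable {d : ℕ} [NeZero d]

/-- `L(ψ_d, 1 - m)` is rational, as the values of `ψ_d` are. -/
theorem exists_rat_primLFunction_quadChar (n : ℕ) :
    ∃ r : ℚ, primLFunction (quadChar d) (1 - (n + 2 : ℕ)) = r := by
  have : NeZero (quadChar d).conductor := ⟨conductor_ne_zero _⟩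
  have hval : ∀ a, ∃ r : ℚ, (quadChar d).primitiveCharacter a = r := by
    intro a
    by_cases ha : IsUnit a
    · obtain ⟨u, rfl⟩ := ha
      obtain ⟨v, rfl⟩ := ZMod.unitsMap_surjective (quadChar d).conductor_dvd_level u
      refine ⟨((if _root_.Odd (v : ZMod (4 * d)).val then
        jacobiSym d (v : ZMod (4 * d)).val else 0 : ℤ) : ℚ), ?_⟩
      have h := changeLevel_eq_cast_of_dvd (quadChar d).primitiveCharacter
        (quadChar d).conductor_dvd_level v
      rw [changeLevel_primitiveCharacter] at h
      rw [ZMod.unitsMap_val, ← h, Rat.cast_intCast]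
      rfl
    · exact ⟨0, by rw [MulChar.map_nonunit _ ha, Rat.cast_zero]⟩
  choose r hr using hval
  refine ⟨bernVal r (n + 2), ?_⟩
  have h := map_bernVal (algebraMap ℚ ℂ) r (n + 2)
  rw [eq_ratCast] at h
  rw [h]
  change LFunction (quadChar d).primitiveCharacter (1 - (n + 2 : ℕ)) = _
  rw [LFunction_eq_bernVal]
  congr 1
  funext a
  exact hr a

theorem ord2_ratCast (ι ι' : Embedding2) (r : ℚ) : ord2 ι (r : ℂ) = ord2 ι' (r : ℂ) := by
  have h : (r : ℂ) = ((r : algebraicClosure ℚ ℂ) : ℂ) :=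
    (map_ratCast (algebraMap (algebraicClosure ℚ ℂ) ℂ) r).symm
  rw [h, ord2_coe, ord2_coe, map_ratCast, map_ratCast]

/-- Rational polynomial expressions in primitive `2^j`-th roots of unity have norms that do not
depend on the root. -/
theorem norm_aeval_rat_eq {j : ℕ} (hj : 1 ≤ j) {z z' : PadicAlgCl 2}
    (hz : IsPrimitiveRoot z (2 ^ j)) (hz' : IsPrimitiveRoot z' (2 ^ j)) (P : Polynomial ℚ) :
    ‖Polynomial.aeval z P‖ = ‖Polynomial.aeval z' P‖ := by
  obtain ⟨b, hb, hP⟩ := IsLocalization.integerNormalization_spec (nonZeroDivisors ℤ) P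
  set Q := IsLocalization.integerNormalization (nonZeroDivisors ℤ) P
  have hb0 : (b : PadicAlgCl 2) ≠ 0 := Int.cast_ne_zero.2 (nonZeroDivisors.ne_zero hb)
  have key : ∀ w : PadicAlgCl 2, (b : PadicAlgCl 2) * Polynomial.aeval w P =
      Q.eval₂ (Int.castRingHom _) w := fun w => by
    have h : Polynomial.aeval w (Q.map (algebraMap ℤ ℚ)) = Q.eval₂ (Int.castRingHom _) w := by
      rw [Polynomial.aeval_def, Polynomial.eval₂_map]
      exact congrArg (fun f => Q.eval₂ f w) (RingHom.ext_int _ _)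
    rw [← h, hP, map_zsmul, zsmul_eq_mul]
  have h := norm_aeval_eq norm_two hj hz' hz Q
  rw [Polynomial.aeval_def, Polynomial.aeval_def,
    RingHom.ext_int (@algebraMap ℤ (PadicAlgCl 2) _ _ (_)) (Int.castRingHom _), ← key, ← key, norm_mul,
    norm_mul] at h
  exact mul_left_cancel₀ (norm_ne_zero_iff.2 hb0) h

/-- The values of `χ ψ_d` are rational multiples of powers of `χ(5)`, in a way that is
independent of the even character `χ`. -/
theorem exists_adicChar_twist_eq (j : ℕ) (a : ZMod (2 ^ (j + 2) * d)) :
    ∃ (c : ℚ) (i : ℕ), ∀ (ι : Embedding2) (χ : DirichletCharacter ℂ (2 ^ (j + 2))), χ.Even →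
      adicChar ι (liftTwo χ d * liftQuad j d) a = c * adicChar ι χ 5 ^ i := by
  by_cases ha : IsUnit a
  · obtain ⟨u, rfl⟩ := ha
    have hc := ZMod.val_coe_unit_coprime u
    set b := (u : ZMod (2 ^ (j + 2) * d)).val with hb
    have hub : (u : ZMod (2 ^ (j + 2) * d)) = b := (ZMod.natCast_zmod_val _).symm
    set v := ZMod.unitOfCoprime b (hc.of_dvd_right (Dvd.intro _ rfl)) with hv
    have hvb : (v : ZMod (2 ^ (j + 2))) = b := ZMod.coe_unitOfCoprime _ _
    obtain ⟨i, hi⟩ := eq_or_eq_neg_unitFive_pow v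
    refine ⟨(jacobiSym d b : ℤ), i, fun ι χ hχ => ?_⟩
    rw [hub, adicChar_mul_apply, adicChar_liftTwo_natCast ι χ hc, adicChar_liftQuad_natCast ι hc,
      mul_comm, Rat.cast_intCast, ← hvb]
    congr 1
    rcases hi with hi | hi
    · rw [hi, Units.val_pow_eq_pow_val, coe_unitFive, map_pow]
    · rw [hi, Units.val_neg, Units.val_pow_eq_pow_val, coe_unitFive, (even_adicChar ι hχ).eval_neg,
        map_pow]
  · exact ⟨0, 0, fun ι χ _ => by rw [MulChar.map_nonunit _ ha, Rat.cast_zero, zero_mul]⟩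

/-- The order of `L(χ ψ_d, 1 - m)` depends neither on the place nor on the character `χ` of
exact level `j`: the prime `2` is totally ramified in `ℚ(μ_{2^j})`. -/
theorem norm_algL_twist_eq {j : ℕ} (hj : 1 ≤ j) (ι ι' : Embedding2)
    {χ χ' : DirichletCharacter ℂ (2 ^ (j + 2))} (hχ : χ.Even) (hχ' : χ'.Even)
    (hz : IsPrimitiveRoot (χ 5) (2 ^ j)) (hz' : IsPrimitiveRoot (χ' 5) (2 ^ j)) (m : ℕ) :
    ‖ι (algL (liftTwo χ d * liftQuad j d) m)‖ = ‖ι' (algL (liftTwo χ' d * liftQuad j d) m)‖ := by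
  choose c i h using exists_adicChar_twist_eq (d := d) j
  set P : Polynomial ℚ := Polynomial.C (-(((2 ^ (j + 2) * d : ℕ) : ℚ) ^ (m - 1) / m)) *
    ∑ a : ZMod (2 ^ (j + 2) * d), Polynomial.C (c a) * Polynomial.X ^ i a *
      Polynomial.C ((Polynomial.bernoulli m).eval (a.val / (2 ^ (j + 2) * d : ℕ) : ℚ)) with hP
  have key : ∀ (ι : Embedding2) {χ : DirichletCharacter ℂ (2 ^ (j + 2))}, χ.Even →
      ι (algL (liftTwo χ d * liftQuad j d) m) = Polynomial.aeval (adicChar ι χ 5) P := by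
    intro ι χ hχ
    rw [map_algL, bernVal, hP]
    simp only [map_mul, map_sum, Polynomial.aeval_C, map_pow, Polynomial.aeval_X, eq_ratCast,
      h _ ι χ hχ]
    push_cast
    rfl
  rw [key ι hχ, key ι' hχ']
  exact norm_aeval_rat_eq hj (isPrimitiveRoot_adicChar ι hz) (isPrimitiveRoot_adicChar ι' hz') P

theorem ord2_twistedL_eq (hd : _root_.Odd d) (hsq : Squarefree d) {j : ℕ} (hj : 1 ≤ j)
    (ι ι' : Embedding2) {χ χ' : DirichletCharacter ℂ (2 ^ (j + 2))} (hχ : χ.Even) (hχ' : χ'.Even)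
    (hz : IsPrimitiveRoot (χ 5) (2 ^ j)) (hz' : IsPrimitiveRoot (χ' 5) (2 ^ j)) (n : ℕ) :
    ord2 ι (twistedL χ d (1 - (n + 2 : ℕ))) = ord2 ι' (twistedL χ' d (1 - (n + 2 : ℕ))) := by
  have h1 : ∀ {w : ℂ}, IsPrimitiveRoot w (2 ^ j) → w ≠ 1 := fun hw =>
    hw.ne_one (Nat.one_lt_two_pow (by omega))
  rw [twistedL_eq_algL hd hsq (h1 hz), twistedL_eq_algL hd hsq (h1 hz'), ord2_coe, ord2_coe,
    norm_algL_twist_eq hj ι ι' hχ hχ' hz hz']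

theorem hasOrd2_twistedL (hd : _root_.Odd d) (hsq : Squarefree d) (ι : Embedding2) {j : ℕ}
    (hj : 1 ≤ j) (hjp : ∀ p ∈ d.primeFactors, fp p + 2 ≤ j)
    (hjS : (2 : ℝ) ^ (1 - (j : ℤ)) * sumFp d < 1) {χ : DirichletCharacter ℂ (2 ^ (j + 2))}
    (hχ : χ.Even) (hz : IsPrimitiveRoot (χ 5) (2 ^ j)) {n : ℕ} (hn : _root_.Even n) :
    HasOrd2 ι (twistedL χ d (1 - (n + 2 : ℕ)))
      (1 + (2 : ℝ) ^ (1 - (j : ℤ)) * (-1 + sumFp d)) := by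
  rw [twistedL_eq_algL hd hsq (hz.ne_one (Nat.one_lt_two_pow (by omega))), hasOrd2_coe_iff]
  exact norm_algL_twist hd ι hj hjp hjS hχ hz hn

end Independence

/-! ### The order of the zeta values of the layers -/

section ZetaOrder

open DirichletCharacter

theorem HasOrd2.mul {ι : Embedding2} {x y : ℂ} {r s : ℝ} (hx : HasOrd2 ι x r)
    (hy : HasOrd2 ι y s) : HasOrd2 ι (x * y) (r + s) := by
  obtain ⟨x, rfl⟩ : ∃ a : algebraicClosure ℚ ℂ, (a : ℂ) = x :=
    ⟨⟨x, mem_algebraicClosure_iff.2 hx.1⟩, rfl⟩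
  obtain ⟨y, rfl⟩ : ∃ a : algebraicClosure ℚ ℂ, (a : ℂ) = y :=
    ⟨⟨y, mem_algebraicClosure_iff.2 hy.1⟩, rfl⟩
  rw [hasOrd2_coe_iff] at hx hy
  rw [← MulMemClass.coe_mul, hasOrd2_coe_iff, map_mul, norm_mul, hx, hy, ← Real.rpow_add two_pos]
  congr 1
  ring

theorem HasOrd2.prod {ι : Embedding2} {α : Type*} (s : Finset α) {f : α → ℂ} {r : α → ℝ}
    (h : ∀ i ∈ s, HasOrd2 ι (f i) (r i)) : HasOrd2 ι (∏ i ∈ s, f i) (∑ i ∈ s, r i) := by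
  classical
  induction s using Finset.induction_on with
  | empty =>
    rw [Finset.prod_empty, Finset.sum_empty]
    have h1 : (1 : ℂ) = ((1 : algebraicClosure ℚ ℂ) : ℂ) := rfl
    rw [h1, hasOrd2_coe_iff, map_one, norm_one, neg_zero, Real.rpow_zero]
  | insert a s ha ih =>
    rw [Finset.prod_insert ha, Finset.sum_insert ha]
    exact (h a (Finset.mem_insert_self a s)).mul
      (ih fun i hi => h i (Finset.mem_insert_of_mem hi))

theorem hasOrd2_natCast (ι : Embedding2) {k : ℕ} (hk : k ≠ 0) :
    HasOrd2 ι (k : ℂ) (padicValNat 2 k) := by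
  have h : (k : ℂ) = ((k : algebraicClosure ℚ ℂ) : ℂ) := rfl
  rw [h, hasOrd2_coe_iff, map_natCast, norm_natCast_eq norm_two hk, Real.rpow_neg zero_le_two,
    Real.rpow_natCast, one_div, inv_pow]

theorem ord2_div_four_mul (ι : Embedding2) {x : ℂ} (hx : IsAlgebraic ℚ x) (hx0 : x ≠ 0) {m : ℕ}
    (hm : m ≠ 0) : ord2 ι (x / (4 * m)) = ord2 ι x - 2 - padicValNat 2 m := by
  have : Fact (Nat.Prime 2) := ⟨Nat.prime_two⟩
  have hm' : (4 : ℂ) * m ≠ 0 := mul_ne_zero (by norm_num) (Nat.cast_ne_zero.2 hm)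
  have hy : HasOrd2 ι (x / (4 * m)) (ord2 ι (x / (4 * m))) := by
    refine ⟨?_, div_ne_zero hx0 hm', rfl⟩
    rw [← mem_algebraicClosure_iff] at hx ⊢
    exact div_mem hx (mul_mem (ofNat_mem _ 4) (natCast_mem _ m))
  have h4 : padicValNat 2 (4 * m) = 2 + padicValNat 2 m := by
    rw [padicValNat.mul (by norm_num) hm, show 4 = 2 ^ 2 by norm_num, padicValNat.prime_pow]
  have h := (hy.mul (hasOrd2_natCast ι (k := 4 * m) (by omega))).2.2
  have e : x / (4 * m) * ((4 * m : ℕ) : ℂ) = x := by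
    push_cast
    exact div_mul_cancel₀ x hm'
  rw [e, h4] at h
  rw [h]
  push_cast
  ring

theorem evenChars_zero : evenChars 0 = {1} := by
  obtain ⟨χ, hχ⟩ := Finset.card_eq_one.1 ((card_evenChars 0).trans (pow_zero 2))
  have h1 : (1 : DirichletCharacter ℂ (2 ^ (0 + 2))) ∈ evenChars 0 := mem_evenChars.2 (even_one _)
  rw [hχ, Finset.mem_singleton] at h1
  rw [hχ, ← h1]

theorem level_dvd_succ (k : ℕ) : 2 ^ (k + 2) ∣ 2 ^ (k + 1 + 2) := Nat.pow_dvd_pow 2 (by omega)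

/-- Sums over the even characters, arranged by exact level: there are `2^(k-1)` even characters of
exact level `k`. -/
theorem sum_evenChars {f : ∀ k : ℕ, DirichletCharacter ℂ (2 ^ (k + 2)) → ℝ} {g : ℕ → ℝ}
    (hf : ∀ k χ, f (k + 1) (changeLevel (level_dvd_succ k) χ) = f k χ)
    (hg : ∀ k χ, 1 ≤ k → χ.Even → IsPrimitiveRoot (χ 5) (2 ^ k) → f k χ = g k) (n : ℕ) :
    ∑ χ ∈ evenChars n, f n χ = f 0 1 + ∑ k ∈ Finset.Icc 1 n, 2 ^ (k - 1) * g k := by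
  classical
  induction n with
  | zero => rw [evenChars_zero, Finset.sum_singleton, Finset.Icc_eq_empty (by omega),
      Finset.sum_empty, add_zero]
  | succ n ih =>
    have hinj : Function.Injective (changeLevel (R := ℂ) (level_dvd_succ n)) :=
      changeLevel_injective _
    set A := (evenChars n).image (changeLevel (level_dvd_succ n)) with hA
    have hAsub : A ⊆ evenChars (n + 1) := by
      intro χ hχ
      obtain ⟨χ', h, rfl⟩ := Finset.mem_image.1 hχ
      exact mem_evenChars.2 (even_changeLevel _ (mem_evenChars.1 h))
    have hcard : (evenChars (n + 1) \ A).card = 2 ^ n := by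
      rw [Finset.card_sdiff_of_subset hAsub, card_evenChars, Finset.card_image_of_injective _ hinj,
        card_evenChars, pow_succ]
      omega
    have hnew : ∀ χ ∈ evenChars (n + 1) \ A, f (n + 1) χ = g (n + 1) := by
      intro χ hχ
      obtain ⟨h1, h2⟩ := Finset.mem_sdiff.1 hχ
      rw [mem_evenChars] at h1
      refine hg (n + 1) χ (by omega) h1 ?_
      have : Fact (Nat.Prime 2) := ⟨Nat.prime_two⟩
      rw [IsPrimitiveRoot.iff_orderOf]
      refine orderOf_eq_prime_pow (fun h => h2 ?_) (char_five_pow χ)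
      obtain ⟨χ', h3, -, h4⟩ := exists_changeLevel_eq (Nat.le_succ n) h1 h
      exact Finset.mem_image.2 ⟨χ', mem_evenChars.2 h3, h4⟩
    rw [← Finset.sum_sdiff hAsub, Finset.sum_congr rfl hnew, Finset.sum_const, hcard, hA,
      Finset.sum_image fun _ _ _ _ h => hinj h, Finset.sum_congr rfl fun χ _ => hf n χ, ih,
      Finset.sum_Icc_succ_top (by omega), Nat.add_sub_cancel, nsmul_eq_mul]
    push_cast
    ring

theorem sum_two_pow_mul_one_sub (n : ℕ) :
    ∑ k ∈ Finset.Icc 1 n, (2 : ℝ) ^ (k - 1) * (1 - (2 : ℝ) ^ (1 - (k : ℤ))) = 2 ^ n - 1 - n := by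
  induction n with
  | zero => simp
  | succ n ih =>
    have e : (1 : ℤ) - ((n + 1 : ℕ) : ℤ) = -n := by push_cast; ring
    rw [Finset.sum_Icc_succ_top (by omega), ih, Nat.add_sub_cancel, e, zpow_neg, zpow_natCast,
      mul_sub, mul_inv_cancel₀ (by positivity), pow_succ]
    push_cast
    ring

/-- The orders of the zeta values of the layers of `ℚ_cyc`. -/
theorem hasOrd2_prod_primLFunction (ι : Embedding2) {n : ℕ} (hn : _root_.Even n) (k : ℕ) :
    HasOrd2 ι (∏ χ ∈ evenChars k, primLFunction χ (1 - (n + 2 : ℕ)))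
      (2 ^ k - k - 2 - padicValNat 2 (n + 2)) := by
  have h : HasOrd2 ι (∏ χ ∈ evenChars k, primLFunction χ (1 - (n + 2 : ℕ)))
      (∑ χ ∈ evenChars k, ord2 ι (primLFunction χ (1 - (n + 2 : ℕ)))) :=
    HasOrd2.prod _ fun χ hχ =>
      ⟨isAlgebraic_primLFunction χ n, primLFunction_ne_zero (mem_evenChars.1 hχ) hn, rfl⟩
  rw [sum_evenChars (f := fun _ χ => ord2 ι (primLFunction χ (1 - (n + 2 : ℕ))))
      (g := fun k => 1 - (2 : ℝ) ^ (1 - (k : ℤ)))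
      (fun k χ => by rw [primLFunction_changeLevel])
      (fun k χ hk he hz => (hasOrd2_primLFunction ι hn hk he hz).2.2),
    (hasOrd2_primLFunction_one ι hn).2.2, sum_two_pow_mul_one_sub] at h
  convert h using 1
  ring

variable {d : ℕ} [NeZero d]

theorem twistedL_changeLevel {k : ℕ} (χ : DirichletCharacter ℂ (2 ^ (k + 2))) (s : ℂ) :
    twistedL (n := k + 1) (changeLevel (level_dvd_succ k) χ) d s = twistedL χ d s := by
  have h : 2 ^ (k + 2) * d ∣ 2 ^ (k + 1 + 2) * d := Nat.mul_dvd_mul_right (level_dvd_succ k) d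
  rw [twistedL_eq, twistedL_eq, ← primLFunction_changeLevel h, map_mul, liftTwo, liftTwo, liftQuad,
    liftQuad, ← changeLevel_trans, ← changeLevel_trans, ← changeLevel_trans]

theorem twistedL_one (k : ℕ) (s : ℂ) :
    twistedL (1 : DirichletCharacter ℂ (2 ^ (k + 2))) d s = primLFunction (quadChar d) s := by
  rw [twistedL_eq, liftTwo, map_one, one_mul, liftQuad, primLFunction_changeLevel]

theorem isAlgebraic_twistedL {k : ℕ} (χ : DirichletCharacter ℂ (2 ^ (k + 2))) (n : ℕ) :
    IsAlgebraic ℚ (twistedL χ d (1 - (n + 2 : ℕ))) := by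
  rw [twistedL_eq]
  exact isAlgebraic_primLFunction _ n

theorem twistedL_ne_zero (hd : _root_.Odd d) {k : ℕ} {χ : DirichletCharacter ℂ (2 ^ (k + 2))}
    (hχ : χ.Even) {n : ℕ} (hn : _root_.Even n) : twistedL χ d (1 - (n + 2 : ℕ)) ≠ 0 := by
  rw [twistedL_eq]
  exact primLFunction_ne_zero (even_liftTwo_mul_liftQuad hd hχ) hn

/-- The constant does not change when the starting index grows. -/
theorem nuPrime_eq_of_le {ι : Embedding2} {χ : ∀ n : ℕ, DirichletCharacter ℂ (2 ^ (n + 2))}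
    {m N : ℕ} (h : IsAdmissible ι χ m d N) {k : ℕ} (hk : N ≤ k) :
    nuPrime ι χ m d k = nuPrime ι χ m d N := by
  induction k, hk using Nat.le_induction with
  | base => rfl
  | succ k hk ih =>
    have e : (1 : ℤ) - ((k + 1 : ℕ) : ℤ) = -k := by push_cast; ring
    have hcancel : (2 : ℝ) ^ k * (2 : ℝ) ^ (-(k : ℤ)) = 1 := by
      rw [zpow_neg, zpow_natCast, mul_inv_cancel₀ (by positivity)]
    rw [← ih, nuPrime, nuPrime, Finset.sum_Icc_succ_top (by omega), (h.2 (k + 1) (by omega)).2.2,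
      Nat.add_sub_cancel, e, pow_succ]
    push_cast
    linear_combination (-1 + sumFp d) * hcancel

variable (hd : _root_.Odd d) (hsq : Squarefree d)
include hd hsq

/-- The constant depends neither on the place nor on the characters. -/
theorem nuPrime_eq (ι ι' : Embedding2) {χ χ' : ∀ n : ℕ, DirichletCharacter ℂ (2 ^ (n + 2))}
    (hχ : ∀ n : ℕ, 1 ≤ n → IsLayerChar (χ n)) (hχ' : ∀ n : ℕ, 1 ≤ n → IsLayerChar (χ' n))
    {n : ℕ} (hn : _root_.Even n) (N : ℕ) :
    nuPrime ι χ (n + 2) d N = nuPrime ι' χ' (n + 2) d N := by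
  have h1 : ∑ k ∈ Finset.Icc 1 N, 2 ^ (k - 1) * ord2 ι (twistedL (χ k) d (1 - (n + 2 : ℕ))) =
      ∑ k ∈ Finset.Icc 1 N, 2 ^ (k - 1) * ord2 ι' (twistedL (χ' k) d (1 - (n + 2 : ℕ))) := by
    refine Finset.sum_congr rfl fun k hk => ?_
    have hk1 := (Finset.mem_Icc.1 hk).1
    rw [ord2_twistedL_eq hd hsq hk1 ι ι' (hχ k hk1).1 (hχ' k hk1).1 ((hχ k hk1).isPrimitiveRoot hk1)
      ((hχ' k hk1).isPrimitiveRoot hk1)]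
  obtain ⟨r, hr⟩ := exists_rat_primLFunction_quadChar (d := d) n
  have halg := isAlgebraic_primLFunction (quadChar d) n
  have hne := primLFunction_ne_zero (even_quadChar hd) hn
  rw [nuPrime, nuPrime, h1, ord2_div_four_mul ι halg hne (by omega),
    ord2_div_four_mul ι' halg hne (by omega), hr, ord2_ratCast ι ι']

/-- The orders of the zeta values of the layers of the cyclotomic extension of `ℚ(√d)`. -/
theorem hasOrd2_prod_quad {ι : Embedding2} {χ : ∀ n : ℕ, DirichletCharacter ℂ (2 ^ (n + 2))}
    (hχ : ∀ n : ℕ, 1 ≤ n → IsLayerChar (χ n)) {n : ℕ} (hn : _root_.Even n) {N : ℕ}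
    (hN : IsAdmissible ι χ (n + 2) d N) {k : ℕ} (hk : N ≤ k) :
    HasOrd2 ι (∏ χ ∈ evenChars k,
        (primLFunction χ (1 - (n + 2 : ℕ)) * twistedL χ d (1 - (n + 2 : ℕ))))
      (2 * 2 ^ k + (-2 + sumFp d) * k + nuPrime ι χ (n + 2) d N) := by
  have h : HasOrd2 ι (∏ χ ∈ evenChars k, twistedL χ d (1 - (n + 2 : ℕ)))
      (∑ χ ∈ evenChars k, ord2 ι (twistedL χ d (1 - (n + 2 : ℕ)))) :=
    HasOrd2.prod _ fun χ hχ =>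
      ⟨isAlgebraic_twistedL χ n, twistedL_ne_zero hd (mem_evenChars.1 hχ) hn, rfl⟩
  rw [sum_evenChars (f := fun _ χ => ord2 ι (twistedL χ d (1 - (n + 2 : ℕ))))
      (g := fun k => ord2 ι (twistedL (χ k) d (1 - (n + 2 : ℕ))))
      (fun k χ => by rw [twistedL_changeLevel])
      (fun k η hk he hz => ord2_twistedL_eq hd hsq hk ι ι he (hχ k hk).1 hz
        ((hχ k hk).isPrimitiveRoot hk) n), twistedL_one] at h
  rw [Finset.prod_mul_distrib, ← nuPrime_eq_of_le hN hk, nuPrime,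
    ord2_div_four_mul ι (isAlgebraic_primLFunction (quadChar d) n)
      (primLFunction_ne_zero (even_quadChar hd) hn) (by omega)]
  convert (hasOrd2_prod_primLFunction ι hn k).mul h using 1
  ring

end ZetaOrder

end TwoAdicZeta

end

theorem theorem3p11 (m : ℕ) (hm : 0 < m) (hm2 : Even m) :
    -- (1) the layers of the cyclotomic extension of the rationals
    (∀ n : ℕ, (∃! E, TwoAdicZeta.IsLayer ⊥ n E) ∧
      ∀ (E : IntermediateField ℚ ℂ) [NumberField E], TwoAdicZeta.IsLayer ⊥ n E →
        ∃ Z : ℂ → ℂ, TwoAdicZeta.IsDedekindZeta E Z ∧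
          ∀ ι : TwoAdicZeta.Embedding2,
            TwoAdicZeta.HasOrd2 ι (Z (1 - m)) ((2 : ℝ) ^ n - n - 2 - padicValNat 2 m)) ∧
    -- (2) the layers of the cyclotomic extension of a real quadratic field
    (∀ (d : ℕ) [NeZero d], 1 < d → Odd d → Squarefree d →
      -- the layers are well defined
      (∀ n : ℕ, ∃! E, TwoAdicZeta.IsLayer (TwoAdicZeta.quadField d) n E) ∧
      -- the L-values that enter the constant are non-zero algebraic numbers
      (IsAlgebraic ℚ (TwoAdicZeta.primLFunction (TwoAdicZeta.quadChar d) (1 - m)) ∧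
        TwoAdicZeta.primLFunction (TwoAdicZeta.quadChar d) (1 - m) ≠ 0) ∧
      (∀ (n : ℕ) (χ : DirichletCharacter ℂ (2 ^ (n + 2))), 1 ≤ n → TwoAdicZeta.IsLayerChar χ →
        IsAlgebraic ℚ (TwoAdicZeta.twistedL χ d (1 - m)) ∧
          TwoAdicZeta.twistedL χ d (1 - m) ≠ 0) ∧
      -- the explicit bound can be taken as the starting index
      (∀ (ι : TwoAdicZeta.Embedding2) (χ : ∀ n : ℕ, DirichletCharacter ℂ (2 ^ (n + 2))),
        (∀ n : ℕ, 1 ≤ n → TwoAdicZeta.IsLayerChar (χ n)) →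
          TwoAdicZeta.IsAdmissible ι χ m d (TwoAdicZeta.explicitBound d)) ∧
      -- the zeta values, with a constant depending only on `m` and `d`
      ∃ ν : ℝ, ∀ (ι : TwoAdicZeta.Embedding2)
        (χ : ∀ n : ℕ, DirichletCharacter ℂ (2 ^ (n + 2))),
        (∀ n : ℕ, 1 ≤ n → TwoAdicZeta.IsLayerChar (χ n)) →
        ∀ N : ℕ, TwoAdicZeta.IsAdmissible ι χ m d N →
          ν = TwoAdicZeta.nuPrime ι χ m d N ∧
          ∀ n : ℕ, N ≤ n →
            ∀ (E : IntermediateField ℚ ℂ) [NumberField E],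
              TwoAdicZeta.IsLayer (TwoAdicZeta.quadField d) n E →
              ∃ Z : ℂ → ℂ, TwoAdicZeta.IsDedekindZeta E Z ∧
                TwoAdicZeta.HasOrd2 ι (Z (1 - m))
                  (2 * (2 : ℝ) ^ n + (-2 + TwoAdicZeta.sumFp d) * n + ν)) := by
  obtain ⟨n, rfl⟩ : ∃ n, m = n + 2 := by
    obtain ⟨l, rfl⟩ := hm2
    exact ⟨l + l - 2, by omega⟩
  have hn : Even n := by
    rwa [Nat.even_add, iff_true_right even_two] at hm2
  refine ⟨fun k => ⟨⟨TwoAdicZeta.realCyc k, TwoAdicZeta.isLayer_bot_iff.2 rfl, fun E hE =>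
    TwoAdicZeta.isLayer_bot_iff.1 hE⟩, fun E _ hE => ?_⟩, fun d _ hd1 hd hsq => ?_⟩
  · obtain rfl := TwoAdicZeta.isLayer_bot_iff.1 hE
    exact ⟨_, TwoAdicZeta.isDedekindZeta_realCyc k, fun ι =>
      TwoAdicZeta.hasOrd2_prod_primLFunction ι hn k⟩
  refine ⟨fun k => ⟨TwoAdicZeta.quadField d ⊔ TwoAdicZeta.realCyc k,
      (TwoAdicZeta.isLayer_quadField_iff hd hsq hd1).2 rfl, fun E hE =>
      (TwoAdicZeta.isLayer_quadField_iff hd hsq hd1).1 hE⟩,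
    ⟨TwoAdicZeta.isAlgebraic_primLFunction _ n,
      TwoAdicZeta.primLFunction_ne_zero (TwoAdicZeta.even_quadChar hd) hn⟩,
    fun k χ _ hχ => ⟨TwoAdicZeta.isAlgebraic_twistedL χ n,
      TwoAdicZeta.twistedL_ne_zero hd hχ.1 hn⟩,
    fun ι χ hχ => ⟨(TwoAdicZeta.explicitBound_spec hd1 le_rfl).1, fun k hk => ?_⟩, ?_⟩
  · obtain ⟨hk1, hk2, hk3⟩ := TwoAdicZeta.explicitBound_spec hd1 hk
    exact TwoAdicZeta.hasOrd2_twistedL hd hsq ι hk1 hk2 hk3 (hχ k hk1).1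
      ((hχ k hk1).isPrimitiveRoot hk1) hn
  -- the constant can be computed with any one choice of a place and of characters
  obtain ⟨ν, hν⟩ : ∃ ν : ℝ, ∀ (ι : TwoAdicZeta.Embedding2)
      (χ : ∀ n : ℕ, DirichletCharacter ℂ (2 ^ (n + 2))),
      (∀ n : ℕ, 1 ≤ n → TwoAdicZeta.IsLayerChar (χ n)) →
      ∀ N : ℕ, TwoAdicZeta.IsAdmissible ι χ (n + 2) d N →
        ν = TwoAdicZeta.nuPrime ι χ (n + 2) d N := by
    by_cases h : ∃ (ι : TwoAdicZeta.Embedding2)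
        (χ : ∀ n : ℕ, DirichletCharacter ℂ (2 ^ (n + 2))) (N : ℕ),
        (∀ n : ℕ, 1 ≤ n → TwoAdicZeta.IsLayerChar (χ n)) ∧
        TwoAdicZeta.IsAdmissible ι χ (n + 2) d N
    · obtain ⟨ι₀, χ₀, N₀, hχ₀, hN₀⟩ := h
      refine ⟨TwoAdicZeta.nuPrime ι₀ χ₀ (n + 2) d N₀, fun ι χ hχ N hN => ?_⟩
      rw [← TwoAdicZeta.nuPrime_eq_of_le hN₀ (le_max_left N₀ N),
        ← TwoAdicZeta.nuPrime_eq_of_le hN (le_max_right N₀ N),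
        TwoAdicZeta.nuPrime_eq hd hsq ι₀ ι hχ₀ hχ hn]
    · exact ⟨0, fun ι χ hχ N hN => (h ⟨ι, χ, N, hχ, hN⟩).elim⟩
  refine ⟨ν, fun ι χ hχ N hN => ⟨hν ι χ hχ N hN, fun k hk E _ hE => ?_⟩⟩
  obtain rfl := (TwoAdicZeta.isLayer_quadField_iff hd hsq hd1).1 hE
  refine ⟨_, TwoAdicZeta.isDedekindZeta_quad_sup hd hsq hd1 k, ?_⟩
  rw [hν ι χ hχ N hN]
  exact TwoAdicZeta.hasOrd2_prod_quad hd hsq hχ hn hN hk
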